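/- Let $\mathbb{R}^4$ have coordinates $(t,z)=(t^1,t^2,z^1,z^2)$, and consider smooth metrics of arbitrary signature $$\mathbf{g}=b_{ij}(t)\,dt^i dt^j+2f_{ik}(t)\,dt^i dz^k+h_{kl}(t)\,dz^k dz^l,\qquad b_{ij}=b_{ji},\ h_{kl}=h_{lk},\ \det(h_{kl})\neq 0,$$ defined over open sets of values of $t=(t^1,t^2)$. Let $J^m\tau$ be the space of $m$-jets of such metrics, with coordinates $t^i$, $z^k$ and the partial derivatives of $b_{ij},f_{ik},h_{kl}$ with respect to $t^1,t^2$ of orders $0,\dots,m$. Let $\mathfrak{G}$ be the pseudogroup of local diffeomorphisms $P$ of $\mathbb{R}^4$ for which there is a constant matrix $(\alpha^i_j)\in\mathrm{GL}(2,\mathbb{R})$ with $P_*\,\partial/\partial z^j=\alpha^i_j\,\partial/\partial z^i$ (so that locally $\bar t^{\,i}=\phi^i(t)$, $\bar z^{\,i}=\alpha^i_j z^j+\psi^i(t)$ with $\det(\partial\phi^i/\partial t^j)\ne 0$). It acts on these metrics, and hence on $J^m\tau$ through its prolongation $\mathfrak{G}^{(m)}_\tau$. Let $\Xi^\perp$ be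 the distribution orthogonal, with respect to $\mathbf{g}$, to $\partial/\partial z^1$ and $\partial/\partial z^2$. Given a subspace $S\subseteq J^m\tau$, the generic dimension of the orbit space $S/\mathfrak{G}^{(m)}_\tau$ is said to be $N$ if $S$ has an invariant, open and dense subset on which all orbits of $\mathfrak{G}^{(m)}_\tau$ have one and the same dimension $d$, and $N=\dim S-d$. (a) (Orthogonally intransitive case.) Let $S$ be the set of $m$-jets, at points $x$, of metrics for which $\Xi^\perp$ is not integrable (over any neighbourhood of $x$). Then the generic dimension $N_m$ of the orbit space $S/\mathfrak{G}^{(m)}_\tau$ is $N_0=0$, $N_1=6$, $N_2=20$. (b) (Orthogonally transitive case.) Let $S$ be the set of $m$-jets of metrics for which $\Xi^\perp$ is integrable. Then the generic dimension $N_m$ of the orbit space $S/\mathfrak{G}^{(m)}_\tau$ is $N_0=0$, $N_1=4$, $N_2=14$. -/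

import Mathlib

open scoped ContDiff

noncomputable section

namespace GTwo

/-- The plane `ℝ²`. -/
abbrev Plane : Type := Fin 2 → ℝ

/-- The space `ℝ⁴` of adapted coordinates `(t, z) = ((t¹, t²), (z¹, z²))`. It is also the tangent
space at each of its points; the abelian algebra is spanned by `∂/∂z¹, ∂/∂z²`, and its leaves
are the surfaces `t = const`. -/
abbrev Space : Type := Plane × Plane

/-- The values at one point of the metric coefficients `(b_{ij}, f_{ik}, h_{kl})`, with
`b_{ij} = b_{ji}` and `h_{kl} = h_{lk}` (so that there are `3 + 4 + 3` of them). -/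
abbrev Coeff : Type := (Sym2 (Fin 2) → ℝ) × (Fin 2 → Fin 2 → ℝ) × (Sym2 (Fin 2) → ℝ)

def bMat (c : Coeff) : Matrix (Fin 2) (Fin 2) ℝ := Matrix.of fun i j => c.1 s(i, j)

def fMat (c : Coeff) : Matrix (Fin 2) (Fin 2) ℝ := Matrix.of fun i k => c.2.1 i k

def hMat (c : Coeff) : Matrix (Fin 2) (Fin 2) ℝ := Matrix.of fun k l => c.2.2 s(k, l)

/-- The Gram matrix of `b_{ij} dtⁱ dtʲ + 2 f_{ik} dtⁱ dzᵏ + h_{kl} dzᵏ dzˡ`. -/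
def gMat (c : Coeff) : Matrix (Fin 2 ⊕ Fin 2) (Fin 2 ⊕ Fin 2) ℝ :=
  Matrix.fromBlocks (bMat c) (fMat c) (fMat c).transpose (hMat c)

/-- The symmetric bilinear form `b_{ij} dtⁱ dtʲ + 2 f_{ik} dtⁱ dzᵏ + h_{kl} dzᵏ dzˡ`. -/
def gForm (c : Coeff) (u v : Space) : ℝ :=
  Sum.elim u.1 u.2 ⬝ᵥ (gMat c).mulVec (Sum.elim v.1 v.2)

/-- The coefficient functions `σ = (b, f, h)` of `t` define, over the set `Ω` of values of `t`,
a smooth (semi-Riemannian) metric of arbitrary signature, whose restriction to the leaves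
`t = const` is nondegenerate. -/
def IsMetricOn (σ : Plane → Coeff) (Ω : Set Plane) : Prop :=
  ContDiffOn ℝ ∞ σ Ω ∧ ∀ t ∈ Ω, (gMat (σ t)).det ≠ 0 ∧ (hMat (σ t)).det ≠ 0

/-- The fibre of the distribution `Ξ^⊥`: the vectors orthogonal to `∂/∂z¹, ∂/∂z²`. -/
def orthLeaf (c : Coeff) : Set Space := {v | ∀ w : Plane, gForm c v (0, w) = 0}

/-- `Ξ^⊥` is integrable over `Ω`: through every point `y` of `Ω × ℝ²` there passes an integral
manifold, i.e. a smoothly immersed surface `e : W → Ω × ℝ²` whose tangent spaces are the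
fibres of `Ξ^⊥`. -/
def OrthIntegrableOn (σ : Plane → Coeff) (Ω : Set Plane) : Prop :=
  ∀ y : Space, y.1 ∈ Ω → ∃ (W : Set Plane) (e : Plane → Space),
    IsOpen W ∧ ContDiffOn ℝ ∞ e W ∧ (∃ w ∈ W, e w = y) ∧
    ∀ w ∈ W, (e w).1 ∈ Ω ∧ Function.Injective (fderiv ℝ e w) ∧
      Set.range (fderiv ℝ e w) = orthLeaf (σ (e w).1)

/-- `∂σ/∂tⁱ`. -/
def partialDeriv (i : Fin 2) (σ : Plane → Coeff) : Plane → Coeff :=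
  fun t => fderiv ℝ σ t (Pi.single i 1)

/-- Multi-indices `(p, q)` with `p + q ≤ m`. -/
abbrev MultiIndex (m : ℕ) : Type := {p : Fin (m + 1) × Fin (m + 1) // (p.1 : ℕ) + p.2 ≤ m}

/-- The coordinates `(t, z)`, `b_{ij,I}`, `f_{ik,I}`, `h_{kl,I}`, `|I| ≤ m`, of jets of order `m`.
Jets of metrics form an open subset of this space. -/
abbrev JetSpace (m : ℕ) : Type := Space × (MultiIndex m → Coeff)

/-- The `m`-jet at the point `x` of the metric with coefficients `σ`. -/
def jet (m : ℕ) (σ : Plane → Coeff) (x : Space) : JetSpace m :=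
  (x, fun p => (partialDeriv 0)^[(p.1.1 : ℕ)] ((partialDeriv 1)^[(p.1.2 : ℕ)] σ) x.1)

/-- The `m`-jets of orthogonally intransitive metrics: the `m`-jets at `x` of metrics near `x`
for which `Ξ^⊥` is not integrable (over any neighbourhood of `x`). -/
def intransitiveJets (m : ℕ) : Set (JetSpace m) :=
  {θ | ∃ (x : Space) (Ω : Set Plane) (σ : Plane → Coeff), IsOpen Ω ∧ x.1 ∈ Ω ∧ IsMetricOn σ Ω ∧
    (∀ Ω' ⊆ Ω, IsOpen Ω' → x.1 ∈ Ω' → ¬ OrthIntegrableOn σ Ω') ∧ θ = jet m σ x}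

/-- The `m`-jets of orthogonally transitive metrics: the `m`-jets at `x` of metrics near `x`
for which `Ξ^⊥` is integrable. -/
def transitiveJets (m : ℕ) : Set (JetSpace m) :=
  {θ | ∃ (x : Space) (Ω : Set Plane) (σ : Plane → Coeff), IsOpen Ω ∧ x.1 ∈ Ω ∧ IsMetricOn σ Ω ∧
    OrthIntegrableOn σ Ω ∧ θ = jet m σ x}

/-- The pseudogroup `𝔊` of transformations of adapted coordinates: the local diffeomorphisms `P`
of `ℝ⁴` such that `P_* ∂/∂zʲ = αⁱⱼ ∂/∂zⁱ` with constants `α ∈ GL(2, ℝ)`. -/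
def IsAdapted (P : OpenPartialHomeomorph Space Space) : Prop :=
  ContDiffOn ℝ ∞ P P.source ∧ ContDiffOn ℝ ∞ P.symm P.target ∧
    ∃ α : GL (Fin 2) ℝ, ∀ x ∈ P.source, ∀ v : Plane,
      fderiv ℝ P x (0, v) = (0, α.val.mulVec v)

/-- The orbit of an `m`-jet `θ` under the prolonged pseudogroup `𝔊_τ^{(m)}`: `P ∈ 𝔊` carries the
`m`-jet at `x` of a metric `g` to the `m`-jet at `P x` of the metric `g'` with `P^* g' = g`. -/
def jetOrbit (m : ℕ) (θ : JetSpace m) : Set (JetSpace m) :=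
  {θ' | ∃ (P : OpenPartialHomeomorph Space Space) (x : Space) (σ σ' : Plane → Coeff),
    IsAdapted P ∧ x ∈ P.source ∧
    IsMetricOn σ (Prod.fst '' P.source) ∧ IsMetricOn σ' (Prod.fst '' P.target) ∧
    (∀ y ∈ P.source, ∀ u v : Space,
      gForm (σ' (P y).1) (fderiv ℝ P y u) (fderiv ℝ P y v) = gForm (σ y.1) u v) ∧
    θ = jet m σ x ∧ θ' = jet m σ' (P x)}

/-- `S` is the image of a smooth immersion of a second countable `d`-dimensional manifold, given
by the countably many charts `Ω n` of the latter. For nonempty `S` the number `d` is unique. -/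
def HasDimension {E : Type*} [NormedAddCommGroup E] [NormedSpace ℝ E] (S : Set E) (d : ℕ) : Prop :=
  ∃ (Ω : ℕ → Set (EuclideanSpace ℝ (Fin d))) (F : ℕ → EuclideanSpace ℝ (Fin d) → E),
    (∀ n, IsOpen (Ω n) ∧ ContDiffOn ℝ ∞ (F n) (Ω n) ∧
      ∀ p ∈ Ω n, Function.Injective (fderiv ℝ (F n) p)) ∧
    S = ⋃ n, F n '' Ω n

/-- The generic dimension of the orbit space `S / 𝔊_τ^{(m)}` is `N`: there is an invariant, open
and dense subset `U` of the nonempty space `S` of `m`-jets, such that the orbits of the points of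
`U` have one and the same dimension, which is smaller by `N` than the dimension of `S`. -/
def HasGenericOrbitSpaceDim (m : ℕ) (S : Set (JetSpace m)) (N : ℕ) : Prop :=
  S.Nonempty ∧ ∃ (D d : ℕ) (U : Set (JetSpace m)),
    HasDimension S D ∧
    (∃ O : Set (JetSpace m), IsOpen O ∧ U = S ∩ O) ∧ S ⊆ closure U ∧
    (∀ θ ∈ U, jetOrbit m θ ⊆ U) ∧
    (∀ θ ∈ U, HasDimension (jetOrbit m θ) d) ∧
    D = d + N

end GTwo

end

open Filter Topology Matrix

noncomputable section

/-! The `m`-jet of a pulled-back metric depends only on the `(m+1)`-jets of the functions `φ`, `ψ`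
in the transformation `(t, z) ↦ (φ(t), α z + ψ(t))` and on `α`. An orbit in `J^m τ` is therefore the
image of a smooth map `orbitMap` on an open set of a finite-dimensional space `OrbitParam m`: the
new point, `α`, and the derivatives of `φ`, `ψ` of orders `1, …, m+1` (`jetOrbit_eq`). If that map
is an immersion, the orbit has the dimension of `OrbitParam m`, and `N` is a difference of two
dimensions.

For `m ≥ 1` the immersion property is an infinitesimal rigidity statement (`rigidity`,
`orbitMap_immersion`). Completing the square writes a metric as a quotient metric `b - f h⁻¹ fᵀ`, a
connection `f h⁻¹` and a leaf metric `h`. Suppose an infinitesimal transformation `(ξ, ζ, a)` fixes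
the point and preserves the `m`-jet. Then the linear part `X` of `ξ` is skew for the quotient
metric, and `Y = a α⁻¹` is skew for `h`. The first derivatives of `h` tie `X` and `Y` together: if
`det h` has a nonzero gradient and some `∂ᵢh` is not a multiple of `h` (`Regular`), both vanish
(`regular_rigid`). A vector field satisfying the Killing equations modulo flat terms gains one order
of flatness (`flat_of_killing`), so `ξ` vanishes to order `m + 1`; the mixed block then forces the
same for `ζ`. Regular jets form an invariant open dense set (`regularJet_orbitMap`,
`isOpen_regularJet`, and the two `closure_regularJet` lemmas).

It remains to find the dimension of `S`. Integrability of `Ξ^⊥` means that the connection is closed,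
hence locally exact (`closed_of_orthIntegrableOn`, `exists_potential`, `orthIntegrableOn_of_exact`).
Non-integrability puts no condition on an `m`-jet, because a term of order `m + 1` can always create
curvature (`intransitiveJets_eq`): `S` is then the open set of all jets of metrics. In the
transitive case the jets are parametrized immersively by the `m`-jets of the quotient and leaf
metrics and the `(m+1)`-jet of a potential modulo constants (`transitiveJets_eq`,
`transMap_immersion`).

For `m = 0` both spaces `S` coincide, and `orbitMap` is a submersion, so all orbits are open
(`orbitMap_submersion`). -/

namespace GTwo

/-! ### Partial derivatives and functions that are flat to order `m` at a point. -/

section Flat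

variable {E F : Type*} [NormedAddCommGroup E] [NormedSpace ℝ E] [NormedAddCommGroup F]
  [NormedSpace ℝ F]

/-- The partial derivative `∂f/∂tⁱ`. -/
def pd (i : Fin 2) (f : Plane → E) : Plane → E := fun t => fderiv ℝ f t (Pi.single i 1)

lemma _root_.ContDiffAt.pd {f : Plane → E} {t : Plane} (hf : ContDiffAt ℝ ∞ f t) (i : Fin 2) :
    ContDiffAt ℝ ∞ (pd i f) t :=
  (hf.fderiv_right (m := ∞) (by simp)).clm_apply contDiffAt_const

lemma _root_.ContDiffAt.diff {X : Type*} [NormedAddCommGroup X] [NormedSpace ℝ X] {f : X → E} {t : X}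
    (hf : ContDiffAt ℝ ∞ f t) : DifferentiableAt ℝ f t :=
  hf.differentiableAt (by simp)

lemma _root_.ContDiffAt.eventually_diff {X : Type*} [NormedAddCommGroup X] [NormedSpace ℝ X] {f : X → E}
    {t : X} (hf : ContDiffAt ℝ ∞ f t) : ∀ᶠ s in 𝓝 t, DifferentiableAt ℝ f s :=
  ((hf.of_le (m := 1) (by simp)).eventually (by simp)).mono
    fun _ h => h.differentiableAt (by simp)

lemma pd_congr {f g : Plane → E} {t : Plane} (h : f =ᶠ[𝓝 t] g) (i : Fin 2) :
    pd i f =ᶠ[𝓝 t] pd i g :=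
  (h.fderiv (𝕜 := ℝ)).mono fun s hs => by simp only [pd, hs]

lemma pd_add {f g : Plane → E} {t : Plane} (hf : ContDiffAt ℝ ∞ f t) (hg : ContDiffAt ℝ ∞ g t)
    (i : Fin 2) : pd i (fun s => f s + g s) =ᶠ[𝓝 t] fun s => pd i f s + pd i g s := by
  filter_upwards [hf.eventually_diff, hg.eventually_diff] with s h1 h2
  simp [pd, fderiv_fun_add h1 h2]

lemma pd_sub {f g : Plane → E} {t : Plane} (hf : ContDiffAt ℝ ∞ f t) (hg : ContDiffAt ℝ ∞ g t)
    (i : Fin 2) : pd i (fun s => f s - g s) =ᶠ[𝓝 t] fun s => pd i f s - pd i g s := by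
  filter_upwards [hf.eventually_diff, hg.eventually_diff] with s h1 h2
  simp [pd, fderiv_fun_sub h1 h2]

lemma pd_mul {f g : Plane → ℝ} {t : Plane} (hf : ContDiffAt ℝ ∞ f t) (hg : ContDiffAt ℝ ∞ g t)
    (i : Fin 2) : pd i (fun s => f s * g s) =ᶠ[𝓝 t] fun s => pd i f s * g s + f s * pd i g s := by
  filter_upwards [hf.eventually_diff, hg.eventually_diff] with s h1 h2
  simp only [pd, fderiv_fun_mul h1 h2]
  simp
  ring

lemma pd_clm (L : E →L[ℝ] F) {f : Plane → E} {t : Plane} (hf : ContDiffAt ℝ ∞ f t)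
    (i : Fin 2) : pd i (fun s => L (f s)) =ᶠ[𝓝 t] fun s => L (pd i f s) := by
  filter_upwards [hf.eventually_diff] with s h1
  have := (L.hasFDerivAt.comp s h1.hasFDerivAt).fderiv
  simp only [Function.comp_def] at this
  simp [pd, this]

lemma plane_decomp (u : Plane) : u = ∑ j, u j • (Pi.single j 1 : Plane) := by
  ext k; fin_cases k <;> simp

lemma fderiv_eq_sum_pd (f : Plane → E) (t u : Plane) :
    fderiv ℝ f t u = ∑ j, u j • pd j f t := by
  conv_lhs => rw [plane_decomp u]
  simp [pd]

lemma pd_apply {ι : Type*} [Fintype ι] {φ : Plane → ι → ℝ} {t : Plane}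
    (hφ : DifferentiableAt ℝ φ t) (i : Fin 2) (j : ι) :
    pd i φ t j = pd i (fun s => φ s j) t := by
  have := ((ContinuousLinearMap.proj (R := ℝ) (φ := fun _ : ι => ℝ) j).hasFDerivAt.comp t
    hφ.hasFDerivAt).fderiv
  simp only [Function.comp_def, ContinuousLinearMap.proj_apply] at this
  simp [pd, this]

lemma pd_comp {f : Plane → E} {φ : Plane → Plane} {t : Plane} (hf : ContDiffAt ℝ ∞ f (φ t))
    (hφ : ContDiffAt ℝ ∞ φ t) (i : Fin 2) :
    pd i (fun s => f (φ s)) =ᶠ[𝓝 t] fun s => ∑ j, pd i φ s j • pd j f (φ s) := by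
  filter_upwards [hφ.continuousAt.eventually hf.eventually_diff, hφ.eventually_diff] with s h1 h2
  have := fderiv_comp s h1 h2
  simp only [Function.comp_def] at this
  simp only [pd, this, ContinuousLinearMap.comp_apply]
  rw [fderiv_eq_sum_pd]
  rfl

lemma pd_comm {f : Plane → E} {t : Plane} (hf : ContDiffAt ℝ ∞ f t) (i j : Fin 2) :
    pd i (pd j f) =ᶠ[𝓝 t] pd j (pd i f) := by
  have h2 : ∀ᶠ s in 𝓝 t, ContDiffAt ℝ 2 f s :=
    (hf.of_le (m := 2) (by norm_cast)).eventually (by simp)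
  filter_upwards [h2] with s hs
  have hd : DifferentiableAt ℝ (fderiv ℝ f) s :=
    (hs.fderiv_right (m := 1) (by norm_num)).differentiableAt (by simp)
  have hsym := hs.isSymmSndFDerivAt (by simp)
  have key : ∀ a b : Plane, fderiv ℝ (fun x => fderiv ℝ f x a) s b = fderiv ℝ (fderiv ℝ f) s b a := by
    intro a b
    rw [fderiv_clm_apply hd (differentiableAt_const _)]
    simp
  simp only [pd]
  change fderiv ℝ (fun x => fderiv ℝ f x (Pi.single j 1)) s _ =
    fderiv ℝ (fun x => fderiv ℝ f x (Pi.single i 1)) s _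
  rw [key, key]
  exact hsym.eq _ _

/-- `f` is smooth at `t`, and its partial derivatives of order at most `m` vanish at `t`. -/
def Flat : ℕ → (Plane → E) → Plane → Prop
  | 0, f, t => ContDiffAt ℝ ∞ f t ∧ f t = 0
  | m + 1, f, t => ContDiffAt ℝ ∞ f t ∧ f t = 0 ∧ ∀ i, Flat m (pd i f) t

namespace Flat

variable {m n : ℕ} {t : Plane}

lemma smooth {f : Plane → E} (h : Flat m f t) : ContDiffAt ℝ ∞ f t := by
  cases m <;> exact h.1

lemma eq_zero {f : Plane → E} (h : Flat m f t) : f t = 0 := by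
  cases m
  · exact h.2
  · exact h.2.1

lemma pd {f : Plane → E} (h : Flat (m + 1) f t) (i : Fin 2) : Flat m (pd i f) t := h.2.2 i

lemma mono {f : Plane → E} (hmn : m ≤ n) (h : Flat n f t) : Flat m f t := by
  induction n generalizing m f with
  | zero => obtain rfl : m = 0 := by omega
            exact h
  | succ n ih =>
    cases m with
    | zero => exact ⟨h.1, h.2.1⟩
    | succ m => exact ⟨h.1, h.2.1, fun i => ih (by omega) (h.2.2 i)⟩

lemma congr {f g : Plane → E} (h : Flat m f t) (hfg : f =ᶠ[𝓝 t] g) : Flat m g t := by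
  induction m generalizing f g with
  | zero => exact ⟨h.1.congr_of_eventuallyEq hfg.symm, hfg.eq_of_nhds ▸ h.2⟩
  | succ m ih =>
    exact ⟨h.1.congr_of_eventuallyEq hfg.symm, hfg.eq_of_nhds ▸ h.2.1,
      fun i => ih (h.2.2 i) (pd_congr hfg i)⟩

lemma add {f g : Plane → E} (hf : Flat m f t) (hg : Flat m g t) :
    Flat m (fun s => f s + g s) t := by
  induction m generalizing f g with
  | zero => exact ⟨hf.1.add hg.1, by simp [hf.2, hg.2]⟩
  | succ m ih =>
    exact ⟨hf.1.add hg.1, by simp [hf.2.1, hg.2.1],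
      fun i => (ih (hf.2.2 i) (hg.2.2 i)).congr (pd_add hf.1 hg.1 i).symm⟩

lemma clm (L : E →L[ℝ] F) {f : Plane → E} (hf : Flat m f t) :
    Flat m (fun s => L (f s)) t := by
  induction m generalizing f with
  | zero => exact ⟨L.contDiff.contDiffAt.comp t hf.1, by simp [hf.2]⟩
  | succ m ih =>
    exact ⟨L.contDiff.contDiffAt.comp t hf.1, by simp [hf.2.1],
      fun i => (ih (hf.2.2 i)).congr (pd_clm L hf.1 i).symm⟩

lemma neg {f : Plane → E} (hf : Flat m f t) : Flat m (fun s => - f s) t :=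
  hf.clm (-ContinuousLinearMap.id ℝ E)

lemma sub {f g : Plane → E} (hf : Flat m f t) (hg : Flat m g t) :
    Flat m (fun s => f s - g s) t := by
  simpa only [sub_eq_add_neg] using hf.add hg.neg

lemma zero : Flat m (fun _ => (0 : E)) t := by
  induction m with
  | zero => exact ⟨contDiffAt_const, rfl⟩
  | succ m ih =>
    refine ⟨contDiffAt_const, rfl, fun i => ih.congr (Eventually.of_forall fun s => ?_)⟩
    simp [GTwo.pd]

lemma sum {ι : Type*} (s : Finset ι) {f : ι → Plane → E} (hf : ∀ i ∈ s, Flat m (f i) t) :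
    Flat m (fun x => ∑ i ∈ s, f i x) t := by
  classical
  induction s using Finset.induction_on with
  | empty => simpa using zero
  | insert a s ha ih =>
    simp only [Finset.sum_insert ha]
    exact (hf a (by simp)).add (ih fun i hi => hf i (by simp [hi]))

lemma mul_right {f g : Plane → ℝ} (hf : Flat m f t) (hg : ContDiffAt ℝ ∞ g t) :
    Flat m (fun s => f s * g s) t := by
  induction m generalizing f g with
  | zero => exact ⟨hf.1.mul hg, by simp [hf.2]⟩
  | succ m ih =>
    exact ⟨hf.1.mul hg, by simp [hf.2.1],
      fun i => ((ih (hf.2.2 i) hg).add (ih (hf.mono (by omega)) (hg.pd i))).congr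
        (pd_mul hf.1 hg i).symm⟩

lemma mul_left {f g : Plane → ℝ} (hf : ContDiffAt ℝ ∞ f t) (hg : Flat m g t) :
    Flat m (fun s => f s * g s) t := by
  simpa only [mul_comm] using hg.mul_right hf

/-- From `fg - f'g' = (f - f')g + f'(g - g')`: congruence modulo flat functions respects products.
-/
lemma mul_sub_mul {f f' g g' : Plane → ℝ} (hf : Flat m (fun s => f s - f' s) t)
    (hg : Flat m (fun s => g s - g' s) t) (hf' : ContDiffAt ℝ ∞ f' t) (hgs : ContDiffAt ℝ ∞ g t) :
    Flat m (fun s => f s * g s - f' s * g' s) t :=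
  ((hf.mul_right hgs).add (mul_left hf' hg)).congr (Eventually.of_forall fun s => by ring)

/-- A family of continuous linear maps separating points detects flatness. -/
lemma of_clm {ι : Type*} {F : ι → Type*} [∀ a, NormedAddCommGroup (F a)] [∀ a, NormedSpace ℝ (F a)]
    (L : ∀ a, E →L[ℝ] F a) (hL : ∀ v, (∀ a, L a v = 0) → v = 0) {f : Plane → E}
    (hf : ContDiffAt ℝ ∞ f t) (h : ∀ a, Flat m (fun s => L a (f s)) t) : Flat m f t := by
  induction m generalizing f with
  | zero => exact ⟨hf, hL _ fun a => (h a).2⟩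
  | succ m ih =>
    exact ⟨hf, hL _ fun a => (h a).2.1, fun i => ih (hf.pd i) fun a =>
      ((h a).2.2 i).congr (pd_clm (L a) hf i)⟩

lemma apply {ι : Type*} [Fintype ι] {f : Plane → ι → ℝ} (hf : Flat m f t) (j : ι) :
    Flat m (fun s => f s j) t :=
  hf.clm (ContinuousLinearMap.proj j)

lemma pi {ι : Type*} [Fintype ι] {f : Plane → ι → ℝ} (hf : ∀ j, Flat m (fun s => f s j) t) :
    Flat m f t :=
  of_clm (fun j => ContinuousLinearMap.proj (R := ℝ) (φ := fun _ => ℝ) j) (fun _ h => funext h)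
    (contDiffAt_pi.2 fun j => (hf j).smooth) hf

lemma comp {f : Plane → ℝ} {φ : Plane → Plane} (hf : Flat m f (φ t))
    (hφ : ContDiffAt ℝ ∞ φ t) : Flat m (fun s => f (φ s)) t := by
  induction m generalizing f with
  | zero => exact ⟨hf.1.comp t hφ, hf.2⟩
  | succ m ih =>
    refine ⟨hf.1.comp t hφ, hf.2.1, fun i => ?_⟩
    refine (sum Finset.univ fun j _ => ?_).congr (pd_comp hf.1 hφ i).symm
    exact mul_left (contDiffAt_pi.1 (hφ.pd i) j) (ih (hf.2.2 j))

/-- By the chain rule the derivatives are sums of products `∂ᵢφʲ · (∂ⱼf ∘ φ)`. The first factors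
agree to order `m` by hypothesis, the second by induction applied to `∂ⱼf`. -/
lemma comp_sub_comp {f : Plane → ℝ} {φ ψ : Plane → Plane} (hf : ContDiffAt ℝ ∞ f (φ t))
    (hψ : ContDiffAt ℝ ∞ ψ t) (h : Flat m (fun s => φ s - ψ s) t) :
    Flat m (fun s => f (φ s) - f (ψ s)) t := by
  have hφ : ContDiffAt ℝ ∞ φ t := by simpa using h.smooth.add hψ
  have he : φ t = ψ t := sub_eq_zero.1 h.eq_zero
  induction m generalizing f with
  | zero =>
    exact ⟨(hf.comp t hφ).sub (ContDiffAt.comp t (he ▸ hf) hψ), by simp [he]⟩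
  | succ m ih =>
    have hf' : ContDiffAt ℝ ∞ f (ψ t) := he ▸ hf
    have hs1 : ContDiffAt ℝ ∞ (fun s => f (φ s)) t := hf.comp t hφ
    have hs2 : ContDiffAt ℝ ∞ (fun s => f (ψ s)) t := hf'.comp t hψ
    refine ⟨hs1.sub hs2, by simp [he], fun i => ?_⟩
    have h1 : Flat m (fun s => ∑ j, (GTwo.pd i φ s j * GTwo.pd j f (φ s)
        - GTwo.pd i ψ s j * GTwo.pd j f (ψ s))) t := by
      refine sum Finset.univ fun j _ => ?_
      refine mul_sub_mul ?_ (ih (hf.pd j) (h.mono (by omega))) (contDiffAt_pi.1 (hψ.pd i) j)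
        ((hf.pd j).comp t hφ)
      exact ((h.pd i).apply j).congr ((pd_sub hφ hψ i).mono fun s hs => by simp [hs])
    refine h1.congr ?_
    filter_upwards [pd_sub hs1 hs2 i, pd_comp hf hφ i, pd_comp hf' hψ i] with s e1 e2 e3
    rw [e1, e2, e3, Finset.sum_sub_distrib]
    rfl

end Flat

lemma pd_iter_contDiffAt {f : Plane → E} {t : Plane} (hf : ContDiffAt ℝ ∞ f t) (i : Fin 2)
    (n : ℕ) : ContDiffAt ℝ ∞ ((pd i)^[n] f) t := by
  induction n generalizing f with
  | zero => exact hf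
  | succ n ih => exact ih (hf.pd i)

lemma pd_iter_congr {f g : Plane → E} {t : Plane} (h : f =ᶠ[𝓝 t] g) (i : Fin 2) (n : ℕ) :
    (pd i)^[n] f =ᶠ[𝓝 t] (pd i)^[n] g := by
  induction n generalizing f g with
  | zero => exact h
  | succ n ih => exact ih (pd_congr h i)

lemma pd_iter_comm {f : Plane → E} {t : Plane} (hf : ContDiffAt ℝ ∞ f t) (i j : Fin 2) (n : ℕ) :
    (pd i)^[n] (pd j f) =ᶠ[𝓝 t] pd j ((pd i)^[n] f) := by
  induction n generalizing f with
  | zero => rfl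
  | succ n ih =>
    exact (pd_iter_congr (pd_comm hf i j) i n).trans (ih (hf.pd i))

/-- The recursion in `Flat` differentiates in any order, while jet coordinates use a fixed one;
symmetry of second derivatives reconciles them. -/
lemma flat_iff {m : ℕ} {f : Plane → E} {t : Plane} (hf : ContDiffAt ℝ ∞ f t) :
    Flat m f t ↔ ∀ p q : ℕ, p + q ≤ m → (pd 0)^[p] ((pd 1)^[q] f) t = 0 := by
  induction m generalizing f with
  | zero =>
    refine ⟨fun h p q hpq => ?_, fun h => ⟨hf, h 0 0 le_rfl⟩⟩
    obtain ⟨rfl, rfl⟩ : p = 0 ∧ q = 0 := by omega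
    exact h.2
  | succ m ih =>
    have h01 : ∀ p q, (pd 0)^[p] ((pd 1)^[q] (pd 0 f)) t = (pd 0)^[p + 1] ((pd 1)^[q] f) t :=
      fun p q => by
        rw [Function.iterate_succ_apply]
        exact (pd_iter_congr (pd_iter_comm hf 1 0 q) 0 p).eq_of_nhds
    constructor
    · rintro ⟨-, h0, h1⟩ p q hpq
      rcases q with _ | q
      · rcases p with _ | p
        · exact h0
        · rw [← h01]
          exact (ih (hf.pd 0)).1 (h1 0) p 0 (by omega)
      · exact (ih (hf.pd 1)).1 (h1 1) p q (by omega)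
    · refine fun h => ⟨hf, h 0 0 (by omega), fun i => (ih (hf.pd i)).2 fun p q hpq => ?_⟩
      fin_cases i
      · exact (h01 p q).trans (h _ _ (by omega))
      · exact h p (q + 1) (by omega)

lemma pd_iter_sub {f g : Plane → E} {t : Plane} (hf : ContDiffAt ℝ ∞ f t)
    (hg : ContDiffAt ℝ ∞ g t) (i : Fin 2) (n : ℕ) :
    (pd i)^[n] (fun s => f s - g s) =ᶠ[𝓝 t] fun s => (pd i)^[n] f s - (pd i)^[n] g s := by
  induction n generalizing f g with
  | zero => rfl
  | succ n ih => exact (pd_iter_congr (pd_sub hf hg i) i n).trans (ih (hf.pd i) (hg.pd i))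

lemma flat_sub_iff {m : ℕ} {f g : Plane → E} {t : Plane} (hf : ContDiffAt ℝ ∞ f t)
    (hg : ContDiffAt ℝ ∞ g t) :
    Flat m (fun s => f s - g s) t ↔ ∀ p q : ℕ, p + q ≤ m →
      (pd 0)^[p] ((pd 1)^[q] f) t = (pd 0)^[p] ((pd 1)^[q] g) t := by
  rw [flat_iff (hf.sub hg)]
  refine forall₃_congr fun p q _ => ?_
  rw [((pd_iter_congr (pd_iter_sub hf hg 1 q) 0 p).trans (pd_iter_sub (pd_iter_contDiffAt hf 1 q)
    (pd_iter_contDiffAt hg 1 q) 0 p)).eq_of_nhds, sub_eq_zero]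

end Flat

/-- Turns equality of jets into a congruence that is stable under products, inverses and
composition, so that no explicit formula for higher derivatives of a pullback is needed. -/
lemma jet_eq_iff {m : ℕ} {σ τ : Plane → Coeff} {x : Space} (hσ : ContDiffAt ℝ ∞ σ x.1)
    (hτ : ContDiffAt ℝ ∞ τ x.1) :
    jet m σ x = jet m τ x ↔ Flat m (fun s => σ s - τ s) x.1 := by
  rw [flat_sub_iff hσ hτ]
  constructor
  · intro h p q hpq
    have := congrFun (congrArg Prod.snd h) ⟨(⟨p, by omega⟩, ⟨q, by omega⟩), hpq⟩
    exact this
  · intro h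
    refine Prod.ext rfl (funext fun p => ?_)
    exact h _ _ p.2

/-! ### Matrix blocks of the coefficients; smooth and flat matrix functions. -/

/-- Real `2 × 2` matrices. -/
abbrev M2 : Type := Matrix (Fin 2) (Fin 2) ℝ

/-- The metric coefficients whose blocks are the symmetrization of `B`, `F`, and the
symmetrization of `H`. -/
def coeffOf (B F H : M2) : Coeff :=
  (Sym2.lift ⟨fun i j => (B i j + B j i) / 2, fun i j => by ring⟩, fun i k => F i k,
    Sym2.lift ⟨fun i j => (H i j + H j i) / 2, fun i j => by ring⟩)

lemma bMat_coeffOf {B F H : M2} (hB : Bᵀ = B) : bMat (coeffOf B F H) = B := by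
  ext i j
  have : B j i = B i j := congrFun (congrFun hB i) j
  simp [bMat, coeffOf, this]

lemma hMat_coeffOf {B F H : M2} (hH : Hᵀ = H) : hMat (coeffOf B F H) = H := by
  ext i j
  have : H j i = H i j := congrFun (congrFun hH i) j
  simp [hMat, coeffOf, this]

@[simp] lemma bMat_transpose (c : Coeff) : (bMat c)ᵀ = bMat c := by
  ext i j
  simp [bMat, Sym2.eq_swap]

@[simp] lemma hMat_transpose (c : Coeff) : (hMat c)ᵀ = hMat c := by
  ext i j
  simp [hMat, Sym2.eq_swap]

lemma coeff_ext {c c' : Coeff} (hb : bMat c = bMat c') (hf : fMat c = fMat c')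
    (hh : hMat c = hMat c') : c = c' := by
  refine Prod.ext (funext fun s => ?_) (Prod.ext ?_ (funext fun s => ?_))
  · induction s using Sym2.ind with
    | _ i j => exact congrFun (congrFun hb i) j
  · exact hf
  · induction s using Sym2.ind with
    | _ i j => exact congrFun (congrFun hh i) j

/-- The entries of `b`, `f` and `h`, as continuous linear functionals. -/
def entry (a : Fin 3) (i j : Fin 2) : Coeff →L[ℝ] ℝ :=
  match a with
  | 0 => (ContinuousLinearMap.proj (R := ℝ) (φ := fun _ : Sym2 (Fin 2) => ℝ) s(i, j)).comp
      (ContinuousLinearMap.fst ℝ _ _)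
  | 1 => ((ContinuousLinearMap.proj (R := ℝ) (φ := fun _ : Fin 2 => ℝ) j).comp
      (ContinuousLinearMap.proj (R := ℝ) (φ := fun _ : Fin 2 => Fin 2 → ℝ) i)).comp
      ((ContinuousLinearMap.fst ℝ _ _).comp (ContinuousLinearMap.snd ℝ _ _))
  | 2 => (ContinuousLinearMap.proj (R := ℝ) (φ := fun _ : Sym2 (Fin 2) => ℝ) s(i, j)).comp
      ((ContinuousLinearMap.snd ℝ _ _).comp (ContinuousLinearMap.snd ℝ _ _))

lemma entry_two (i j : Fin 2) (c : Coeff) : entry 2 i j c = hMat c i j := rfl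

/-- The entries of the matrix function `A` are smooth at `x`. -/
def MSm {X : Type*} [NormedAddCommGroup X] [NormedSpace ℝ X] (A : X → M2) (x : X) : Prop :=
  ∀ i j, ContDiffAt ℝ ∞ (fun s => A s i j) x

/-- The entries of the matrix function `A` are flat to order `m` at `t`. -/
def MFlat (m : ℕ) (A : Plane → M2) (t : Plane) : Prop :=
  ∀ i j, Flat m (fun s => A s i j) t

section MSm

variable {X : Type*} [NormedAddCommGroup X] [NormedSpace ℝ X] {A B : X → M2} {x : X}

lemma MSm.add (hA : MSm A x) (hB : MSm B x) : MSm (fun s => A s + B s) x :=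
  fun i j => (hA i j).add (hB i j)

lemma MSm.sub (hA : MSm A x) (hB : MSm B x) : MSm (fun s => A s - B s) x :=
  fun i j => (hA i j).sub (hB i j)

lemma MSm.mul (hA : MSm A x) (hB : MSm B x) : MSm (fun s => A s * B s) x := fun i j => by
  simp only [Matrix.mul_apply]
  exact ContDiffAt.sum fun k _ => (hA i k).mul (hB k j)

lemma MSm.transpose (hA : MSm A x) : MSm (fun s => (A s)ᵀ) x := fun i j => hA j i

lemma MSm.const (A : M2) : MSm (fun _ : X => A) x := fun _ _ => contDiffAt_const

lemma MSm.det (hA : MSm A x) : ContDiffAt ℝ ∞ (fun s => (A s).det) x := by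
  simp only [Matrix.det_fin_two]
  exact ((hA 0 0).mul (hA 1 1)).sub ((hA 0 1).mul (hA 1 0))

lemma MSm.inv (hA : MSm A x) (h : (A x).det ≠ 0) : MSm (fun s => (A s)⁻¹) x := by
  have hd := hA.det.inv h
  intro i j
  simp only [Matrix.inv_def, Matrix.adjugate_fin_two, Matrix.smul_apply, smul_eq_mul,
    Ring.inverse_eq_inv']
  refine hd.mul ?_
  fin_cases i <;> fin_cases j
  exacts [hA 1 1, (hA 0 1).neg, (hA 1 0).neg, hA 0 0]

lemma contDiffAt_coeff {σ : X → Coeff} :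
    ContDiffAt ℝ ∞ σ x ↔ MSm (fun s => bMat (σ s)) x ∧ MSm (fun s => fMat (σ s)) x ∧
      MSm (fun s => hMat (σ s)) x := by
  constructor
  · intro h
    exact ⟨fun i j => (entry 0 i j).contDiff.contDiffAt.comp x h,
      fun i j => (entry 1 i j).contDiff.contDiffAt.comp x h,
      fun i j => (entry 2 i j).contDiff.contDiffAt.comp x h⟩
  · rintro ⟨hb, hf, hh⟩
    refine ContDiffAt.prodMk (contDiffAt_pi.2 fun s => ?_) (ContDiffAt.prodMk
      (contDiffAt_pi.2 fun i => contDiffAt_pi.2 fun j => hf i j) (contDiffAt_pi.2 fun s => ?_))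
    · induction s using Sym2.ind with
      | _ i j => exact hb i j
    · induction s using Sym2.ind with
      | _ i j => exact hh i j

lemma contDiffAt_coeffOf {B F H : X → M2} (hB : MSm B x) (hF : MSm F x) (hH : MSm H x) :
    ContDiffAt ℝ ∞ (fun s => coeffOf (B s) (F s) (H s)) x := by
  refine contDiffAt_coeff.2 ⟨fun i j => ?_, hF, fun i j => ?_⟩
  · exact ((hB i j).add (hB j i)).div_const 2
  · exact ((hH i j).add (hH j i)).div_const 2

end MSm

section MFlat

variable {m : ℕ} {A B : Plane → M2} {t : Plane}

lemma MFlat.smooth (hA : MFlat m A t) : MSm A t := fun i j => (hA i j).smooth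

lemma MFlat.eq_zero (hA : MFlat m A t) : A t = 0 := by
  ext i j
  exact (hA i j).eq_zero

lemma MFlat.mono {n : ℕ} (h : m ≤ n) (hA : MFlat n A t) : MFlat m A t :=
  fun i j => (hA i j).mono h

lemma MFlat.add (hA : MFlat m A t) (hB : MFlat m B t) : MFlat m (fun s => A s + B s) t :=
  fun i j => (hA i j).add (hB i j)

lemma MFlat.sub (hA : MFlat m A t) (hB : MFlat m B t) : MFlat m (fun s => A s - B s) t :=
  fun i j => (hA i j).sub (hB i j)

lemma MFlat.mul_right (hA : MFlat m A t) (hB : MSm B t) : MFlat m (fun s => A s * B s) t :=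
  fun i j => by
    simp only [Matrix.mul_apply]
    exact Flat.sum _ fun k _ => (hA i k).mul_right (hB k j)

lemma MFlat.mul_left (hA : MSm A t) (hB : MFlat m B t) : MFlat m (fun s => A s * B s) t :=
  fun i j => by
    simp only [Matrix.mul_apply]
    exact Flat.sum _ fun k _ => Flat.mul_left (hA i k) (hB k j)

lemma MFlat.transpose (hA : MFlat m A t) : MFlat m (fun s => (A s)ᵀ) t := fun i j => hA j i

lemma MFlat.congr (hA : MFlat m A t) (h : A =ᶠ[𝓝 t] B) : MFlat m B t := fun i j =>
  (hA i j).congr (h.mono fun s hs => by simp only [hs])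

lemma MFlat.mul_sub_mul {A' B' : Plane → M2} (hA : MFlat m (fun s => A s - A' s) t)
    (hB : MFlat m (fun s => B s - B' s) t) (hA' : MSm A' t) (hBs : MSm B t) :
    MFlat m (fun s => A s * B s - A' s * B' s) t :=
  ((hA.mul_right hBs).add (MFlat.mul_left hA' hB)).congr
    (Eventually.of_forall fun s => by simp [sub_mul, mul_sub])

lemma flat_coeff_iff {σ : Plane → Coeff} :
    Flat m σ t ↔ MFlat m (fun s => bMat (σ s)) t ∧ MFlat m (fun s => fMat (σ s)) t ∧
      MFlat m (fun s => hMat (σ s)) t := by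
  constructor
  · exact fun h => ⟨fun i j => h.clm (entry 0 i j), fun i j => h.clm (entry 1 i j),
      fun i j => h.clm (entry 2 i j)⟩
  · rintro ⟨hb, hf, hh⟩
    refine Flat.of_clm (ι := Fin 3 × Fin 2 × Fin 2) (fun a => entry a.1 a.2.1 a.2.2)
      (fun v hv => ?_) (contDiffAt_coeff.2 ⟨hb.smooth, hf.smooth, hh.smooth⟩) ?_
    · refine coeff_ext ?_ ?_ ?_ <;> ext i j
      exacts [hv (0, i, j), hv (1, i, j), hv (2, i, j)]
    · rintro ⟨a, i, j⟩
      fin_cases a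
      exacts [hb i j, hf i j, hh i j]

end MFlat

/-! ### Pullback by block-triangular maps; quotient metric, connection and leaf metric. -/

lemma gForm_eq (c : Coeff) (u v : Space) :
    gForm c u v = u.1 ⬝ᵥ (bMat c *ᵥ v.1 + fMat c *ᵥ v.2)
      + u.2 ⬝ᵥ ((fMat c)ᵀ *ᵥ v.1 + hMat c *ᵥ v.2) := by
  rw [gForm, gMat, Matrix.fromBlocks_mulVec]
  simp [sumElim_dotProduct_sumElim]

/-- The coefficients of the pullback of the metric `c` by the linear map
`(u, v) ↦ (J u, K u + α v)`. -/
def pull (J K α : M2) (c : Coeff) : Coeff :=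
  coeffOf (Jᵀ * bMat c * J + Jᵀ * fMat c * K + Kᵀ * (fMat c)ᵀ * J + Kᵀ * hMat c * K)
    ((Jᵀ * fMat c + Kᵀ * hMat c) * α) (αᵀ * hMat c * α)

lemma bMat_pull (J K α : M2) (c : Coeff) : bMat (pull J K α c) =
    Jᵀ * bMat c * J + Jᵀ * fMat c * K + Kᵀ * (fMat c)ᵀ * J + Kᵀ * hMat c * K :=
  bMat_coeffOf (by simp [Matrix.transpose_mul, Matrix.mul_assoc]; ac_rfl)

lemma fMat_pull (J K α : M2) (c : Coeff) : fMat (pull J K α c) =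
    (Jᵀ * fMat c + Kᵀ * hMat c) * α := rfl

lemma hMat_pull (J K α : M2) (c : Coeff) : hMat (pull J K α c) = αᵀ * hMat c * α :=
  hMat_coeffOf (by simp [Matrix.transpose_mul, Matrix.mul_assoc])

lemma gForm_pull (J K α : M2) (c : Coeff) (u v : Space) :
    gForm (pull J K α c) u v
      = gForm c (J *ᵥ u.1, K *ᵥ u.1 + α *ᵥ u.2) (J *ᵥ v.1, K *ᵥ v.1 + α *ᵥ v.2) := by
  have h1 : bMat c 1 0 = bMat c 0 1 := congrFun (congrFun (bMat_transpose c) 0) 1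
  have h2 : hMat c 1 0 = hMat c 0 1 := congrFun (congrFun (hMat_transpose c) 0) 1
  simp only [gForm_eq, bMat_pull, fMat_pull, hMat_pull]
  simp only [dotProduct, Matrix.mulVec, Fin.sum_univ_two, Matrix.mul_apply, Matrix.add_apply,
    Matrix.transpose_apply, Pi.add_apply, h1, h2]
  ring

lemma gForm_ext {c c' : Coeff} (h : ∀ u v, gForm c u v = gForm c' u v) : c = c' := by
  simp only [gForm_eq] at h
  refine coeff_ext ?_ ?_ ?_ <;> ext i j
  · simpa [dotProduct, Matrix.mulVec, Pi.single_apply] using h (Pi.single i 1, 0) (Pi.single j 1, 0)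
  · simpa [dotProduct, Matrix.mulVec, Pi.single_apply] using h (Pi.single i 1, 0) (0, Pi.single j 1)
  · simpa [dotProduct, Matrix.mulVec, Pi.single_apply] using h (0, Pi.single i 1) (0, Pi.single j 1)

/-- The connection coefficients `f h⁻¹`. -/
def aMat (c : Coeff) : M2 := fMat c * (hMat c)⁻¹

/-- The metric on the quotient by the leaves. -/
def qMat (c : Coeff) : M2 := bMat c - fMat c * (hMat c)⁻¹ * (fMat c)ᵀ

/-- The metric is nondegenerate, and so is its restriction to the leaves. -/
def Nondeg (c : Coeff) : Prop := (gMat c).det ≠ 0 ∧ (hMat c).det ≠ 0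

/-- `qMat c` is the Schur complement of the leaf block, so `det g = det h · det q`. -/
lemma nondeg_iff (c : Coeff) : Nondeg c ↔ (qMat c).det ≠ 0 ∧ (hMat c).det ≠ 0 := by
  refine and_congr_left fun h => ?_
  have : Invertible (hMat c) := Matrix.invertibleOfIsUnitDet _ (isUnit_iff_ne_zero.2 h)
  rw [gMat, Matrix.det_fromBlocks₂₂, Matrix.invOf_eq_nonsing_inv, qMat]
  simp [h]

lemma qMat_transpose (c : Coeff) : (qMat c)ᵀ = qMat c := by
  simp [qMat, Matrix.transpose_mul, Matrix.transpose_nonsing_inv, Matrix.mul_assoc]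

/-- The metric with the given quotient metric `B`, connection coefficients `A` and leaf
metric `H`. -/
def ofReduced (B A H : M2) : Coeff := coeffOf (B + A * H * Aᵀ) (A * H) H

section Reduced

variable {B A H : M2}

lemma bMat_ofReduced (hB : Bᵀ = B) (hH : Hᵀ = H) : bMat (ofReduced B A H) = B + A * H * Aᵀ :=
  bMat_coeffOf (by simp [Matrix.transpose_mul, Matrix.mul_assoc, hB, hH])

lemma fMat_ofReduced : fMat (ofReduced B A H) = A * H := rfl

lemma hMat_ofReduced (hH : Hᵀ = H) : hMat (ofReduced B A H) = H := hMat_coeffOf hH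

lemma aMat_ofReduced (hH : Hᵀ = H) (h : H.det ≠ 0) : aMat (ofReduced B A H) = A := by
  rw [aMat, fMat_ofReduced, hMat_ofReduced hH,
    Matrix.mul_nonsing_inv_cancel_right _ _ (isUnit_iff_ne_zero.2 h)]

lemma qMat_ofReduced (hB : Bᵀ = B) (hH : Hᵀ = H) (h : H.det ≠ 0) :
    qMat (ofReduced B A H) = B := by
  rw [qMat, bMat_ofReduced hB hH, fMat_ofReduced, hMat_ofReduced hH,
    Matrix.mul_nonsing_inv_cancel_right _ _ (isUnit_iff_ne_zero.2 h), Matrix.transpose_mul, hH,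
    Matrix.mul_assoc]
  simp

lemma ofReduced_eq {c : Coeff} (h : (hMat c).det ≠ 0) :
    ofReduced (qMat c) (aMat c) (hMat c) = c := by
  have hu := isUnit_iff_ne_zero.2 h
  have hf : aMat c * hMat c = fMat c := by
    rw [aMat, Matrix.nonsing_inv_mul_cancel_right _ _ hu]
  refine coeff_ext ?_ ?_ ?_
  · rw [bMat_ofReduced (qMat_transpose c) (hMat_transpose c), hf, qMat, aMat]
    simp [Matrix.transpose_mul, Matrix.transpose_nonsing_inv, Matrix.mul_assoc]
  · rw [fMat_ofReduced, hf]
  · rw [hMat_ofReduced (hMat_transpose c)]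

/-- In the reduced variables the action decouples: the quotient metric sees only `J`, the leaf
metric only `α`, and `K` merely shifts the connection, as a gauge transformation does. -/
lemma pull_ofReduced (hB : Bᵀ = B) (hH : Hᵀ = H) {J K α : M2} (hα : α.det ≠ 0) :
    pull J K α (ofReduced B A H)
      = ofReduced (Jᵀ * B * J) ((Jᵀ * A + Kᵀ) * (α⁻¹)ᵀ) (αᵀ * H * α) := by
  have hα' : (α⁻¹)ᵀ * αᵀ = 1 := by
    rw [← Matrix.transpose_mul, Matrix.mul_nonsing_inv _ (isUnit_iff_ne_zero.2 hα)]; simp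
  have hα'' : α * α⁻¹ = 1 := Matrix.mul_nonsing_inv _ (isUnit_iff_ne_zero.2 hα)
  have h1 : ∀ M N : M2, M * (α⁻¹)ᵀ * (αᵀ * N) = M * N := fun M N => by
    rw [Matrix.mul_assoc, ← Matrix.mul_assoc _ αᵀ, hα', one_mul]
  refine coeff_ext ?_ ?_ ?_
  · rw [bMat_pull, bMat_ofReduced hB hH, fMat_ofReduced, hMat_ofReduced hH, bMat_ofReduced]
    · rw [Matrix.mul_assoc αᵀ, h1, Matrix.transpose_mul ((Jᵀ * A + Kᵀ)),
        Matrix.transpose_transpose, Matrix.mul_assoc _ (H * α), Matrix.mul_assoc H α,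
        ← Matrix.mul_assoc α, hα'', one_mul]
      simp only [Matrix.transpose_mul, Matrix.transpose_add, Matrix.transpose_transpose, hH]
      noncomm_ring
    · simp [Matrix.transpose_mul, Matrix.mul_assoc, hB]
    · simp [Matrix.transpose_mul, Matrix.mul_assoc, hH]
  · rw [fMat_pull, fMat_ofReduced, fMat_ofReduced, hMat_ofReduced hH, Matrix.mul_assoc αᵀ, h1]
    noncomm_ring
  · rw [hMat_pull, hMat_ofReduced hH, hMat_ofReduced]
    simp [Matrix.transpose_mul, Matrix.mul_assoc, hH]

end Reduced

lemma nondeg_ofReduced {B A H : M2} (hB : Bᵀ = B) (hH : Hᵀ = H) (hBd : B.det ≠ 0)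
    (hHd : H.det ≠ 0) : Nondeg (ofReduced B A H) := by
  rw [nondeg_iff, qMat_ofReduced hB hH hHd, hMat_ofReduced hH]
  exact ⟨hBd, hHd⟩

lemma nondeg_pull {c : Coeff} (hc : Nondeg c) {J K α : M2} (hJ : J.det ≠ 0) (hα : α.det ≠ 0) :
    Nondeg (pull J K α c) := by
  rw [nondeg_iff] at hc
  rw [← ofReduced_eq hc.2, pull_ofReduced (qMat_transpose c) (hMat_transpose c) hα]
  refine nondeg_ofReduced ?_ ?_ ?_ ?_
  · simp [Matrix.transpose_mul, Matrix.mul_assoc, qMat_transpose]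
  · simp [Matrix.transpose_mul, Matrix.mul_assoc]
  · simp [hJ, hc.1]
  · simp [hα, hc.2]

lemma isOpen_nondeg : IsOpen {c : Coeff | Nondeg c} := by
  have hb : Continuous bMat := continuous_matrix fun i j => (entry 0 i j).continuous
  have hf : Continuous fMat := continuous_matrix fun i j => (entry 1 i j).continuous
  have hh : Continuous hMat := continuous_matrix fun i j => (entry 2 i j).continuous
  have hg : Continuous gMat := hb.matrix_fromBlocks hf hf.matrix_transpose hh
  exact (isOpen_ne.preimage hg.matrix_det).inter (isOpen_ne.preimage hh.matrix_det)

/-! ### Smooth dependence, and congruence modulo flat terms, of pullbacks. -/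

section Smoothness

variable {X : Type*} [NormedAddCommGroup X] [NormedSpace ℝ X] {x : X}

lemma contDiffAt_pull {J K α : X → M2} {σ : X → Coeff} (hJ : MSm J x) (hK : MSm K x)
    (hα : MSm α x) (hσ : ContDiffAt ℝ ∞ σ x) :
    ContDiffAt ℝ ∞ (fun s => pull (J s) (K s) (α s) (σ s)) x := by
  obtain ⟨hb, hf, hh⟩ := contDiffAt_coeff.1 hσ
  exact contDiffAt_coeffOf (((((hJ.transpose.mul hb).mul hJ).add
    ((hJ.transpose.mul hf).mul hK)).add ((hK.transpose.mul hf.transpose).mul hJ)).add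
    ((hK.transpose.mul hh).mul hK)) (((hJ.transpose.mul hf).add (hK.transpose.mul hh)).mul hα)
    ((hα.transpose.mul hh).mul hα)

lemma contDiffAt_ofReduced {B A H : X → M2} (hB : MSm B x) (hA : MSm A x) (hH : MSm H x) :
    ContDiffAt ℝ ∞ (fun s => ofReduced (B s) (A s) (H s)) x :=
  contDiffAt_coeffOf (hB.add ((hA.mul hH).mul hA.transpose)) (hA.mul hH) hH

lemma MSm.aMat {σ : X → Coeff} (hσ : ContDiffAt ℝ ∞ σ x) (h : (hMat (σ x)).det ≠ 0) :
    MSm (fun s => aMat (σ s)) x := by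
  obtain ⟨hb, hf, hh⟩ := contDiffAt_coeff.1 hσ
  exact hf.mul (hh.inv h)

lemma MSm.qMat {σ : X → Coeff} (hσ : ContDiffAt ℝ ∞ σ x) (h : (hMat (σ x)).det ≠ 0) :
    MSm (fun s => qMat (σ s)) x := by
  obtain ⟨hb, hf, hh⟩ := contDiffAt_coeff.1 hσ
  exact hb.sub ((hf.mul (hh.inv h)).mul hf.transpose)

end Smoothness

section Congruence

variable {m : ℕ} {t : Plane}

lemma MFlat.coeffOf_sub {B F H B' F' H' : Plane → M2} (hB : MFlat m (fun s => B s - B' s) t)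
    (hF : MFlat m (fun s => F s - F' s) t) (hH : MFlat m (fun s => H s - H' s) t) :
    Flat m (fun s => coeffOf (B s) (F s) (H s) - coeffOf (B' s) (F' s) (H' s)) t := by
  refine flat_coeff_iff.2 ⟨fun i j => ?_, hF, fun i j => ?_⟩
  · refine (((hB i j).add (hB j i)).mul_right (g := fun _ => 1 / 2) contDiffAt_const).congr
      (Eventually.of_forall fun s => ?_)
    simp [bMat, coeffOf]; ring
  · refine (((hH i j).add (hH j i)).mul_right (g := fun _ => 1 / 2) contDiffAt_const).congr
      (Eventually.of_forall fun s => ?_)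
    simp [hMat, coeffOf]; ring

lemma MFlat.add_sub_add {A B A' B' : Plane → M2} (hA : MFlat m (fun s => A s - A' s) t)
    (hB : MFlat m (fun s => B s - B' s) t) :
    MFlat m (fun s => (A s + B s) - (A' s + B' s)) t :=
  (hA.add hB).congr (Eventually.of_forall fun _ => (add_sub_add_comm _ _ _ _).symm)

/-- With `J = jac φ` and `K = jac ψ`, this is why the `m`-jet of a pullback depends only on the
`(m+1)`-jets of `φ` and `ψ`. -/
lemma flat_pull_sub {J K J' K' : Plane → M2} {α : M2} {σ σ' : Plane → Coeff}
    (hJ : MFlat m (fun s => J s - J' s) t) (hK : MFlat m (fun s => K s - K' s) t)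
    (hσ : Flat m (fun s => σ s - σ' s) t) (hJs : MSm J t) (hKs : MSm K t)
    (hJs' : MSm J' t) (hKs' : MSm K' t) (hσs : ContDiffAt ℝ ∞ σ t) (hσs' : ContDiffAt ℝ ∞ σ' t) :
    Flat m (fun s => pull (J s) (K s) α (σ s) - pull (J' s) (K' s) α (σ' s)) t := by
  obtain ⟨hb, hf, hh⟩ := flat_coeff_iff.1 hσ
  obtain ⟨sb, sf, sh⟩ := contDiffAt_coeff.1 hσs
  obtain ⟨sb', sf', sh'⟩ := contDiffAt_coeff.1 hσs'
  have hα : MFlat m (fun _ => α - α) t := fun i j => by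
    simpa using Flat.zero (m := m) (t := t) (E := ℝ)
  have sα : MSm (fun _ => α) t := MSm.const α
  exact MFlat.coeffOf_sub (((((hJ.transpose.mul_sub_mul hb hJs'.transpose sb).mul_sub_mul hJ
    (hJs'.transpose.mul sb') hJs).add_sub_add
    ((hJ.transpose.mul_sub_mul hf hJs'.transpose sf).mul_sub_mul hK
    (hJs'.transpose.mul sf') hKs)).add_sub_add
    ((hK.transpose.mul_sub_mul hf.transpose hKs'.transpose sf.transpose).mul_sub_mul hJ
    (hKs'.transpose.mul sf'.transpose) hJs)).add_sub_add
    ((hK.transpose.mul_sub_mul hh hKs'.transpose sh).mul_sub_mul hK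
    (hKs'.transpose.mul sh') hKs))
    (((hJ.transpose.mul_sub_mul hf hJs'.transpose sf).add_sub_add
    (hK.transpose.mul_sub_mul hh hKs'.transpose sh)).mul_sub_mul hα
    ((hJs'.transpose.mul sf').add (hKs'.transpose.mul sh')) sα)
    ((hα.transpose.mul_sub_mul hh sα.transpose sh).mul_sub_mul hα (sα.transpose.mul sh') sα)

lemma flat_ofReduced_sub {B A H B' A' H' : Plane → M2} (hB : MFlat m (fun s => B s - B' s) t)
    (hA : MFlat m (fun s => A s - A' s) t) (hH : MFlat m (fun s => H s - H' s) t)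
    (sA : MSm A t) (sH : MSm H t) (sA' : MSm A' t) (sH' : MSm H' t) :
    Flat m (fun s => ofReduced (B s) (A s) (H s) - ofReduced (B' s) (A' s) (H' s)) t :=
  MFlat.coeffOf_sub (hB.add_sub_add ((hA.mul_sub_mul hH sA' sH).mul_sub_mul hA.transpose
    (sA'.mul sH') sA.transpose)) (hA.mul_sub_mul hH sA' sH) hH

lemma flat_comp_sub {σ σ' : Plane → Coeff} {φ φ' : Plane → Plane} (hσ : ContDiffAt ℝ ∞ σ (φ t))
    (h : Flat m (fun s => σ s - σ' s) (φ t)) (hφ' : ContDiffAt ℝ ∞ φ' t)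
    (hφ : Flat m (fun s => φ s - φ' s) t) :
    Flat m (fun s => σ (φ s) - σ' (φ' s)) t := by
  have sφ : ContDiffAt ℝ ∞ φ t := by simpa using hφ.smooth.add hφ'
  have sσ' : ContDiffAt ℝ ∞ σ' (φ t) := by simpa using hσ.sub h.smooth
  have key : ∀ L : Coeff →L[ℝ] ℝ, Flat m (fun s => L (σ (φ s) - σ' (φ' s))) t := fun L => by
    have h1 := (h.clm L).comp sφ
    have h2 := Flat.comp_sub_comp (L.contDiff.contDiffAt.comp _ sσ') hφ' hφ
    refine (h1.add h2).congr (Eventually.of_forall fun s => ?_)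
    simp
  exact flat_coeff_iff.2 ⟨fun i j => key (entry 0 i j), fun i j => key (entry 1 i j),
    fun i j => key (entry 2 i j)⟩

end Congruence

/-! ### Jacobian matrices and derivatives of matrix functions. -/

/-- The Jacobian matrix `∂φʲ/∂tⁱ`, with row index `j`. -/
def jac (φ : Plane → Plane) (t : Plane) : M2 := Matrix.of fun j i => pd i φ t j

lemma MSm.jac {φ : Plane → Plane} {t : Plane} (hφ : ContDiffAt ℝ ∞ φ t) : MSm (jac φ) t :=
  fun j i => contDiffAt_pi.1 (hφ.pd i) j

lemma Flat.jac {m : ℕ} {φ : Plane → Plane} {t : Plane} (h : Flat (m + 1) φ t) :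
    MFlat m (jac φ) t :=
  fun j i => (h.pd i).apply j

/-- The entrywise partial derivative of a matrix function. -/
def mpd (i : Fin 2) (A : Plane → M2) (t : Plane) : M2 :=
  Matrix.of fun a b => pd i (fun s => A s a b) t

section mpd

variable {A B : Plane → M2} {t : Plane} (i : Fin 2)

lemma mpd_add (hA : MSm A t) (hB : MSm B t) :
    mpd i (fun s => A s + B s) t = mpd i A t + mpd i B t := by
  ext a b
  exact (pd_add (hA a b) (hB a b) i).eq_of_nhds

lemma mpd_mul (hA : MSm A t) (hB : MSm B t) :
    mpd i (fun s => A s * B s) t = mpd i A t * B t + A t * mpd i B t := by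
  ext a b
  simp only [mpd, Matrix.of_apply, Matrix.mul_apply, Matrix.add_apply, Fin.sum_univ_two]
  rw [(pd_add ((hA a 0).mul (hB 0 b)) ((hA a 1).mul (hB 1 b)) i).eq_of_nhds,
    (pd_mul (hA a 0) (hB 0 b) i).eq_of_nhds, (pd_mul (hA a 1) (hB 1 b) i).eq_of_nhds]
  ring

lemma mpd_const (C : M2) : mpd i (fun _ => C) t = 0 := by
  ext a b
  simp [mpd, pd]

lemma MFlat.mpd_eq_zero {m : ℕ} (hm : 1 ≤ m) (h : MFlat m A t) : mpd i A t = 0 := by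
  ext a b
  exact (((h a b).mono hm).pd i).eq_zero

end mpd

/-! ### Linear algebra of the infinitesimal isotropy at a regular point. -/

section LinearAlgebra

/-- The trace part of some derivative `k i` of the leaf metric `h` is not zero, and neither is the
trace-free part of some `k i`. -/
def Regular (h : M2) (k : Fin 2 → M2) : Prop :=
  (∃ i, (h.adjugate * k i).trace ≠ 0) ∧ ∃ i a b c d, h a b * k i c d ≠ h c d * k i a b

/-- `b X` is a skew `2 × 2` matrix, whose determinant is the square of its only independent entry;
this holds in every signature. -/
lemma eq_zero_of_skew {b X : M2} (hb : b.det ≠ 0) (hbs : bᵀ = b) (hX : Xᵀ * b + b * X = 0)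
    (hd : X.det = 0) : X = 0 := by
  have hu := isUnit_iff_ne_zero.2 hb
  have hs : (b * X)ᵀ + b * X = 0 := by rw [Matrix.transpose_mul, hbs, hX]
  have hdet : (b * X).det = 0 := by simp [hd]
  have e : ∀ i j, (b * X) j i + (b * X) i j = 0 := fun i j => congrFun (congrFun hs i) j
  have e00 := e 0 0
  have e01 := e 0 1
  have e11 := e 1 1
  rw [Matrix.det_fin_two] at hdet
  have h01 : (b * X) 0 1 = 0 := by
    refine pow_eq_zero_iff (two_ne_zero) |>.1 ?_
    linear_combination hdet + (b * X) 0 1 * e01 - (b * X) 1 1 / 2 * e00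
  have hZ : b * X = 0 := by
    ext i j
    fin_cases i <;> fin_cases j <;> simp only [Fin.zero_eta, Fin.mk_one, Matrix.zero_apply]
    exacts [by linarith, h01, by linarith, by linarith]
  rw [← Matrix.nonsing_inv_mul_cancel_left _ X hu, hZ, Matrix.mul_zero]

/-- The `h`-skew matrices form a line: `det h · Y = r (h₀₁, h₁₁; -h₀₀, -h₀₁)`. Substituting into the
equation for `k i` gives `r` times the `2 × 2` minors of the pair `(k i, h)`, which cannot all
vanish when `k i` is not proportional to `h`. -/
lemma rotation_eq_zero {h Y : M2} {k : Fin 2 → M2} (hd : h.det ≠ 0) (hs : hᵀ = h)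
    (ks : ∀ i, (k i)ᵀ = k i) (hr : ∃ i a b c d, h a b * k i c d ≠ h c d * k i a b)
    (hY : Yᵀ * h + h * Y = 0) (hk : ∀ j, Yᵀ * k j + k j * Y = 0) : Y = 0 := by
  have hs01 : h 1 0 = h 0 1 := congrFun (congrFun hs 0) 1
  have e : ∀ M : M2, Yᵀ * M + M * Y = 0 → M 1 0 = M 0 1 →
      M 0 0 * Y 0 0 + M 0 1 * Y 1 0 = 0 ∧ M 0 1 * Y 0 1 + M 1 1 * Y 1 1 = 0 ∧
      M 0 0 * Y 0 1 + M 0 1 * Y 1 1 + M 0 1 * Y 0 0 + M 1 1 * Y 1 0 = 0 := fun M hM h01 => by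
    have a := congrFun (congrFun hM 0) 0
    have b := congrFun (congrFun hM 1) 1
    have c := congrFun (congrFun hM 0) 1
    simp only [Matrix.add_apply, Matrix.mul_apply, Matrix.transpose_apply, Fin.sum_univ_two,
      Matrix.zero_apply, h01] at a b c
    exact ⟨by linarith, by linarith, by linarith⟩
  obtain ⟨h1, h2, h3⟩ := e h hY hs01
  rw [Matrix.det_fin_two, hs01] at hd
  set r := h 0 0 * Y 0 1 + h 0 1 * Y 1 1 with hr0
  have y00 : (h 0 0 * h 1 1 - h 0 1 * h 0 1) * Y 0 0 = h 0 1 * r := by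
    linear_combination h 1 1 * h1 - h 0 1 * h3 + h 0 1 * hr0
  have y10 : (h 0 0 * h 1 1 - h 0 1 * h 0 1) * Y 1 0 = - h 0 0 * r := by
    linear_combination h 0 0 * h3 - h 0 1 * h1 - h 0 0 * hr0
  have y01 : (h 0 0 * h 1 1 - h 0 1 * h 0 1) * Y 0 1 = h 1 1 * r := by
    linear_combination - h 0 1 * h2 - h 1 1 * hr0
  have y11 : (h 0 0 * h 1 1 - h 0 1 * h 0 1) * Y 1 1 = - h 0 1 * r := by
    linear_combination h 0 0 * h2 + h 0 1 * hr0
  have hr' : r = 0 := by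
    by_contra hne
    obtain ⟨i, a, b, c, d, hi⟩ := hr
    have k01 : k i 1 0 = k i 0 1 := congrFun (congrFun (ks i) 0) 1
    obtain ⟨k1, k2, k3⟩ := e (k i) (hk i) k01
    have m1 : k i 0 0 * h 0 1 - k i 0 1 * h 0 0 = 0 := (mul_eq_zero.1 (show
      r * (k i 0 0 * h 0 1 - k i 0 1 * h 0 0) = 0 by
        linear_combination (h 0 0 * h 1 1 - h 0 1 * h 0 1) * k1 - k i 0 0 * y00 - k i 0 1 * y10)).resolve_left hne
    have m2 : k i 0 1 * h 1 1 - k i 1 1 * h 0 1 = 0 := (mul_eq_zero.1 (show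
      r * (k i 0 1 * h 1 1 - k i 1 1 * h 0 1) = 0 by
        linear_combination (h 0 0 * h 1 1 - h 0 1 * h 0 1) * k2 - k i 0 1 * y01 - k i 1 1 * y11)).resolve_left hne
    have m3 : k i 0 0 * h 1 1 - k i 1 1 * h 0 0 = 0 := (mul_eq_zero.1 (show
      r * (k i 0 0 * h 1 1 - k i 1 1 * h 0 0) = 0 by
        linear_combination (h 0 0 * h 1 1 - h 0 1 * h 0 1) * k3 - k i 0 0 * y01 - k i 0 1 * y11
          - k i 0 1 * y00 - k i 1 1 * y10)).resolve_left hne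
    refine hi ?_
    fin_cases a <;> fin_cases b <;> fin_cases c <;> fin_cases d <;>
      simp only [Fin.zero_eta, Fin.mk_one, k01, hs01] <;> linarith
  ext a b
  refine (mul_eq_zero.1 (?_ : (h 0 0 * h 1 1 - h 0 1 * h 0 1) * Y a b = 0)).resolve_left hd
  fin_cases a <;> fin_cases b <;> simp [y00, y10, y01, y11, hr']

/-- Multiplying the last equation by `adj h` and taking traces removes `Y`, because `Y` is `h`-skew.
What remains is `Xᵀ τ = 0` with `τᵢ = tr(adj h · k i)`, the gradient of `det h` when `k i = ∂ᵢh`. As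
`τ ≠ 0`, `X` is singular and skew, hence zero; then `Y` is skew for every `k i` too. -/
lemma regular_rigid {h b X Y : M2} {k : Fin 2 → M2} (hr : Regular h k) (hd : h.det ≠ 0)
    (hs : hᵀ = h) (bd : b.det ≠ 0) (bs : bᵀ = b) (ks : ∀ i, (k i)ᵀ = k i)
    (hY : Yᵀ * h + h * Y = 0) (hX : Xᵀ * b + b * X = 0)
    (hk : ∀ j, Yᵀ * k j + k j * Y + ∑ c, X c j • k c = 0) : X = 0 ∧ Y = 0 := by
  have hcomm : h.adjugate * Yᵀ = - (Y * h.adjugate) := by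
    have h1 : h.adjugate * (Yᵀ * h + h * Y) * h.adjugate = 0 := by rw [hY]; simp
    have h2 : h.det • (h.adjugate * Yᵀ + Y * h.adjugate) = 0 := by
      rw [← h1, Matrix.mul_add, Matrix.add_mul, Matrix.mul_assoc, Matrix.mul_assoc Yᵀ,
        Matrix.mul_adjugate, ← Matrix.mul_assoc _ h Y, Matrix.adjugate_mul]
      simp [smul_add]
    exact eq_neg_of_add_eq_zero_left ((smul_eq_zero.1 h2).resolve_left hd)
  obtain ⟨⟨i₀, hi₀⟩, hr2⟩ := hr
  have hτ : Xᵀ *ᵥ (fun i => (h.adjugate * k i).trace) = 0 := by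
    ext j
    have h1 : (h.adjugate * (Yᵀ * k j + k j * Y + ∑ c, X c j • k c)).trace = 0 := by
      rw [hk]; simp
    rw [Matrix.mul_add, Matrix.mul_add, ← Matrix.mul_assoc, hcomm, Matrix.trace_add,
      Matrix.trace_add, Matrix.neg_mul, Matrix.trace_neg, ← Matrix.mul_assoc _ _ Y,
      Matrix.trace_mul_comm (h.adjugate * k j) Y, Matrix.mul_assoc Y] at h1
    simpa [Matrix.mulVec, dotProduct, Matrix.mul_add, Matrix.trace_add] using h1
  have hdX : X.det = 0 := by
    rw [← Matrix.det_transpose]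
    exact Matrix.exists_mulVec_eq_zero_iff.1 ⟨_, fun h0 => hi₀ (congrFun h0 i₀), hτ⟩
  have hX0 := eq_zero_of_skew bd bs hX hdX
  refine ⟨hX0, rotation_eq_zero hd hs ks hr2 hY fun j => ?_⟩
  simpa [hX0] using hk j

end LinearAlgebra

/-! ### Killing equations, the linearized action, and rigidity. -/

/-- A solution of the Killing equations modulo terms that are flat to order `j` gains an order of
flatness. -/
lemma flat_of_killing {j : ℕ} (hj : 1 ≤ j) {B : Plane → M2} {ξ : Plane → Plane} {t : Plane}
    (hB : MSm B t) (hd : (B t).det ≠ 0) (hξ : Flat j ξ t)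
    (h : MFlat j (fun s => (jac ξ s)ᵀ * B s + (B s)ᵀ * jac ξ s) t) : Flat (j + 1) ξ t := by
  obtain ⟨j, rfl⟩ : ∃ i, j = i + 1 := ⟨j - 1, by omega⟩
  -- Lowering the index: in terms of `κ` the equation reads `∂ₐκ_b + ∂_bκₐ ≡ 0` modulo terms in
  -- undifferentiated `ξ`, which are one order flatter.
  set κ : Fin 2 → Plane → ℝ := fun b s => ∑ c, ξ s c * B s c b with hκ
  have hκf : ∀ b, Flat (j + 1) (κ b) t := fun b =>
    Flat.sum _ fun c _ => (hξ.apply c).mul_right (hB c b)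
  have hpd : ∀ a b, pd a (κ b) =ᶠ[𝓝 t]
      fun s => ∑ c, (jac ξ s c a * B s c b + ξ s c * pd a (fun s => B s c b) s) := fun a b => by
    have hc := fun c => contDiffAt_pi.1 hξ.smooth c
    simp only [hκ, Fin.sum_univ_two]
    filter_upwards [pd_add ((hc 0).mul (hB 0 b)) ((hc 1).mul (hB 1 b)) a,
      pd_mul (hc 0) (hB 0 b) a, pd_mul (hc 1) (hB 1 b) a, hξ.smooth.eventually_diff]
      with s e1 e2 e3 e4
    rw [e1, e2, e3]
    simp only [jac, Matrix.of_apply, pd_apply e4]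
  have hS : ∀ a b, Flat (j + 1) (fun s => pd a (κ b) s + pd b (κ a) s) t := fun a b => by
    have h1 : ∀ a b, Flat (j + 1) (fun s => ∑ c, ξ s c * pd a (fun s => B s c b) s) t :=
      fun a b => Flat.sum _ fun c _ => (hξ.apply c).mul_right ((hB c b).pd a)
    refine ((h a b).add ((h1 a b).add (h1 b a))).congr ?_
    filter_upwards [hpd a b, hpd b a] with s e1 e2
    rw [e1, e2]
    simp only [Matrix.add_apply, Matrix.mul_apply, Matrix.transpose_apply, Fin.sum_univ_two]
    ring
  -- With `S_ab = ∂ₐκ_b + ∂_bκₐ`, the Christoffel trick gives `2 ∂_c∂ₐκ_b = ∂_c S_ab - ∂_b S_ca + ∂ₐ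
  -- S_bc`: all second derivatives of `κ` are controlled by first derivatives of `S`.
  have hK : ∀ a b, Flat (j + 1) (pd a (κ b)) t := fun a b => by
    have sκ := fun b => (hκf b).smooth
    refine ⟨(sκ b).pd a, ((hκf b).pd a).eq_zero, fun c => ?_⟩
    refine (((((hS a b).pd c).sub ((hS c a).pd b)).add ((hS b c).pd a)).mul_right
      (g := fun _ => 1 / 2) contDiffAt_const).congr ?_
    filter_upwards [pd_add ((sκ b).pd a) ((sκ a).pd b) c, pd_add ((sκ a).pd c) ((sκ c).pd a) b,
      pd_add ((sκ c).pd b) ((sκ b).pd c) a, pd_comm (sκ a) c b, pd_comm (sκ c) a b,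
      pd_comm (sκ b) a c] with s e1 e2 e3 e4 e5 e6
    rw [e1, e2, e3, e4, e5, e6]
    ring
  have hκ' : ∀ b, Flat (j + 1 + 1) (κ b) t := fun b =>
    ⟨(hκf b).smooth, (hκf b).eq_zero, fun a => hK a b⟩
  -- `ξ` is recovered from `κ` by multiplication with `B⁻¹`.
  refine Flat.pi fun c => ?_
  refine (Flat.sum Finset.univ fun b _ => (hκ' b).mul_right (hB.inv hd b c)).congr ?_
  filter_upwards [hB.det.continuousAt.eventually_ne hd] with s hs
  have := congrFun (congrArg (fun M => ξ s ᵥ* M)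
    (Matrix.mul_nonsing_inv (B s) (isUnit_iff_ne_zero.2 hs))) c
  rw [← Matrix.vecMul_vecMul, Matrix.vecMul_one] at this
  rw [← this]
  rfl

/-- The derivative of `pull` along `(J', K', α', g)`. -/
def linPullB (J K J' K' : M2) (c g : Coeff) : M2 :=
  J'ᵀ * bMat c * J + Jᵀ * bMat g * J + Jᵀ * bMat c * J'
    + (J'ᵀ * fMat c * K + Jᵀ * fMat g * K + Jᵀ * fMat c * K')
    + (K'ᵀ * (fMat c)ᵀ * J + Kᵀ * (fMat g)ᵀ * J + Kᵀ * (fMat c)ᵀ * J')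
    + (K'ᵀ * hMat c * K + Kᵀ * hMat g * K + Kᵀ * hMat c * K')

def linPullF (J K α J' K' α' : M2) (c g : Coeff) : M2 :=
  (J'ᵀ * fMat c + Jᵀ * fMat g + (K'ᵀ * hMat c + Kᵀ * hMat g)) * α
    + (Jᵀ * fMat c + Kᵀ * hMat c) * α'

def linPullH (α α' : M2) (c g : Coeff) : M2 :=
  α'ᵀ * hMat c * α + αᵀ * hMat g * α + αᵀ * hMat c * α'

/-- The derivative of the quotient metric along `g`. -/
def linQ (c g : Coeff) : M2 :=
  bMat g - fMat g * (aMat c)ᵀ - aMat c * (fMat g)ᵀ + aMat c * hMat g * (aMat c)ᵀ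

/-- `A` is the connection of the pulled-back metric, and the left side is the variation of its
quotient metric `b - f h⁻¹ fᵀ`. Since that quotient metric is `Jᵀ q J`, the variations `K'` and `α'`
must cancel. -/
lemma linPull_reduced {c g : Coeff} (hc : (hMat c).det ≠ 0) {J K α J' K' α' β A : M2}
    (hα : α * β = 1) (hA : A = (Jᵀ * aMat c + Kᵀ) * βᵀ) :
    linPullB J K J' K' c g - A * (linPullF J K α J' K' α' c g)ᵀ
      - linPullF J K α J' K' α' c g * Aᵀ + A * linPullH α α' c g * Aᵀ
      = J'ᵀ * qMat c * J + Jᵀ * qMat c * J' + Jᵀ * linQ c g * J := by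
  have hf : fMat c = aMat c * hMat c := by
    rw [aMat, Matrix.nonsing_inv_mul_cancel_right _ _ (isUnit_iff_ne_zero.2 hc)]
  have hb : bMat c = qMat c + aMat c * hMat c * (aMat c)ᵀ := by
    rw [← hf, qMat, aMat]
    simp [Matrix.transpose_mul, Matrix.transpose_nonsing_inv, Matrix.mul_assoc]
  have hβ : βᵀ * αᵀ = 1 := by rw [← Matrix.transpose_mul, hα, Matrix.transpose_one]
  set P : M2 := Jᵀ * aMat c + Kᵀ with hP
  have hPt : Pᵀ = (aMat c)ᵀ * J + K := by simp [hP, Matrix.transpose_mul]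
  have hAt : Aᵀ = β * Pᵀ := by rw [hA, Matrix.transpose_mul, Matrix.transpose_transpose]
  have e1 : linPullF J K α J' K' α' c g * Aᵀ
      = (J'ᵀ * fMat c + Jᵀ * fMat g + (K'ᵀ * hMat c + Kᵀ * hMat g)) * Pᵀ
        + P * hMat c * α' * β * Pᵀ := by
    rw [linPullF, hAt, hf, Matrix.add_mul, Matrix.mul_assoc _ α, ← Matrix.mul_assoc α, hα, one_mul,
      hP]
    simp only [Matrix.add_mul, Matrix.mul_assoc]
  have e2 : A * (linPullF J K α J' K' α' c g)ᵀ
      = P * ((fMat c)ᵀ * J' + (fMat g)ᵀ * J + (hMat c * K' + hMat g * K))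
        + P * βᵀ * α'ᵀ * hMat c * Pᵀ := by
    have := congrArg Matrix.transpose e1
    simp only [Matrix.transpose_mul, Matrix.transpose_add, Matrix.transpose_transpose,
      hMat_transpose] at this
    rw [Matrix.mul_assoc, Matrix.mul_assoc, Matrix.mul_assoc, this.symm.symm]
  have e3 : A * linPullH α α' c g * Aᵀ = P * βᵀ * α'ᵀ * hMat c * Pᵀ + P * hMat g * Pᵀ
      + P * hMat c * α' * β * Pᵀ := by
    have h1 : ∀ M : M2, βᵀ * (αᵀ * M) = M := fun M => by rw [← Matrix.mul_assoc, hβ, one_mul]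
    have h2 : ∀ M : M2, α * (β * M) = M := fun M => by rw [← Matrix.mul_assoc, hα, one_mul]
    rw [linPullH, hAt, hA]
    simp only [Matrix.add_mul, Matrix.mul_add, Matrix.mul_assoc, h1, h2]
  rw [e1, e2, e3, linPullB, linQ, hb, hf, hPt, hP]
  simp only [Matrix.transpose_mul, hMat_transpose]
  noncomm_ring

lemma clm_fderiv_eq {σ : Plane → Coeff} (L : Coeff →L[ℝ] ℝ) (t u : Plane) :
    L (fderiv ℝ σ t u) = ∑ c, u c * L (pd c σ t) := by
  rw [fderiv_eq_sum_pd, map_sum]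
  simp

section Variation

variable {m : ℕ} {φ ξ : Plane → Plane} {σ : Plane → Coeff} {t : Plane}

lemma Flat.variation {j : ℕ} (sσ : ContDiffAt ℝ ∞ σ (φ t)) (sφ : ContDiffAt ℝ ∞ φ t)
    (hξ : Flat j ξ t) : Flat j (fun s => fderiv ℝ σ (φ s) (ξ s)) t := by
  have key : ∀ L : Coeff →L[ℝ] ℝ, Flat j (fun s => L (fderiv ℝ σ (φ s) (ξ s))) t := fun L => by
    simp only [clm_fderiv_eq]
    exact Flat.sum _ fun c _ => (hξ.apply c).mul_right
      (L.contDiff.contDiffAt.comp t ((sσ.pd c).comp t sφ))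
  exact flat_coeff_iff.2 ⟨fun i j => key (entry 0 i j), fun i j => key (entry 1 i j),
    fun i j => key (entry 2 i j)⟩

lemma mpd_hMat_comp (sσ : ContDiffAt ℝ ∞ σ (φ t)) (sφ : ContDiffAt ℝ ∞ φ t) (i : Fin 2) :
    mpd i (fun s => hMat (σ (φ s))) t = ∑ j, jac φ t j i • hMat (pd j σ (φ t)) := by
  ext a b
  have h1 := (pd_clm (entry 2 a b) (sσ.comp t sφ) i).eq_of_nhds
  have h2 := (pd_comp sσ sφ i).eq_of_nhds
  simp only [Function.comp_def] at h1
  rw [h2, map_sum] at h1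
  simpa [mpd, jac, entry_two, Matrix.sum_apply] using h1

/-- As `ξ t = 0`, only the terms in which the derivative falls on `ξ` survive; no second derivative
of `σ` enters. -/
lemma mpd_hMat_variation (sσ : ContDiffAt ℝ ∞ σ (φ t)) (sφ : ContDiffAt ℝ ∞ φ t)
    (hξ : Flat 0 ξ t) (i : Fin 2) :
    mpd i (fun s => hMat (fderiv ℝ σ (φ s) (ξ s))) t
      = ∑ c, jac ξ t c i • hMat (pd c σ (φ t)) := by
  ext a b
  have h0 : ∀ c, ξ t c = 0 := fun c => congrFun hξ.eq_zero c
  have hc := fun c => contDiffAt_pi.1 hξ.smooth c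
  have hk : ∀ c, ContDiffAt ℝ ∞ (fun s => entry 2 a b (pd c σ (φ s))) t := fun c =>
    (entry 2 a b).contDiff.contDiffAt.comp t ((sσ.pd c).comp t sφ)
  have h1 : pd i (fun s => entry 2 a b (fderiv ℝ σ (φ s) (ξ s))) t
      = ∑ c, jac ξ t c i * entry 2 a b (pd c σ (φ t)) := by
    simp only [clm_fderiv_eq, Fin.sum_univ_two]
    rw [(pd_add ((hc 0).mul (hk 0)) ((hc 1).mul (hk 1)) i).eq_of_nhds]
    rw [(pd_mul (hc 0) (hk 0) i).eq_of_nhds, (pd_mul (hc 1) (hk 1) i).eq_of_nhds]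
    simp [jac, pd_apply hξ.smooth.diff, h0]
  simpa [Matrix.sum_apply, mpd, entry_two] using h1

end Variation

/-- An infinitesimal change of adapted coordinates that preserves the `m`-jet of a metric which is
regular at the point considered has trivial `m + 1`-jet. -/
lemma rigidity {m : ℕ} (hm : 1 ≤ m) {φ ψ ξ ζ : Plane → Plane} {σ : Plane → Coeff} {α a : M2}
    {t : Plane} (sφ : ContDiffAt ℝ ∞ φ t) (sψ : ContDiffAt ℝ ∞ ψ t) (sξ : ContDiffAt ℝ ∞ ξ t)
    (sσ : ContDiffAt ℝ ∞ σ (φ t)) (hJ : (jac φ t).det ≠ 0)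
    (hα : α.det ≠ 0) (hn : Nondeg (σ (φ t)))
    (hr : Regular (hMat (σ (φ t))) fun i => hMat (pd i σ (φ t))) (hξ0 : ξ t = 0)
    (hB : MFlat m (fun s => linPullB (jac φ s) (jac ψ s) (jac ξ s) (jac ζ s) (σ (φ s))
      (fderiv ℝ σ (φ s) (ξ s))) t)
    (hF : MFlat m (fun s => linPullF (jac φ s) (jac ψ s) α (jac ξ s) (jac ζ s) a (σ (φ s))
      (fderiv ℝ σ (φ s) (ξ s))) t)
    (hH : MFlat m (fun s => linPullH α a (σ (φ s)) (fderiv ℝ σ (φ s) (ξ s))) t) :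
    Flat (m + 1) ξ t ∧ a = 0 ∧ MFlat m (jac ζ) t := by
  rw [nondeg_iff] at hn
  obtain ⟨hq, hh⟩ := hn
  have hαu := isUnit_iff_ne_zero.2 hα
  have hαβ : α * α⁻¹ = 1 := Matrix.mul_nonsing_inv _ hαu
  have hβα : α⁻¹ * α = 1 := Matrix.nonsing_inv_mul _ hαu
  have hβαt : (α⁻¹)ᵀ * αᵀ = 1 := by rw [← Matrix.transpose_mul, hαβ, Matrix.transpose_one]
  have sc : ContDiffAt ℝ ∞ (fun s => σ (φ s)) t := sσ.comp t sφ
  obtain ⟨-, sf, sh⟩ := contDiffAt_coeff.1 sc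
  have sA := MSm.aMat sc hh
  have sq := MSm.qMat sc hh
  have sJ := MSm.jac sφ
  have sK := MSm.jac sψ
  have hξ : Flat 0 ξ t := ⟨sξ, hξ0⟩
  have hg : ∀ {j}, Flat j ξ t → Flat j (fun s => fderiv ℝ σ (φ s) (ξ s)) t :=
    fun h => Flat.variation sσ sφ h
  have hev : ∀ᶠ s in 𝓝 t, (hMat (σ (φ s))).det ≠ 0 :=
    sh.det.continuousAt.eventually_ne hh
  -- the equation for the quotient metric
  have sβ : MSm (fun _ : Plane => (α⁻¹)ᵀ) t := MSm.const _
  have hE : MFlat m (fun s => (jac ξ s)ᵀ * qMat (σ (φ s)) * jac φ s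
      + (jac φ s)ᵀ * qMat (σ (φ s)) * jac ξ s
      + (jac φ s)ᵀ * linQ (σ (φ s)) (fderiv ℝ σ (φ s) (ξ s)) * jac φ s) t := by
    have sA' := ((sJ.transpose.mul sA).add sK.transpose).mul sβ
    refine (((hB.sub (MFlat.mul_left sA' hF.transpose)).sub (hF.mul_right sA'.transpose)).add
      ((MFlat.mul_left sA' hH).mul_right sA'.transpose)).congr ?_
    filter_upwards [hev] with s hs
    exact linPull_reduced hs hαβ rfl
  have hQ : ∀ {j}, Flat j ξ t → MFlat j (fun s => (jac φ s)ᵀ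
      * linQ (σ (φ s)) (fderiv ℝ σ (φ s) (ξ s)) * jac φ s) t := fun h => by
    obtain ⟨gb, gf, gh⟩ := flat_coeff_iff.1 (hg h)
    exact (MFlat.mul_left sJ.transpose (((gb.sub (gf.mul_right sA.transpose)).sub
      (MFlat.mul_left sA gf.transpose)).add ((MFlat.mul_left sA gh).mul_right
      sA.transpose))).mul_right sJ
  have hE' : ∀ {j}, j ≤ m → Flat j ξ t → MFlat j (fun s =>
      (jac ξ s)ᵀ * (qMat (σ (φ s)) * jac φ s)
        + (qMat (σ (φ s)) * jac φ s)ᵀ * jac ξ s) t := fun hj h =>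
    ((hE.mono hj).sub (hQ h)).congr (Eventually.of_forall fun s => by
      simp [Matrix.transpose_mul, qMat_transpose, Matrix.mul_assoc])
  -- the equation for the metric of the leaves
  have hZ : MFlat m (fun s => (a * α⁻¹)ᵀ * hMat (σ (φ s)) + hMat (σ (φ s)) * (a * α⁻¹)
      + hMat (fderiv ℝ σ (φ s) (ξ s))) t := by
    refine ((MFlat.mul_left sβ hH).mul_right sβ.transpose).congr (Eventually.of_forall fun s => ?_)
    have h1 : ∀ M : M2, (α⁻¹)ᵀ * (αᵀ * M) = M := fun M => by
      rw [← Matrix.mul_assoc, hβαt, one_mul]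
    simp only [linPullH, Matrix.mul_add, Matrix.add_mul, Matrix.mul_assoc, h1, hαβ,
      Matrix.transpose_mul, Matrix.transpose_transpose, mul_one]
    abel
  obtain ⟨-, -, gh⟩ := flat_coeff_iff.1 (hg hξ)
  have hJu := isUnit_iff_ne_zero.2 hJ
  -- The values at `t` of the two equations above give the skewness of `X = jac ξ (jac φ)⁻¹` and `Y
  -- = a α⁻¹`. The relation coupling them is the first derivative of the leaf equation, available
  -- because `1 ≤ m`.
  obtain ⟨hX0, hY0⟩ : jac ξ t * (jac φ t)⁻¹ = 0 ∧ a * α⁻¹ = 0 := by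
    refine regular_rigid hr hh (hMat_transpose _) hq (qMat_transpose _)
      (fun i => hMat_transpose _) ?_ ?_ fun j => ?_
    · have := hZ.eq_zero
      have h0 : hMat (fderiv ℝ σ (φ t) (ξ t)) = 0 := gh.eq_zero
      rwa [h0, add_zero] at this
    · have h1 : (jac ξ t)ᵀ * (qMat (σ (φ t)) * jac φ t)
        + (qMat (σ (φ t)) * jac φ t)ᵀ * jac ξ t = 0 := (hE' (Nat.zero_le m) hξ).eq_zero
      have h2 : ((jac φ t)⁻¹)ᵀ * ((jac ξ t)ᵀ * (qMat (σ (φ t)) * jac φ t)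
        + (qMat (σ (φ t)) * jac φ t)ᵀ * jac ξ t) * (jac φ t)⁻¹ = 0 := by rw [h1]; simp
      have h3 : ((jac φ t)⁻¹)ᵀ * (jac φ t)ᵀ = 1 := by
        rw [← Matrix.transpose_mul, Matrix.mul_nonsing_inv _ hJu, Matrix.transpose_one]
      rw [← h2, Matrix.mul_add, Matrix.add_mul, Matrix.transpose_mul (qMat _), qMat_transpose,
        ← Matrix.mul_assoc ((jac φ t)⁻¹)ᵀ ((jac φ t)ᵀ * _), ← Matrix.mul_assoc ((jac φ t)⁻¹)ᵀ
        (jac φ t)ᵀ, h3, one_mul, Matrix.transpose_mul]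
      simp only [Matrix.mul_assoc, Matrix.mul_nonsing_inv _ hJu, mul_one]
    · have sY : MSm (fun _ : Plane => a * α⁻¹) t := MSm.const _
      have h1 : ∀ i, (a * α⁻¹)ᵀ * (∑ j, jac φ t j i • hMat (pd j σ (φ t)))
          + (∑ j, jac φ t j i • hMat (pd j σ (φ t))) * (a * α⁻¹)
          + ∑ c, jac ξ t c i • hMat (pd c σ (φ t)) = 0 := fun i => by
        have := hZ.mpd_eq_zero i hm
        rw [mpd_add i ((sY.transpose.mul sh).add (sh.mul sY)) gh.smooth,
          mpd_add i (sY.transpose.mul sh) (sh.mul sY), mpd_mul i sY.transpose sh,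
          mpd_mul i sh sY, mpd_const, mpd_const, mpd_hMat_comp sσ sφ,
          mpd_hMat_variation sσ sφ hξ] at this
        simpa using this
      -- Contraction with the inverse Jacobian replaces derivatives with respect to `t` by those of
      -- `σ` at `φ t`.
      have h2 : ∑ i, (jac φ t)⁻¹ i j • ((a * α⁻¹)ᵀ * (∑ j, jac φ t j i • hMat (pd j σ (φ t)))
          + (∑ j, jac φ t j i • hMat (pd j σ (φ t))) * (a * α⁻¹)
          + ∑ c, jac ξ t c i • hMat (pd c σ (φ t))) = 0 :=
        Finset.sum_eq_zero fun i _ => by rw [h1, smul_zero]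
      have h3 : ∀ l, ∑ i, (jac φ t)⁻¹ i j * jac φ t l i = if l = j then 1 else 0 := fun l => by
        rw [← Matrix.one_apply, ← Matrix.mul_nonsing_inv _ hJu, Matrix.mul_apply]
        exact Finset.sum_congr rfl fun i _ => mul_comm _ _
      have h4 : ∑ i, (jac φ t)⁻¹ i j • (∑ l, jac φ t l i • hMat (pd l σ (φ t)))
          = hMat (pd j σ (φ t)) := by
        simp only [Finset.smul_sum, smul_smul]
        rw [Finset.sum_comm]
        simp only [← Finset.sum_smul, h3]
        simp
      have h5 : ∑ i, (jac φ t)⁻¹ i j • (∑ l, jac ξ t l i • hMat (pd l σ (φ t)))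
          = ∑ l, (jac ξ t * (jac φ t)⁻¹) l j • hMat (pd l σ (φ t)) := by
        simp only [Finset.smul_sum, smul_smul]
        rw [Finset.sum_comm]
        simp only [← Finset.sum_smul, Matrix.mul_apply, mul_comm]
      have h6 : ∀ (S : Fin 2 → M2) (Y : M2), ∑ i, (jac φ t)⁻¹ i j • (S i * Y)
          = (∑ i, (jac φ t)⁻¹ i j • S i) * Y := fun S Y => by
        simp only [Finset.sum_mul, Matrix.smul_mul]
      have h7 : ∀ (S : Fin 2 → M2) (Y : M2), ∑ i, (jac φ t)⁻¹ i j • (Y * S i)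
          = Y * (∑ i, (jac φ t)⁻¹ i j • S i) := fun S Y => by
        simp only [Finset.mul_sum, Matrix.mul_smul]
      simp only [smul_add, Finset.sum_add_distrib] at h2
      rwa [h6, h7, h4, h5] at h2
  have hJξ : jac ξ t = 0 := by
    rw [← Matrix.nonsing_inv_mul_cancel_right _ (jac ξ t) hJu, hX0, zero_mul]
  have ha : a = 0 := by
    rw [← Matrix.nonsing_inv_mul_cancel_right _ a hαu, hY0, zero_mul]
  have hξ1 : Flat 1 ξ t := ⟨sξ, hξ0, fun i => ⟨sξ.pd i, funext fun j =>
    congrFun (congrFun hJξ j) i⟩⟩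
  -- Bootstrap: once `ξ` is flat to order `j`, so is the variation of the quotient metric along `ξ`,
  -- and the remaining terms are Killing equations modulo order `j`.
  have hind : ∀ j, j ≤ m → Flat (j + 1) ξ t := fun j => by
    induction j with
    | zero => exact fun _ => hξ1
    | succ j ih =>
      intro hj
      have h1 := ih (by omega)
      refine flat_of_killing (by omega) (sq.mul sJ) ?_ h1 (hE' hj h1)
      rw [Matrix.det_mul]
      exact mul_ne_zero hq hJ
  have hξm := hind m le_rfl
  refine ⟨hξm, ha, ?_⟩
  obtain ⟨-, gf, gh⟩ := flat_coeff_iff.1 (hg (hξm.mono (Nat.le_succ m)))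
  -- With `a = 0` and the terms in `ξ` flat, the mixed block is `(jac ζ)ᵀ h α` modulo flat terms;
  -- `α` and `h` are then cancelled.
  have hR := ((hF.mul_right sβ.transpose).sub ((hξm.jac.transpose.mul_right sf).add
    ((MFlat.mul_left sJ.transpose gf).add (MFlat.mul_left sK.transpose gh)))).mul_right
    (sh.inv hh)
  refine hR.transpose.congr ?_
  filter_upwards [hev] with s hs
  have hsu := isUnit_iff_ne_zero.2 hs
  refine Eq.trans (congrArg Matrix.transpose ?_) (Matrix.transpose_transpose (jac ζ s))
  simp only [linPullF, ha, mul_zero, add_zero, Matrix.transpose_transpose]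
  rw [Matrix.mul_assoc _ α, hαβ, mul_one]
  have : ∀ a b c d : M2, a + b + (c + d) - (a + (b + d)) = c := fun a b c d => by abel
  rw [this, Matrix.mul_nonsing_inv_cancel_right _ _ hsu]

/-! ### Dimensions of immersed images and of open sets. -/

section Dimension

variable {V E : Type*} [NormedAddCommGroup V] [NormedSpace ℝ V] [NormedAddCommGroup E]
  [NormedSpace ℝ E]

/-- `f` need not be injective: `HasDimension` asks only for an immersed image. Orbit maps may thus
have discrete isotropy. One chart, repeated countably often, suffices. -/
lemma hasDimension_image [FiniteDimensional ℝ V] {d : ℕ} (hd : Module.finrank ℝ V = d)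
    {Ω : Set V} (hΩ : IsOpen Ω) {f : V → E} (hf : ContDiff ℝ ∞ f)
    (h : ∀ p ∈ Ω, ∀ v, fderiv ℝ f p v = 0 → v = 0) : HasDimension (f '' Ω) d := by
  obtain ⟨L⟩ : Nonempty (EuclideanSpace ℝ (Fin d) ≃L[ℝ] V) :=
    FiniteDimensional.nonempty_continuousLinearEquiv_of_finrank_eq (by simp [hd])
  refine ⟨fun _ => L ⁻¹' Ω, fun _ => f ∘ L, fun _ => ⟨hΩ.preimage L.continuous,
    (hf.comp L.contDiff).contDiffOn, fun p hp => ?_⟩, ?_⟩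
  · rw [fderiv_comp p (hf.differentiable (by simp) _) L.differentiableAt, L.fderiv]
    refine (injective_iff_map_eq_zero _).2 fun v hv => ?_
    exact L.map_eq_zero_iff.1 (h (L p) hp (L v) hv)
  · rw [Set.iUnion_const, Set.image_comp, Set.image_preimage_eq _ L.surjective]

lemma hasDimension_of_isOpen [FiniteDimensional ℝ V] {d : ℕ} (hd : Module.finrank ℝ V = d)
    {S : Set V} (hS : IsOpen S) : HasDimension S d := by
  have := hasDimension_image hd hS (f := id) contDiff_id fun p _ v hv => by simpa using hv
  simpa using this

end Dimension

/-! ### Jets of families of metrics and their dependence on the parameters. -/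

section Family

variable {V E : Type*} [NormedAddCommGroup V] [NormedSpace ℝ V] [NormedAddCommGroup E]
  [NormedSpace ℝ E]

/-- The derivative of `f` in the constant direction `w`. -/
def dirDeriv (w : V) (f : V → E) : V → E := fun x => fderiv ℝ f x w

lemma _root_.ContDiff.dirDeriv {f : V → E} (hf : ContDiff ℝ ∞ f) (w : V) :
    ContDiff ℝ ∞ (dirDeriv w f) :=
  (hf.fderiv_right (m := ∞) (by simp)).clm_apply contDiff_const

lemma _root_.ContDiff.dirDeriv_iterate {f : V → E} (hf : ContDiff ℝ ∞ f) (w : V) (n : ℕ) :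
    ContDiff ℝ ∞ ((GTwo.dirDeriv w)^[n] f) := by
  induction n generalizing f with
  | zero => exact hf
  | succ n ih => exact ih (hf.dirDeriv w)

lemma dirDeriv_comm {f : V → E} (hf : ContDiff ℝ ∞ f) (v w : V) :
    dirDeriv v (dirDeriv w f) = dirDeriv w (dirDeriv v f) := by
  funext x
  have hd : DifferentiableAt ℝ (fderiv ℝ f) x :=
    (hf.fderiv_right (m := 1) (by norm_cast)).differentiable (by simp) x
  have hsym := ((hf.of_le (m := 2) (by norm_cast)).contDiffAt (x := x)).isSymmSndFDerivAt (by simp)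
  have key : ∀ a b : V, fderiv ℝ (fun x => fderiv ℝ f x a) x b = fderiv ℝ (fderiv ℝ f) x b a := by
    intro a b
    rw [fderiv_clm_apply hd (differentiableAt_const _)]
    simp
  change fderiv ℝ (fun x => fderiv ℝ f x w) x v = fderiv ℝ (fun x => fderiv ℝ f x v) x w
  rw [key, key]
  exact hsym.eq _ _

lemma dirDeriv_iterate_comm {f : V → E} (hf : ContDiff ℝ ∞ f) (v w : V) (n : ℕ) :
    (dirDeriv v)^[n] (dirDeriv w f) = dirDeriv w ((dirDeriv v)^[n] f) := by
  induction n generalizing f with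
  | zero => rfl
  | succ n ih =>
    rw [Function.iterate_succ_apply, dirDeriv_comm hf, ih (hf.dirDeriv v),
      Function.iterate_succ_apply]

/-- The `i`-th coordinate direction of the second factor of `V × ℝ²`. -/
def planeDir (i : Fin 2) : V × Plane := (0, Pi.single i 1)

/-- As directional derivatives on the product, the jet coordinates are visibly smooth in the
parameter, and they commute with derivatives in it. -/
lemma pd_iterate_family {G : V × Plane → E} (hG : ContDiff ℝ ∞ G) (p : V) (i : Fin 2) (n : ℕ) :
    (pd i)^[n] (fun t => G (p, t)) = fun t => (dirDeriv (planeDir i))^[n] G (p, t) := by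
  induction n generalizing G with
  | zero => rfl
  | succ n ih =>
    rw [Function.iterate_succ_apply, Function.iterate_succ_apply, ← ih (hG.dirDeriv _)]
    congr 1
    funext t
    have h1 : HasFDerivAt (fun t : Plane => (p, t)) (ContinuousLinearMap.inr ℝ V Plane) t :=
      hasFDerivAt_prodMk_right p t
    have := (((hG.differentiable (by simp)) (p, t)).hasFDerivAt.comp t h1).fderiv
    simp only [Function.comp_def] at this
    simp [pd, this, dirDeriv, planeDir]

lemma jet_family {m : ℕ} {G : V × Plane → Coeff} (hG : ContDiff ℝ ∞ G) (p : V) (x : Space) :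
    jet m (fun t => G (p, t)) x = (x, fun I => (dirDeriv (planeDir 0))^[(I.1.1 : ℕ)]
      ((dirDeriv (planeDir 1))^[(I.1.2 : ℕ)] G) (p, x.1)) := by
  refine Prod.ext rfl (funext fun I => ?_)
  change (pd 0)^[(I.1.1 : ℕ)] ((pd 1)^[(I.1.2 : ℕ)] (fun t => G (p, t))) x.1 = _
  rw [pd_iterate_family hG, pd_iterate_family (hG.dirDeriv_iterate _ _)]

/-- The `m`-jets of the metrics `G (p, ·)` of a family, at points depending on `p`. -/
def jetMap (m : ℕ) (G : V × Plane → Coeff) (π : V →L[ℝ] Space) (p : V) : JetSpace m :=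
  jet m (fun t => G (p, t)) (π p)

variable {m : ℕ} {G : V × Plane → Coeff} (hG : ContDiff ℝ ∞ G) (π : V →L[ℝ] Space)

include hG in
lemma contDiff_jetMap : ContDiff ℝ ∞ (jetMap m G π) := by
  have : jetMap m G π = fun p => _ := funext fun p => jet_family hG p (π p)
  rw [this]
  refine π.contDiff.prodMk (contDiff_pi.2 fun I => ?_)
  exact ((hG.dirDeriv_iterate _ _).dirDeriv_iterate _ _).comp
    (contDiff_id.prodMk (contDiff_fst.comp π.contDiff))

include hG in
-- The point component gives `π v = 0`. With the point fixed, parameter and `t`-derivatives commute,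
-- so the derivative of the jet is the jet of the variation of `G` along `v`.
lemma jetMap_kernel {p v : V} (h : fderiv ℝ (jetMap m G π) p v = 0) :
    π v = 0 ∧ Flat m (fun t => fderiv ℝ G (p, t) (v, 0)) (π p).1 := by
  have hd := (contDiff_jetMap (m := m) hG π).differentiable (by simp) p
  have h1 : π v = 0 := by
    have := ((ContinuousLinearMap.fst ℝ Space (MultiIndex m → Coeff)).hasFDerivAt.comp p
      hd.hasFDerivAt).unique (f₁' := π) π.hasFDerivAt
    have := congrArg (fun L => L v) this
    simpa [h] using this.symm
  refine ⟨h1, ?_⟩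
  have hS : ContDiff ℝ ∞ (fun q : V × Plane => fderiv ℝ G q (v, 0)) := hG.dirDeriv _
  have hS' : ContDiff ℝ ∞ (fun t => fderiv ℝ G (p, t) (v, 0)) :=
    hS.comp (contDiff_const.prodMk contDiff_id)
  rw [flat_iff hS'.contDiffAt]
  intro a b hab
  change (pd 0)^[a] ((pd 1)^[b] (fun t => dirDeriv (v, 0) G (p, t))) (π p).1 = 0
  rw [pd_iterate_family (hG.dirDeriv (v, 0)), pd_iterate_family ((hG.dirDeriv _).dirDeriv_iterate _ _),
    dirDeriv_iterate_comm hG, dirDeriv_iterate_comm (hG.dirDeriv_iterate _ _)]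
  set D := (dirDeriv (planeDir 0))^[a] ((dirDeriv (planeDir 1))^[b] G) with hD
  have sD : ContDiff ℝ ∞ D := (hG.dirDeriv_iterate _ _).dirDeriv_iterate _ _
  let I : MultiIndex m := ⟨(⟨a, by omega⟩, ⟨b, by omega⟩), hab⟩
  have h2 : (fun q => (jetMap m G π q).2 I) = fun q => D (q, (π q).1) := by
    funext q
    rw [jetMap, jet_family hG]
  have h3 : HasFDerivAt (fun q : V => (q, (π q).1)) ((ContinuousLinearMap.id ℝ V).prod
      ((ContinuousLinearMap.fst ℝ Plane Plane).comp π)) p :=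
    (hasFDerivAt_id p).prodMk ((ContinuousLinearMap.fst ℝ Plane Plane).comp π).hasFDerivAt
  have h4 := (sD.differentiable (by simp) (p, (π p).1)).hasFDerivAt.comp p h3
  have h5 := (((ContinuousLinearMap.proj (R := ℝ) (φ := fun _ : MultiIndex m => Coeff) I).comp
    (ContinuousLinearMap.snd ℝ Space _)).hasFDerivAt.comp p hd.hasFDerivAt)
  have h6 := congrArg (fun L => L v) (h5.unique (h4.congr_of_eventuallyEq
    (Eventually.of_forall fun q => congrFun h2 q)))
  simp only [ContinuousLinearMap.comp_apply, h, map_zero] at h6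
  simpa [h1, dirDeriv] using h6.symm

end Family

/-! ### Taylor polynomials with prescribed derivatives at a point. -/

section Taylor

variable {E : Type*} [NormedAddCommGroup E] [NormedSpace ℝ E]

/-- The monomial `(u¹)^p (u²)^q / (p! q!)`. -/
def monom (p q : ℕ) (u : Plane) : ℝ := u 0 ^ p / p.factorial * (u 1 ^ q / q.factorial)

lemma contDiff_monom (p q : ℕ) : ContDiff ℝ ∞ (monom p q) := by
  have h : ∀ i : Fin 2, ContDiff ℝ ∞ (fun u : Plane => u i) := fun i => contDiff_apply ℝ ℝ i
  exact (((h 0).pow p).div_const _).mul (((h 1).pow q).div_const _)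

/-- The polynomial at `c` with prescribed derivatives `w`, of the orders `e`. -/
def taylor {ι : Type*} [Fintype ι] (e : ι → ℕ × ℕ) (c : Plane) (w : ι → E) (t : Plane) : E :=
  ∑ i, monom (e i).1 (e i).2 (t - c) • w i

lemma contDiff_taylor {ι X : Type*} [Fintype ι] [NormedAddCommGroup X] [NormedSpace ℝ X]
    (e : ι → ℕ × ℕ) {c t : X → Plane} {w : X → ι → E} (hc : ContDiff ℝ ∞ c) (ht : ContDiff ℝ ∞ t)
    (hw : ContDiff ℝ ∞ w) : ContDiff ℝ ∞ (fun x => taylor e (c x) (w x) (t x)) :=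
  ContDiff.sum fun i _ => ((contDiff_monom _ _).comp (ht.sub hc)).smul (contDiff_pi.1 hw i)

lemma hasFDerivAt_apply_sub (i : Fin 2) (c t : Plane) :
    HasFDerivAt (fun t : Plane => (t - c) i) (ContinuousLinearMap.proj (R := ℝ)
      (φ := fun _ : Fin 2 => ℝ) i) t :=
  (ContinuousLinearMap.proj (R := ℝ) (φ := fun _ : Fin 2 => ℝ) i).hasFDerivAt.comp t
    ((hasFDerivAt_id t).sub_const c)

lemma hasDerivAt_pow_div_factorial (p : ℕ) (x : ℝ) :
    HasDerivAt (fun x : ℝ => x ^ p / p.factorial)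
      (if p = 0 then 0 else x ^ (p - 1) / (p - 1).factorial) x := by
  rcases p with _ | p
  · simpa using hasDerivAt_const x (1 : ℝ)
  · refine ((hasDerivAt_pow (p + 1) x).div_const _).congr_deriv ?_
    have : ((p + 1 : ℕ) : ℝ) ≠ 0 := by positivity
    rw [if_neg (Nat.succ_ne_zero p), Nat.factorial_succ, Nat.cast_mul, add_tsub_cancel_right]
    field_simp

lemma pd_monom (i : Fin 2) (p q : ℕ) (c : Plane) (w : E) :
    pd i (fun t => monom p q (t - c) • w) = fun t => (if i = 0 then
      (if p = 0 then 0 else monom (p - 1) q (t - c)) else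
      (if q = 0 then 0 else monom p (q - 1) (t - c))) • w := by
  funext t
  have h0 := (hasDerivAt_pow_div_factorial p ((t - c) 0)).comp_hasFDerivAt t
    (hasFDerivAt_apply_sub 0 c t)
  have h1 := (hasDerivAt_pow_div_factorial q ((t - c) 1)).comp_hasFDerivAt t
    (hasFDerivAt_apply_sub 1 c t)
  have h2 : HasFDerivAt (fun t => monom p q (t - c)) _ t := h0.mul h1
  rw [pd, (h2.smul_const w).fderiv]
  fin_cases i
  · rcases p with _ | p <;> rcases q with _ | q <;> simp [monom, mul_comm]
  · rcases p with _ | p <;> rcases q with _ | q <;> simp [monom]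

lemma pd_iterate_zero (i : Fin 2) (n : ℕ) : (pd i)^[n] (fun _ : Plane => (0 : E)) = fun _ => 0 := by
  induction n with
  | zero => rfl
  | succ n ih =>
    rw [Function.iterate_succ_apply]
    convert ih using 2
    funext t
    simp [pd]

lemma pd_zero_iterate_monom (n p q : ℕ) (c : Plane) (w : E) :
    (pd 0)^[n] (fun t => monom p q (t - c) • w)
      = fun t => if n ≤ p then monom (p - n) q (t - c) • w else 0 := by
  induction n generalizing p with
  | zero => simp
  | succ n ih =>
    rw [Function.iterate_succ_apply, pd_monom]
    rcases p with _ | p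
    · simpa using pd_iterate_zero 0 n
    · simpa using ih p

lemma pd_one_iterate_monom (n p q : ℕ) (c : Plane) (w : E) :
    (pd 1)^[n] (fun t => monom p q (t - c) • w)
      = fun t => if n ≤ q then monom p (q - n) (t - c) • w else 0 := by
  induction n generalizing q with
  | zero => simp
  | succ n ih =>
    rw [Function.iterate_succ_apply, pd_monom]
    rcases q with _ | q
    · simpa using pd_iterate_zero 1 n
    · simpa using ih q

lemma pd_iterate_monom (a b p q : ℕ) (c : Plane) (w : E) :
    (pd 0)^[a] ((pd 1)^[b] (fun t => monom p q (t - c) • w)) c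
      = if (p, q) = (a, b) then w else 0 := by
  rw [pd_one_iterate_monom]
  by_cases hb : b ≤ q
  · simp only [hb, if_true, pd_zero_iterate_monom]
    by_cases ha : a ≤ p
    · simp only [ha, if_true, sub_self, monom, Pi.zero_apply]
      by_cases h : (p, q) = (a, b)
      · obtain ⟨rfl, rfl⟩ := Prod.mk.inj h
        simp
      · rw [if_neg h]
        have : p - a ≠ 0 ∨ q - b ≠ 0 := by
          by_contra hc
          push Not at hc
          exact h (Prod.ext (by simp; omega) (by simp; omega))
        rcases this with h' | h' <;> simp [h']
    · rw [if_neg ha, if_neg (by rintro ⟨⟩; omega)]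
  · simp only [hb, if_false]
    rw [pd_iterate_zero, if_neg (by rintro ⟨⟩; omega)]

lemma pd_iterate_sum {ι : Type*} (s : Finset ι) {f : ι → Plane → E}
    (hf : ∀ i, ContDiff ℝ ∞ (f i)) (j : Fin 2) (n : ℕ) :
    (pd j)^[n] (fun t => ∑ i ∈ s, f i t) = fun t => ∑ i ∈ s, (pd j)^[n] (f i) t := by
  induction n generalizing f with
  | zero => rfl
  | succ n ih =>
    simp only [Function.iterate_succ_apply]
    have h := ih (f := fun i => pd j (f i)) fun i => (hf i).dirDeriv (Pi.single j 1)
    rw [← h]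
    congr 1
    funext t
    rw [pd, fderiv_fun_sum fun i _ => (hf i).differentiable (by simp) t]
    simp [pd]

lemma pd_iterate_taylor {ι : Type*} [Fintype ι] (e : ι → ℕ × ℕ) (c : Plane) (w : ι → E)
    (a b : ℕ) : (pd 0)^[a] ((pd 1)^[b] (taylor e c w)) c
      = ∑ i, if e i = (a, b) then w i else 0 := by
  have hs : ∀ i, ContDiff ℝ ∞ (fun t => monom (e i).1 (e i).2 (t - c) • w i) := fun i =>
    ((contDiff_monom _ _).comp (contDiff_id.sub contDiff_const)).smul contDiff_const
  have h0 : taylor e c w = fun t => ∑ i, monom (e i).1 (e i).2 (t - c) • w i := rfl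
  have hs' : ∀ (j : Fin 2) (n : ℕ) (f : Plane → E), ContDiff ℝ ∞ f → ContDiff ℝ ∞ ((pd j)^[n] f) :=
    fun j n f hf => hf.dirDeriv_iterate (Pi.single j 1) n
  rw [h0, pd_iterate_sum _ hs, pd_iterate_sum _ fun i => hs' 1 b _ (hs i)]
  exact Finset.sum_congr rfl fun i _ => pd_iterate_monom a b _ _ c (w i)

lemma pd_iterate_taylor_apply {ι : Type*} [Fintype ι] {e : ι → ℕ × ℕ}
    (he : Function.Injective e) (c : Plane) (w : ι → E) (i : ι) :
    (pd 0)^[(e i).1] ((pd 1)^[(e i).2] (taylor e c w)) c = w i := by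
  classical
  rw [pd_iterate_taylor, Finset.sum_eq_single i]
  · simp
  · intro j _ hj
    exact if_neg fun h => hj (he h)
  · simp

end Taylor

/-- Multi-indices `(p, q)` with `1 ≤ p + q ≤ m + 1`. -/
abbrev PosIndex (m : ℕ) : Type :=
  {p : Fin (m + 2) × Fin (m + 2) // 1 ≤ (p.1 : ℕ) + p.2 ∧ (p.1 : ℕ) + p.2 ≤ m + 1}

def ord {m : ℕ} (I : MultiIndex m) : ℕ × ℕ := (I.1.1, I.1.2)

def posOrd {m : ℕ} (I : PosIndex m) : ℕ × ℕ := (I.1.1, I.1.2)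

lemma ord_injective {m : ℕ} : Function.Injective (ord (m := m)) := fun I J h => by
  obtain ⟨h1, h2⟩ := Prod.mk.inj h
  exact Subtype.ext (Prod.ext (Fin.ext h1) (Fin.ext h2))

lemma posOrd_injective {m : ℕ} : Function.Injective (posOrd (m := m)) := fun I J h => by
  obtain ⟨h1, h2⟩ := Prod.mk.inj h
  exact Subtype.ext (Prod.ext (Fin.ext h1) (Fin.ext h2))

section TaylorFlat

variable {E : Type*} [NormedAddCommGroup E] [NormedSpace ℝ E] {m : ℕ}

lemma smooth_taylor {ι : Type*} [Fintype ι] (e : ι → ℕ × ℕ) (c : Plane) (w : ι → E) :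
    ContDiff ℝ ∞ (taylor e c w) :=
  contDiff_taylor e contDiff_const contDiff_id contDiff_const

lemma taylor_posOrd_self (c : Plane) (w : PosIndex m → E) : taylor posOrd c w c = 0 := by
  have := pd_iterate_taylor (posOrd (m := m)) c w 0 0
  refine this.trans (Finset.sum_eq_zero fun I _ => if_neg fun h => ?_)
  obtain ⟨h1, h2⟩ := Prod.mk.inj h
  have := I.2.1
  omega

lemma taylor_ord_eq_zero {c : Plane} {w : MultiIndex m → E} (h : Flat m (taylor ord c w) c) :
    w = 0 := by
  funext I
  rw [← pd_iterate_taylor_apply ord_injective c w I]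
  exact (flat_iff (smooth_taylor _ _ _).contDiffAt).1 h _ _ I.2

lemma taylor_posOrd_eq_zero {c : Plane} {w : PosIndex m → E}
    (h : Flat (m + 1) (taylor posOrd c w) c) : w = 0 := by
  funext I
  rw [← pd_iterate_taylor_apply posOrd_injective c w I]
  exact (flat_iff (smooth_taylor _ _ _).contDiffAt).1 h _ _ I.2.2

/-- The Taylor polynomial of order `m` agrees with the function to order `m`. -/
lemma flat_sub_taylor {f : Plane → E} {c : Plane} (hf : ContDiffAt ℝ ∞ f c) :
    Flat m (fun s => f s - taylor ord c (fun I : MultiIndex m =>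
      (pd 0)^[(ord I).1] ((pd 1)^[(ord I).2] f) c) s) c := by
  set g := taylor ord c (fun I : MultiIndex m =>
      (pd 0)^[(ord I).1] ((pd 1)^[(ord I).2] f) c) with hg
  have sg : ContDiff ℝ ∞ g := smooth_taylor _ _ _
  refine (flat_sub_iff hf sg.contDiffAt).2 fun p q hpq => ?_
  exact (pd_iterate_taylor_apply ord_injective c
    (fun I : MultiIndex m => (pd 0)^[(ord I).1] ((pd 1)^[(ord I).2] f) c)
    (⟨(⟨p, by omega⟩, ⟨q, by omega⟩), hpq⟩ : MultiIndex m)).symm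

/-- `PosIndex` omits order zero, so the value `f c` is added separately; it does not affect the
derivatives of positive order. -/
lemma flat_sub_taylor_pos {f : Plane → E} {c : Plane} (hf : ContDiffAt ℝ ∞ f c) :
    Flat (m + 1) (fun s => f s - (f c + taylor posOrd c (fun I : PosIndex m =>
      (pd 0)^[(posOrd I).1] ((pd 1)^[(posOrd I).2] f) c) s)) c := by
  set g := taylor posOrd c (fun I : PosIndex m =>
      (pd 0)^[(posOrd I).1] ((pd 1)^[(posOrd I).2] f) c) with hg
  have sg : ContDiff ℝ ∞ g := smooth_taylor _ _ _
  have h1 : Flat (m + 1) (fun s => (f s - f c) - g s) c := by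
    rw [flat_sub_iff (hf.sub contDiffAt_const) sg.contDiffAt]
    intro p q hpq
    by_cases h0 : p + q = 0
    · obtain ⟨rfl, rfl⟩ : p = 0 ∧ q = 0 := by omega
      simp [hg, taylor_posOrd_self]
    · refine Eq.trans ?_ (pd_iterate_taylor_apply posOrd_injective c _
        (⟨(⟨p, by omega⟩, ⟨q, by omega⟩), by simp; omega, hpq⟩ : PosIndex m)).symm
      have h2 : ∀ n i, n ≠ 0 → (pd i)^[n] (fun s => f s - f c) = (pd i)^[n] f := by
        intro n i hn
        obtain ⟨k, rfl⟩ := Nat.exists_eq_succ_of_ne_zero hn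
        rw [Function.iterate_succ_apply, Function.iterate_succ_apply]
        congr 1
        funext s
        simp only [pd, fderiv_sub_const]
      change (pd 0)^[p] ((pd 1)^[q] fun s => f s - f c) c = (pd 0)^[p] ((pd 1)^[q] f) c
      rcases Nat.eq_zero_or_pos q with rfl | hq
      · simp only [Function.iterate_zero, id_eq]
        rw [h2 p 0 (by omega)]
      · rw [h2 q 1 (by omega)]
  exact h1.congr (Eventually.of_forall fun s => sub_sub _ _ _)

end TaylorFlat

/-! ### Polynomial representatives of jets; regular jets. -/

section Representative

variable {m : ℕ}

/-- A polynomial metric with the given jet. -/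
def rep (θ : JetSpace m) : Plane → Coeff := taylor ord θ.1.1 θ.2

lemma smooth_rep (θ : JetSpace m) : ContDiff ℝ ∞ (rep θ) := smooth_taylor _ _ _

lemma jet_rep (θ : JetSpace m) : jet m (rep θ) θ.1 = θ :=
  Prod.ext rfl (funext fun I => pd_iterate_taylor_apply ord_injective _ _ I)

/-- The coordinates of a jet of order `(p, q)`. -/
def coef (θ : JetSpace m) (p q : ℕ) : Coeff := ∑ I, if ord I = (p, q) then θ.2 I else 0

lemma coef_eq (θ : JetSpace m) (p q : ℕ) :
    coef θ p q = (pd 0)^[p] ((pd 1)^[q] (rep θ)) θ.1.1 :=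
  (pd_iterate_taylor ord _ _ p q).symm

lemma coef_ord (θ : JetSpace m) (I : MultiIndex m) : coef θ (ord I).1 (ord I).2 = θ.2 I := by
  rw [coef_eq]
  exact pd_iterate_taylor_apply ord_injective _ _ I

lemma coef_jet (σ : Plane → Coeff) (x : Space) {p q : ℕ} (h : p + q ≤ m) :
    coef (jet m σ x) p q = (pd 0)^[p] ((pd 1)^[q] σ) x.1 :=
  coef_ord (jet m σ x) ⟨(⟨p, by omega⟩, ⟨q, by omega⟩), h⟩

lemma continuous_coef (p q : ℕ) : Continuous fun θ : JetSpace m => coef θ p q := by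
  refine continuous_finsetSum _ fun I _ => ?_
  split_ifs
  · exact (continuous_apply I).comp continuous_snd
  · exact continuous_const

lemma flat_sub_rep {σ : Plane → Coeff} {x : Space} (hσ : ContDiffAt ℝ ∞ σ x.1) :
    Flat m (fun s => σ s - rep (jet m σ x) s) x.1 :=
  (jet_eq_iff hσ (smooth_rep _).contDiffAt).1 (jet_rep (jet m σ x)).symm

/-- The jets of metrics which are regular at the point considered. -/
def RegularJet (θ : JetSpace m) : Prop :=
  Regular (hMat (coef θ 0 0)) ![hMat (coef θ 1 0), hMat (coef θ 0 1)]

lemma regularJet_jet_iff (hm : 1 ≤ m) (σ : Plane → Coeff) (x : Space) :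
    RegularJet (jet m σ x) ↔ Regular (hMat (σ x.1)) fun i => hMat (pd i σ x.1) := by
  rw [RegularJet, coef_jet σ x (by omega), coef_jet σ x (by omega), coef_jet σ x (by omega)]
  have : ![hMat ((pd 0)^[1] ((pd 1)^[0] σ) x.1), hMat ((pd 0)^[0] ((pd 1)^[1] σ) x.1)]
      = fun i => hMat (pd i σ x.1) := by
    funext i
    fin_cases i <;> rfl
  rw [this]
  rfl

lemma coef_jet_zero (σ : Plane → Coeff) (x : Space) : coef (jet m σ x) 0 0 = σ x.1 :=
  coef_jet σ x (by omega)

end Representative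

/-! ### Parametrization of an orbit by jets of transformations. -/

/-- Parameters for the transformations of adapted coordinates: a point, the linear part in `z`,
and the jets at that point, without their constant terms, of the remaining components. -/
abbrev OrbitParam (m : ℕ) : Type :=
  Space × (Fin 2 → Fin 2 → ℝ) × (PosIndex m → Plane) × (PosIndex m → Plane)

section OrbitMap

variable {m : ℕ}

def OrbitParam.alpha (p : OrbitParam m) : M2 := Matrix.of p.2.1

def OrbitParam.phi (p : OrbitParam m) : Plane → Plane := taylor posOrd p.1.1 p.2.2.1

def OrbitParam.psi (p : OrbitParam m) : Plane → Plane := taylor posOrd p.1.1 p.2.2.2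

lemma OrbitParam.smooth_phi (p : OrbitParam m) : ContDiff ℝ ∞ p.phi := smooth_taylor _ _ _

lemma OrbitParam.smooth_psi (p : OrbitParam m) : ContDiff ℝ ∞ p.psi := smooth_taylor _ _ _

/-- The pullbacks of a metric by the transformations of adapted coordinates. -/
def orbitFamily (θ : JetSpace m) (q : OrbitParam m × Plane) : Coeff :=
  pull (jac q.1.phi q.2) (jac q.1.psi q.2) q.1.alpha (rep θ (θ.1.1 + q.1.phi q.2))

lemma jac_const_add (φ : Plane → Plane) (c t : Plane) : jac (fun s => c + φ s) t = jac φ t := by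
  ext i j
  simp [jac, pd]

lemma contDiff_phi : ContDiff ℝ ∞ fun q : OrbitParam m × Plane => q.1.phi q.2 :=
  contDiff_taylor _ (contDiff_fst.comp (contDiff_fst.comp contDiff_fst)) contDiff_snd
    (contDiff_fst.comp (contDiff_snd.comp (contDiff_snd.comp contDiff_fst)))

lemma contDiff_psi : ContDiff ℝ ∞ fun q : OrbitParam m × Plane => q.1.psi q.2 :=
  contDiff_taylor _ (contDiff_fst.comp (contDiff_fst.comp contDiff_fst)) contDiff_snd
    (contDiff_snd.comp (contDiff_snd.comp (contDiff_snd.comp contDiff_fst)))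

lemma MSm.jac_family {V : Type*} [NormedAddCommGroup V] [NormedSpace ℝ V]
    {G : V × Plane → Plane} (hG : ContDiff ℝ ∞ G) (q : V × Plane) :
    MSm (fun q : V × Plane => GTwo.jac (fun t => G (q.1, t)) q.2) q := fun j i => by
  have h : (fun q : V × Plane => GTwo.jac (fun t => G (q.1, t)) q.2 j i)
      = fun q => dirDeriv (planeDir i) G q j := by
    funext q
    have := congrFun (pd_iterate_family hG q.1 i 1) q.2
    exact congrFun this j
  rw [h]
  exact (contDiff_pi.1 (hG.dirDeriv _) j).contDiffAt

lemma contDiff_orbitFamily (θ : JetSpace m) : ContDiff ℝ ∞ (orbitFamily θ) := by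
  rw [contDiff_iff_contDiffAt]
  intro q
  refine contDiffAt_pull (MSm.jac_family contDiff_phi q) (MSm.jac_family contDiff_psi q) ?_
    ((smooth_rep θ).comp (contDiff_const.add contDiff_phi)).contDiffAt
  intro i j
  have : ContDiff ℝ ∞ fun q : OrbitParam m × Plane => q.1.2.1 :=
    contDiff_fst.comp (contDiff_snd.comp contDiff_fst)
  exact (contDiff_pi.1 (contDiff_pi.1 this i) j).contDiffAt

/-- The jets of the pullbacks of a metric by the transformations of adapted coordinates. -/
def orbitMap (θ : JetSpace m) : OrbitParam m → JetSpace m :=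
  jetMap m (orbitFamily θ) (ContinuousLinearMap.fst ℝ Space _)

/-- The parameters of the invertible transformations. -/
def orbitDomain (m : ℕ) : Set (OrbitParam m) :=
  {p | p.alpha.det ≠ 0 ∧ (jac p.phi p.1.1).det ≠ 0}

lemma isOpen_orbitDomain : IsOpen (orbitDomain m) := by
  have h1 : Continuous fun p : OrbitParam m => p.alpha :=
    continuous_fst.comp continuous_snd
  have h2 : Continuous fun p : OrbitParam m => jac p.phi p.1.1 := continuous_matrix fun i j => by
    have : ContDiff ℝ ∞ fun q : OrbitParam m × Plane => jac q.1.phi q.2 i j :=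
      contDiff_iff_contDiffAt.2 fun q => MSm.jac_family contDiff_phi q i j
    have h3 : Continuous fun p : OrbitParam m => (p, p.1.1) :=
      continuous_id.prodMk (continuous_fst.comp continuous_fst)
    have h4 := this.continuous.comp h3
    exact h4
  exact (isOpen_ne.preimage h1.matrix_det).inter (isOpen_ne.preimage h2.matrix_det)

end OrbitMap

/-! ### The differential of the orbit map and its injectivity at regular jets. -/

/-- The entries of the matrix function `A` of a real variable have the derivatives `A'` at `0`. -/
def MDeriv (A : ℝ → M2) (A' : M2) : Prop := ∀ i j, HasDerivAt (fun s => A s i j) (A' i j) 0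

section MDeriv

variable {A B : ℝ → M2} {A' B' : M2}

lemma MDeriv.add (hA : MDeriv A A') (hB : MDeriv B B') : MDeriv (fun s => A s + B s) (A' + B') :=
  fun i j => (hA i j).add (hB i j)

lemma MDeriv.mul (hA : MDeriv A A') (hB : MDeriv B B') :
    MDeriv (fun s => A s * B s) (A' * B 0 + A 0 * B') := fun i j => by
  simp only [Matrix.mul_apply, Matrix.add_apply, ← Finset.sum_add_distrib]
  exact HasDerivAt.fun_sum fun k _ => (hA i k).mul (hB k j)

lemma MDeriv.transpose (hA : MDeriv A A') : MDeriv (fun s => (A s)ᵀ) A'ᵀ := fun i j => hA j i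

lemma MDeriv.affine (A A' : M2) : MDeriv (fun s => A + s • A') A' := fun i j => by
  simpa using ((hasDerivAt_id (0 : ℝ)).mul_const (A' i j)).const_add (A i j)

end MDeriv

lemma hasDerivAt_line {V E : Type*} [NormedAddCommGroup V] [NormedSpace ℝ V]
    [NormedAddCommGroup E] [NormedSpace ℝ E] {f : V → E} {x : V} (hf : DifferentiableAt ℝ f x)
    (v : V) : HasDerivAt (fun s : ℝ => f (x + s • v)) (fderiv ℝ f x v) 0 := by
  have h1 : HasDerivAt (fun s : ℝ => x + s • v) v 0 := by
    simpa using ((hasDerivAt_id (0 : ℝ)).smul_const v).const_add x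
  have h2 : HasFDerivAt f (fderiv ℝ f x) (x + (0 : ℝ) • v) := by simpa using hf.hasFDerivAt
  exact h2.comp_hasDerivAt 0 h1

lemma mDeriv_pull {J K α J' K' α' : M2} {σ : Plane → Coeff} {t u : Plane}
    (hσ : DifferentiableAt ℝ σ t) :
    MDeriv (fun s => bMat (pull (J + s • J') (K + s • K') (α + s • α') (σ (t + s • u))))
      (linPullB J K J' K' (σ t) (fderiv ℝ σ t u)) ∧
    MDeriv (fun s => fMat (pull (J + s • J') (K + s • K') (α + s • α') (σ (t + s • u))))
      (linPullF J K α J' K' α' (σ t) (fderiv ℝ σ t u)) ∧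
    MDeriv (fun s => hMat (pull (J + s • J') (K + s • K') (α + s • α') (σ (t + s • u))))
      (linPullH α α' (σ t) (fderiv ℝ σ t u)) := by
  have hs := hasDerivAt_line hσ u
  have key : ∀ L : Coeff →L[ℝ] ℝ, HasDerivAt (fun s : ℝ => L (σ (t + s • u)))
      (L (fderiv ℝ σ t u)) 0 := fun L => L.hasFDerivAt.comp_hasDerivAt 0 hs
  have hb : MDeriv (fun s => bMat (σ (t + s • u))) (bMat (fderiv ℝ σ t u)) :=
    fun i j => key (entry 0 i j)
  have hf : MDeriv (fun s => fMat (σ (t + s • u))) (fMat (fderiv ℝ σ t u)) :=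
    fun i j => key (entry 1 i j)
  have hh : MDeriv (fun s => hMat (σ (t + s • u))) (hMat (fderiv ℝ σ t u)) :=
    fun i j => key (entry 2 i j)
  have hJ := MDeriv.affine J J'
  have hK := MDeriv.affine K K'
  have hα := MDeriv.affine α α'
  refine ⟨?_, ?_, ?_⟩
  · simp only [bMat_pull]
    convert ((((hJ.transpose.mul hb).mul hJ).add ((hJ.transpose.mul hf).mul hK)).add
      ((hK.transpose.mul hf.transpose).mul hJ)).add ((hK.transpose.mul hh).mul hK) using 1
    simp only [zero_smul, add_zero, linPullB, Matrix.add_mul]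
  · simp only [fMat_pull]
    convert ((hJ.transpose.mul hf).add (hK.transpose.mul hh)).mul hα using 1
    simp only [zero_smul, add_zero, linPullF]
  · simp only [hMat_pull]
    convert (hα.transpose.mul hh).mul hα using 1
    simp only [zero_smul, add_zero, linPullH, Matrix.add_mul]

section Immersion

variable {m : ℕ}

lemma taylor_add_smul {ι E : Type*} [Fintype ι] [NormedAddCommGroup E] [NormedSpace ℝ E]
    (e : ι → ℕ × ℕ) (c : Plane) (w v : ι → E) (s : ℝ) (t : Plane) :
    taylor e c (w + s • v) t = taylor e c w t + s • taylor e c v t := by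
  simp only [taylor, Pi.add_apply, Pi.smul_apply, smul_add, Finset.sum_add_distrib,
    Finset.smul_sum, smul_comm s]

lemma jac_add_smul {φ ξ : Plane → Plane} {t : Plane} (hφ : DifferentiableAt ℝ φ t)
    (hξ : DifferentiableAt ℝ ξ t) (s : ℝ) :
    jac (fun t => φ t + s • ξ t) t = jac φ t + s • jac ξ t := by
  ext i j
  have h : HasFDerivAt (fun t => φ t + s • ξ t) (fderiv ℝ φ t + s • fderiv ℝ ξ t) t :=
    hφ.hasFDerivAt.add (hξ.hasFDerivAt.const_smul s)
  simp [jac, pd, h.fderiv]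

/-- The derivatives of the pullbacks in the directions that fix the point. -/
lemma fderiv_orbitFamily (θ : JetSpace m) {p v : OrbitParam m} (hv : v.1 = 0) (t : Plane) :
    let g := fderiv ℝ (orbitFamily θ) (p, t) (v, 0)
    let ξ : Plane → Plane := taylor posOrd p.1.1 v.2.2.1
    let ζ : Plane → Plane := taylor posOrd p.1.1 v.2.2.2
    let c := rep θ (θ.1.1 + p.phi t)
    let d := fderiv ℝ (rep θ) (θ.1.1 + p.phi t) (ξ t)
    bMat g = linPullB (jac p.phi t) (jac p.psi t) (jac ξ t) (jac ζ t) c d ∧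
    fMat g = linPullF (jac p.phi t) (jac p.psi t) p.alpha (jac ξ t) (jac ζ t) v.alpha c d ∧
    hMat g = linPullH p.alpha v.alpha c d := by
  intro g ξ ζ c d
  have h1 := hasDerivAt_line (((contDiff_orbitFamily θ).differentiable (by simp)) (p, t)) (v, 0)
  have sξ : DifferentiableAt ℝ ξ t := (smooth_taylor _ _ _).differentiable (by simp) t
  have sζ : DifferentiableAt ℝ ζ t := (smooth_taylor _ _ _).differentiable (by simp) t
  have e1 : ∀ s : ℝ, (p + s • v).phi = fun t => p.phi t + s • ξ t := fun s => by
    funext u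
    simp only [OrbitParam.phi, Prod.fst_add, Prod.snd_add, Prod.smul_fst, Prod.smul_snd, hv,
      smul_zero, add_zero, taylor_add_smul, ξ]
  have e2 : ∀ s : ℝ, (p + s • v).psi = fun t => p.psi t + s • ζ t := fun s => by
    funext u
    simp only [OrbitParam.psi, Prod.fst_add, Prod.snd_add, Prod.smul_fst, Prod.smul_snd, hv,
      smul_zero, add_zero, taylor_add_smul, ζ]
  have h2 : (fun s : ℝ => orbitFamily θ ((p, t) + s • (v, 0))) = fun s =>
      pull (jac p.phi t + s • jac ξ t) (jac p.psi t + s • jac ζ t) (p.alpha + s • v.alpha)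
        (rep θ (θ.1.1 + p.phi t + s • ξ t)) := by
    funext s
    simp only [orbitFamily, Prod.fst_add, Prod.snd_add, Prod.smul_fst, Prod.smul_snd, smul_zero,
      add_zero, e1, e2]
    rw [jac_add_smul (p.smooth_phi.differentiable (by simp) t) sξ,
      jac_add_smul (p.smooth_psi.differentiable (by simp) t) sζ, add_assoc]
    rfl
  rw [h2] at h1
  obtain ⟨hb, hf, hh⟩ := mDeriv_pull (J := jac p.phi t) (K := jac p.psi t) (α := p.alpha)
    (J' := jac ξ t) (K' := jac ζ t) (α' := v.alpha) (u := ξ t)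
    ((smooth_rep θ).differentiable (by simp) (θ.1.1 + p.phi t))
  refine ⟨?_, ?_, ?_⟩ <;> ext i j
  exacts [((entry 0 i j).hasFDerivAt.comp_hasDerivAt 0 h1).unique (hb i j),
    ((entry 1 i j).hasFDerivAt.comp_hasDerivAt 0 h1).unique (hf i j),
    ((entry 2 i j).hasFDerivAt.comp_hasDerivAt 0 h1).unique (hh i j)]

/-- A kernel vector fixes the point and is an infinitesimal transformation preserving the `m`-jet.
By `rigidity` its components are flat to order `m + 1`, and they are polynomials determined by
exactly those derivatives. -/
lemma orbitMap_immersion (hm : 1 ≤ m) {θ : JetSpace m} (hn : Nondeg (coef θ 0 0))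
    (hr : RegularJet θ) {p : OrbitParam m} (hp : p ∈ orbitDomain m) {v : OrbitParam m}
    (h : fderiv ℝ (orbitMap θ) p v = 0) : v = 0 := by
  obtain ⟨hv, hfl⟩ := jetMap_kernel (contDiff_orbitFamily θ) _ h
  replace hv : v.1 = 0 := hv
  set t := p.1.1
  set ξ : Plane → Plane := taylor posOrd p.1.1 v.2.2.1 with hξ
  set ζ : Plane → Plane := taylor posOrd p.1.1 v.2.2.2 with hζ
  obtain ⟨hb, hf, hh⟩ := flat_coeff_iff.1 hfl
  have key := fun s => fderiv_orbitFamily θ (p := p) hv s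
  have h0 : θ.1.1 + p.phi t = θ.1.1 := by
    simp [OrbitParam.phi, t, taylor_posOrd_self]
  have hj : ∀ s, jac (fun s => θ.1.1 + p.phi s) s = jac p.phi s := jac_const_add _ _
  have sξ : ContDiff ℝ ∞ ξ := smooth_taylor _ _ _
  have sζ : ContDiff ℝ ∞ ζ := smooth_taylor _ _ _
  rw [← jet_rep θ, regularJet_jet_iff hm] at hr
  rw [← jet_rep θ, coef_jet_zero] at hn
  obtain ⟨r1, r2, r3⟩ := rigidity hm (φ := fun s => θ.1.1 + p.phi s) (ψ := p.psi) (ξ := ξ) (ζ := ζ)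
    (σ := rep θ) (α := p.alpha) (a := v.alpha) (t := t)
    (contDiff_const.add p.smooth_phi).contDiffAt p.smooth_psi.contDiffAt sξ.contDiffAt
    (smooth_rep θ).contDiffAt ((hj t).symm ▸ hp.2) hp.1 (by rwa [h0]) (by rwa [h0])
    (taylor_posOrd_self _ _)
    (hb.congr (Eventually.of_forall fun s => by simp only [hj]; exact (key s).1))
    (hf.congr (Eventually.of_forall fun s => by simp only [hj]; exact (key s).2.1))
    (hh.congr (Eventually.of_forall fun s => by exact (key s).2.2))
  -- `rigidity` controls only `jac ζ`; the missing order-zero condition holds because `ζ` has no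
  -- constant term.
  have r4 : Flat (m + 1) ζ t := ⟨sζ.contDiffAt, taylor_posOrd_self _ _, fun i =>
    Flat.pi fun j => r3 j i⟩
  exact Prod.ext hv (Prod.ext r2 (Prod.ext (taylor_posOrd_eq_zero r1) (taylor_posOrd_eq_zero r4)))

end Immersion

lemma jac_mulVec (φ : Plane → Plane) (t u : Plane) : jac φ t *ᵥ u = fderiv ℝ φ t u := by
  rw [fderiv_eq_sum_pd]
  ext j
  simp [jac, Matrix.mulVec, dotProduct, mul_comm]

lemma flat_jac_sub {m : ℕ} {φ φ' : Plane → Plane} {t : Plane} (hφ : ContDiffAt ℝ ∞ φ t)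
    (hφ' : ContDiffAt ℝ ∞ φ' t) (h : Flat (m + 1) (fun s => φ s - φ' s) t) :
    MFlat m (fun s => jac φ s - jac φ' s) t := fun j i => by
  refine ((h.pd i).apply j).congr ?_
  filter_upwards [pd_sub hφ hφ' i] with s hs
  rw [hs]
  rfl

lemma fderiv_symm_fderiv {P : OpenPartialHomeomorph Space Space}
    (h1 : ContDiffOn ℝ ∞ P P.source) (h2 : ContDiffOn ℝ ∞ P.symm P.target) {y : Space}
    (hy : y ∈ P.source) (u : Space) : fderiv ℝ P.symm (P y) (fderiv ℝ P y u) = u := by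
  have d1 : DifferentiableAt ℝ P y := (h1.contDiffAt (P.open_source.mem_nhds hy)).diff
  have d2 : DifferentiableAt ℝ P.symm (P y) :=
    (h2.contDiffAt (P.open_target.mem_nhds (P.map_source hy))).diff
  have h3 : P.symm ∘ P =ᶠ[𝓝 y] id := P.eventually_left_inverse hy
  rw [← ContinuousLinearMap.comp_apply, ← fderiv_comp y d2 d1, h3.fderiv_eq, fderiv_id]
  rfl

/-! ### The orbit is the image of the orbit map. -/

section Orbit

variable {m : ℕ}

/-- The transformation with the given parameters, carrying the point `p.1` to `x`. -/
def OrbitParam.map (p : OrbitParam m) (x y : Space) : Space :=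
  (x.1 + p.phi y.1, x.2 + p.alpha *ᵥ (y.2 - p.1.2) + p.psi y.1)

/-- The linear map with the blocks `J`, `K` and `α`. -/
def blockMap (J K α : M2) : Space →L[ℝ] Space :=
  ((LinearMap.toContinuousLinearMap (Matrix.mulVecLin J)).comp
    (ContinuousLinearMap.fst ℝ Plane Plane)).prod
    ((LinearMap.toContinuousLinearMap (Matrix.mulVecLin K)).comp
    (ContinuousLinearMap.fst ℝ Plane Plane)
    + (LinearMap.toContinuousLinearMap (Matrix.mulVecLin α)).comp
    (ContinuousLinearMap.snd ℝ Plane Plane))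

lemma blockMap_apply (J K α : M2) (u : Space) :
    blockMap J K α u = (J *ᵥ u.1, K *ᵥ u.1 + α *ᵥ u.2) := rfl

lemma blockMap_injective {J K α : M2} (hJ : J.det ≠ 0) (hα : α.det ≠ 0) :
    Function.Injective (blockMap J K α) := by
  refine (injective_iff_map_eq_zero _).2 fun u hu => ?_
  rw [blockMap_apply] at hu
  obtain ⟨h1, h2⟩ := Prod.mk.inj hu
  have h3 : u.1 = 0 := Matrix.eq_zero_of_mulVec_eq_zero hJ h1
  rw [h3, Matrix.mulVec_zero, zero_add] at h2
  exact Prod.ext h3 (Matrix.eq_zero_of_mulVec_eq_zero hα h2)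

lemma gForm_pull' (J K α : M2) (c : Coeff) (u v : Space) :
    gForm (pull J K α c) u v = gForm c (blockMap J K α u) (blockMap J K α v) :=
  gForm_pull J K α c u v

lemma hasFDerivAt_map (p : OrbitParam m) (x y : Space) :
    HasFDerivAt (p.map x) (blockMap (jac p.phi y.1) (jac p.psi y.1) p.alpha) y := by
  have h1 : HasFDerivAt (fun y : Space => x.1 + p.phi y.1) _ y :=
    (((p.smooth_phi.differentiable (by simp) y.1).hasFDerivAt).comp y
      (hasFDerivAt_fst (p := y))).const_add x.1
  have h2 : HasFDerivAt (fun y : Space => p.psi y.1) _ y :=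
    ((p.smooth_psi.differentiable (by simp) y.1).hasFDerivAt).comp y (hasFDerivAt_fst (p := y))
  have h3 : HasFDerivAt (fun y : Space => p.alpha *ᵥ (y.2 - p.1.2)) _ y :=
    (LinearMap.toContinuousLinearMap (Matrix.mulVecLin p.alpha)).hasFDerivAt.comp y
      ((hasFDerivAt_snd (p := y)).sub_const p.1.2)
  refine (h1.prodMk ((h3.const_add x.2).add h2)).congr_fderiv ?_
  refine ContinuousLinearMap.ext fun u => ?_
  rw [blockMap_apply, jac_mulVec, jac_mulVec]
  exact Prod.ext rfl (add_comm _ _)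

lemma contDiff_map (p : OrbitParam m) (x : Space) : ContDiff ℝ ∞ (p.map x) := by
  refine (contDiff_const.add (p.smooth_phi.comp contDiff_fst)).prodMk
    ((contDiff_const.add ?_).add (p.smooth_psi.comp contDiff_fst))
  exact (LinearMap.toContinuousLinearMap (Matrix.mulVecLin p.alpha)).contDiff.comp
    (contDiff_snd.sub contDiff_const)

lemma map_self (p : OrbitParam m) (x : Space) : p.map x p.1 = x := by
  simp [OrbitParam.map, OrbitParam.phi, OrbitParam.psi, taylor_posOrd_self]

lemma continuous_jac_phi (p : OrbitParam m) : Continuous fun y : Space => jac p.phi y.1 :=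
  continuous_matrix fun i j => by
    have h : ContDiff ℝ ∞ fun t => jac p.phi t i j :=
      contDiff_iff_contDiffAt.2 fun t => MSm.jac p.smooth_phi.contDiffAt i j
    exact h.continuous.comp continuous_fst

/-- The point of the orbit with given parameters is in the orbit. -/
lemma orbitMap_mem_jetOrbit {θ : JetSpace m} (hn : Nondeg (coef θ 0 0)) {p : OrbitParam m}
    (hp : p ∈ orbitDomain m) : orbitMap θ p ∈ jetOrbit m θ := by
  set Q := p.map θ.1 with hQ
  have sQ : ContDiff ℝ ∞ Q := contDiff_map p θ.1
  have dQ := fun y => hasFDerivAt_map p θ.1 y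
  let D : ∀ y : Space, (jac p.phi y.1).det ≠ 0 → Space ≃L[ℝ] Space := fun y hy =>
    (LinearEquiv.ofInjectiveEndo (blockMap (jac p.phi y.1) (jac p.psi y.1) p.alpha :
      Space →ₗ[ℝ] Space) (blockMap_injective hy hp.1)).toContinuousLinearEquiv
  have hD : ∀ y hy, HasFDerivAt Q (D y hy : Space →L[ℝ] Space) y := fun y hy => dQ y
  -- The polynomial map `Q` is inverted near `p.1` by the inverse function theorem, then restricted
  -- to where its Jacobian is invertible and the metric at the image point nondegenerate.
  let R₀ := sQ.contDiffAt.toOpenPartialHomeomorph Q (hD p.1 hp.2) (by simp)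
  have hR₀ : (R₀ : Space → Space) = Q := rfl
  let N : Set Space := {y | (jac p.phi y.1).det ≠ 0} ∩ {y | Nondeg (rep θ (Q y).1)}
  have hN : IsOpen N := (isOpen_ne.preimage (continuous_jac_phi p).matrix_det).inter
    (isOpen_nondeg.preimage ((smooth_rep θ).continuous.comp (continuous_fst.comp sQ.continuous)))
  have hn' : Nondeg (rep θ θ.1.1) := by
    rw [← jet_rep θ, coef_jet_zero] at hn
    exact hn
  have hpN : p.1 ∈ N := ⟨hp.2, by
    change Nondeg (rep θ (Q p.1).1)
    rwa [hQ, map_self]⟩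
  let R := R₀.restrOpen N hN
  have hRs : R.source = R₀.source ∩ N := R₀.restrOpen_source N hN
  have hRQ : (R : Space → Space) = Q := rfl
  have hpR : p.1 ∈ R.source := by
    rw [hRs]
    exact ⟨sQ.contDiffAt.mem_toOpenPartialHomeomorph_source (hD p.1 hp.2) (by simp), hpN⟩
  have hsub : ∀ y ∈ R.source, y ∈ N := fun y hy => (hRs ▸ hy : y ∈ R₀.source ∩ N).2
  have s1 : ContDiffOn ℝ ∞ R R.source := sQ.contDiffOn
  have s2 : ContDiffOn ℝ ∞ R.symm R.target := fun w hw => by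
    exact (R.contDiffAt_symm hw (hD _ (hsub _ (R.map_target hw)).1)
      sQ.contDiffAt).contDiffWithinAt
  have dR : ∀ y ∈ R.source, ∀ u, fderiv ℝ R.symm (Q y)
      (blockMap (jac p.phi y.1) (jac p.psi y.1) p.alpha u) = u := fun y hy u => by
    rw [← (dQ y).fderiv]
    exact fderiv_symm_fderiv s1 s2 hy u
  have dR' : ∀ w ∈ R.target, ∀ u, blockMap (jac p.phi (R.symm w).1) (jac p.psi (R.symm w).1)
      p.alpha (fderiv ℝ R.symm w u) = u := fun w hw u => by
    rw [← (dQ _).fderiv]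
    exact fderiv_symm_fderiv (P := R.symm) s2 s1 hw u
  -- `Q` carries `p.1` to `θ.1` and pulls `rep θ` back to the new metric, so the transformation
  -- moving the jet forward is its inverse.
  refine ⟨R.symm, θ.1, rep θ, fun t => orbitFamily θ (p, t), ⟨s2, s1,
    (Matrix.GeneralLinearGroup.mkOfDetNeZero p.alpha hp.1)⁻¹, fun w hw v => ?_⟩, ?_, ?_, ?_,
    fun w hw u v => ?_, (jet_rep θ).symm, ?_⟩
  · have h1 := dR _ (R.map_target hw) (0, p.alpha⁻¹ *ᵥ v)
    have h2 : Q (R.symm w) = w := R.right_inv hw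
    rw [h2, blockMap_apply] at h1
    simp only [Matrix.mulVec_zero, zero_add, Matrix.mulVec_mulVec,
      Matrix.mul_nonsing_inv _ (isUnit_iff_ne_zero.2 hp.1), Matrix.one_mulVec] at h1
    rw [h1, Matrix.coe_units_inv]
    rfl
  · rw [← map_self p θ.1]
    exact R.map_source hpR
  · refine ⟨(smooth_rep θ).contDiffOn, ?_⟩
    rintro _ ⟨w, hw, rfl⟩
    have h1 := (hsub _ (R.map_target hw)).2
    have h2 : Q (R.symm w) = w := R.right_inv hw
    change Nondeg (rep θ (Q (R.symm w)).1) at h1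
    rwa [h2] at h1
  · refine ⟨((contDiff_orbitFamily θ).comp (contDiff_const.prodMk contDiff_id)).contDiffOn, ?_⟩
    rintro _ ⟨y, hy, rfl⟩
    exact nondeg_pull (hsub y hy).2 (hsub y hy).1 hp.1
  · have h2 : Q (R.symm w) = w := R.right_inv hw
    have h3 : rep θ (θ.1.1 + p.phi (R.symm w).1) = rep θ w.1 := by
      conv_rhs => rw [← h2]
      rfl
    simp only [orbitFamily]
    rw [gForm_pull', dR' w hw, dR' w hw, h3]
  · have h1 : R.symm θ.1 = p.1 := by
      have := R.left_inv hpR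
      rwa [hRQ, hQ, map_self] at this
    rw [h1]
    rfl

/-- The jets at a point of a metric and of its pullback by a transformation of adapted
coordinates. -/
lemma jetOrbit_subset {θ θ' : JetSpace m} (h : θ' ∈ jetOrbit m θ) :
    ∃ p ∈ orbitDomain m, orbitMap θ p = θ' := by
  obtain ⟨P, x, σ, σ', ⟨s1, s2, a, hα⟩, hx, hσ, hσ', hiso, rfl, rfl⟩ := h
  have hx' := P.map_source hx
  have d2 : ∀ y ∈ P.target, ContDiffAt ℝ ∞ P.symm y := fun y hy =>
    s2.contDiffAt (P.open_target.mem_nhds hy)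
  set x' := P x with hxx
  set β : M2 := (a.val)⁻¹ with hβ
  have hadet : a.val.det ≠ 0 := (Matrix.isUnit_iff_isUnit_det _).1 a.isUnit |>.ne_zero
  have hβdet : β.det ≠ 0 := by
    rw [hβ, Matrix.det_nonsing_inv, Ring.inverse_eq_inv']
    exact inv_ne_zero hadet
  -- the components of the inverse transformation
  let φ : Plane → Plane := fun t => (P.symm (t, x'.2)).1
  let ψ : Plane → Plane := fun t => (P.symm (t, x'.2)).2
  have hnhds : ∀ᶠ t in 𝓝 x'.1, (t, x'.2) ∈ P.target := by
    have : Tendsto (fun t : Plane => (t, x'.2)) (𝓝 x'.1) (𝓝 x') :=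
      (Continuous.prodMk_left x'.2).tendsto x'.1
    exact this.eventually (P.open_target.mem_nhds hx')
  have sQ : ∀ t, (t, x'.2) ∈ P.target → ContDiffAt ℝ ∞ (fun t => P.symm (t, x'.2)) t :=
    fun t ht => ContDiffAt.comp t (d2 _ ht) (contDiffAt_id.prodMk contDiffAt_const)
  have sφ : ContDiffAt ℝ ∞ φ x'.1 := contDiffAt_fst.comp _ (sQ x'.1 hx')
  have sψ : ContDiffAt ℝ ∞ ψ x'.1 := contDiffAt_snd.comp _ (sQ x'.1 hx')
  have hblock : ∀ t, (t, x'.2) ∈ P.target →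
      fderiv ℝ P.symm (t, x'.2) = blockMap (jac φ t) (jac ψ t) β := fun t ht => by
    have e1 : HasFDerivAt (fun t : Plane => P.symm (t, x'.2))
        ((fderiv ℝ P.symm (t, x'.2)).comp (ContinuousLinearMap.inl ℝ Plane Plane)) t :=
      (d2 _ ht).diff.hasFDerivAt.comp t (hasFDerivAt_prodMk_left t x'.2)
    have e2 : ∀ v, fderiv ℝ P.symm (t, x'.2) (0, v) = (0, β *ᵥ v) := fun v => by
      have h1 := hα _ (P.map_target ht) (β *ᵥ v)
      have h2 := fderiv_symm_fderiv s1 s2 (P.map_target ht) (0, β *ᵥ v)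
      rw [h1, P.right_inv ht, Matrix.mulVec_mulVec, hβ,
        Matrix.mul_nonsing_inv _ (isUnit_iff_ne_zero.2 hadet), Matrix.one_mulVec] at h2
      exact h2
    refine ContinuousLinearMap.ext fun u => ?_
    have h3 : u = (u.1, 0) + (0, u.2) := by simp
    have h4 : fderiv ℝ P.symm (t, x'.2) (u.1, 0) = (fderiv ℝ φ t u.1, fderiv ℝ ψ t u.1) := by
      have f1 : fderiv ℝ φ t = _ := (hasFDerivAt_fst.comp t e1).fderiv
      have f2 : fderiv ℝ ψ t = _ := (hasFDerivAt_snd.comp t e1).fderiv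
      rw [f1, f2]
      rfl
    conv_lhs => rw [h3]
    rw [map_add, h4, e2, blockMap_apply, jac_mulVec, jac_mulVec]
    simp
  have hpull : ∀ᶠ t in 𝓝 x'.1, pull (jac φ t) (jac ψ t) β (σ (φ t)) = σ' t := by
    filter_upwards [hnhds] with t ht
    refine gForm_ext fun u v => ?_
    have h1 := hiso _ (P.map_target ht) (fderiv ℝ P.symm (t, x'.2) u)
      (fderiv ℝ P.symm (t, x'.2) v)
    have h2 : ∀ w, fderiv ℝ P (P.symm (t, x'.2)) (fderiv ℝ P.symm (t, x'.2) w) = w := fun w =>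
      fderiv_symm_fderiv (P := P.symm) s2 s1 ht w
    rw [h2, h2, P.right_inv ht, hblock t ht] at h1
    rw [gForm_pull', h1]
  have hφx : φ x'.1 = x.1 := congrArg Prod.fst (P.left_inv hx)
  -- A vector `u` in the kernel of `jac φ` can be completed by a `z`-component that cancels `jac ψ
  -- u`, which gives a kernel vector of the invertible derivative of `P.symm`.
  have hJ : (jac φ x'.1).det ≠ 0 := by
    intro h0
    obtain ⟨u, hu, hu'⟩ := Matrix.exists_mulVec_eq_zero_iff.2 h0
    have h1 := fderiv_symm_fderiv (P := P.symm) s2 s1 hx'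
      (u, - (a.val *ᵥ (jac ψ x'.1 *ᵥ u)))
    have h2 := hblock x'.1 hx'
    have h3 : blockMap (jac φ x'.1) (jac ψ x'.1) β (u, - (a.val *ᵥ (jac ψ x'.1 *ᵥ u))) = 0 := by
      have h5 : ∀ w, β *ᵥ (a.val *ᵥ w) = w := fun w => by
        rw [Matrix.mulVec_mulVec, hβ, Matrix.nonsing_inv_mul _ (isUnit_iff_ne_zero.2 hadet),
          Matrix.one_mulVec]
      rw [blockMap_apply, hu', Matrix.mulVec_neg, h5, add_neg_cancel]
      rfl
    have h4 : fderiv ℝ P.symm x' = blockMap (jac φ x'.1) (jac ψ x'.1) β := h2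
    rw [h4, h3, map_zero] at h1
    exact hu (congrArg Prod.fst h1).symm
  have sσ : ContDiffAt ℝ ∞ σ x.1 :=
    hσ.1.contDiffAt ((isOpenMap_fst _ P.open_source).mem_nhds ⟨x, hx, rfl⟩)
  have sσ' : ContDiffAt ℝ ∞ σ' x'.1 :=
    hσ'.1.contDiffAt ((isOpenMap_fst _ P.open_target).mem_nhds ⟨x', hx', rfl⟩)
  -- The parameters are the Taylor coefficients of the inverse transformation at the image point.
  let p : OrbitParam m := (x', fun i j => β i j,
    fun I => (pd 0)^[(posOrd I).1] ((pd 1)^[(posOrd I).2] φ) x'.1,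
    fun I => (pd 0)^[(posOrd I).1] ((pd 1)^[(posOrd I).2] ψ) x'.1)
  have fφ : Flat (m + 1) (fun s => φ s - (φ x'.1 + p.phi s)) x'.1 := flat_sub_taylor_pos sφ
  have fψ : Flat (m + 1) (fun s => ψ s - (ψ x'.1 + p.psi s)) x'.1 := flat_sub_taylor_pos sψ
  have cφ : ContDiffAt ℝ ∞ (fun s => φ x'.1 + p.phi s) x'.1 :=
    (contDiff_const.add p.smooth_phi).contDiffAt
  have cψ : ContDiffAt ℝ ∞ (fun s => ψ x'.1 + p.psi s) x'.1 :=
    (contDiff_const.add p.smooth_psi).contDiffAt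
  have jφ := flat_jac_sub sφ cφ fφ
  have jψ := flat_jac_sub sψ cψ fψ
  simp only [jac_const_add] at jφ jψ
  refine ⟨p, ⟨hβdet, ?_⟩, ?_⟩
  · have := sub_eq_zero.1 jφ.eq_zero
    change (jac p.phi x'.1).det ≠ 0
    rwa [← this]
  · refine ((jet_eq_iff (x := x') sσ' ?_).2 ?_).symm
    · exact ((contDiff_orbitFamily _).comp (contDiff_const.prodMk contDiff_id)).contDiffAt
    · have sσφ : ContDiffAt ℝ ∞ (fun s => σ (φ s)) x'.1 :=
        ContDiffAt.comp _ (hφx.symm ▸ sσ) sφ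
      have h1 : Flat m (fun s => σ (φ s) - rep (jet m σ x) (φ x'.1 + p.phi s)) x'.1 := by
        refine flat_comp_sub (hφx.symm ▸ sσ) ?_ cφ (fφ.mono (Nat.le_succ m))
        rw [hφx]
        exact flat_sub_rep sσ
      rw [hφx] at h1
      have h2 : ContDiffAt ℝ ∞ (fun s => rep (jet m σ x) (x.1 + p.phi s)) x'.1 :=
        ((smooth_rep _).comp (contDiff_const.add p.smooth_phi)).contDiffAt
      refine (flat_pull_sub (α := β) jφ jψ h1 (MSm.jac sφ) (MSm.jac sψ)
        (MSm.jac p.smooth_phi.contDiffAt) (MSm.jac p.smooth_psi.contDiffAt) sσφ h2).congr ?_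
      filter_upwards [hpull] with s hs
      rw [hs]
      rfl

lemma jetOrbit_eq {θ : JetSpace m} (hn : Nondeg (coef θ 0 0)) :
    jetOrbit m θ = orbitMap θ '' orbitDomain m := by
  ext θ'
  constructor
  · exact fun h => jetOrbit_subset h
  · rintro ⟨p, hp, rfl⟩
    exact orbitMap_mem_jetOrbit hn hp

end Orbit

/-! ### Integrability of `Ξ^⊥` and closedness of the connection. -/

/-- Solving `fᵀ v₁ + h v₂ = 0` for `v₂` exhibits `Ξ^⊥` as the horizontal distribution of the
connection `aMat`. -/
lemma mem_orthLeaf_iff {c : Coeff} (h : (hMat c).det ≠ 0) (v : Space) :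
    v ∈ orthLeaf c ↔ v.2 = - ((aMat c)ᵀ *ᵥ v.1) := by
  have hu := isUnit_iff_ne_zero.2 h
  have h1 : v ∈ orthLeaf c ↔ (fMat c)ᵀ *ᵥ v.1 + hMat c *ᵥ v.2 = 0 := by
    have h2 : ∀ w, gForm c v (0, w) = ((fMat c)ᵀ *ᵥ v.1 + hMat c *ᵥ v.2) ⬝ᵥ w := fun w => by
      have h3 : v.2 ⬝ᵥ hMat c *ᵥ w = (hMat c *ᵥ v.2) ⬝ᵥ w := by
        rw [Matrix.dotProduct_mulVec, ← Matrix.mulVec_transpose, hMat_transpose]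
      rw [gForm_eq]
      simp only [Matrix.mulVec_zero, zero_add, add_dotProduct]
      rw [h3, Matrix.dotProduct_mulVec, ← Matrix.mulVec_transpose]
    simp only [orthLeaf, Set.mem_ofPred_eq, h2]
    exact ⟨fun h0 => dotProduct_eq_zero _ h0, fun h0 w => by rw [h0, zero_dotProduct]⟩
  have h4 : (aMat c)ᵀ = (hMat c)⁻¹ * (fMat c)ᵀ := by
    rw [aMat, Matrix.transpose_mul, Matrix.transpose_nonsing_inv, hMat_transpose]
  rw [h1, h4, ← Matrix.mulVec_mulVec]
  constructor
  · intro h0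
    rw [eq_neg_of_add_eq_zero_left h0, Matrix.mulVec_neg, Matrix.mulVec_mulVec,
      Matrix.nonsing_inv_mul _ hu, Matrix.one_mulVec, neg_neg]
  · intro h0
    rw [h0, Matrix.mulVec_neg, Matrix.mulVec_mulVec, Matrix.mul_nonsing_inv _ hu,
      Matrix.one_mulVec, add_neg_cancel]

/-- If `Ξ^⊥` is integrable, the connection is flat. -/
lemma closed_of_orthIntegrableOn {σ : Plane → Coeff} {Ω : Set Plane} (hΩ : IsOpen Ω)
    (hσ : IsMetricOn σ Ω) (hI : OrthIntegrableOn σ Ω) {t : Plane} (ht : t ∈ Ω) (k : Fin 2) :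
    pd 0 (fun s => aMat (σ s) 1 k) t = pd 1 (fun s => aMat (σ s) 0 k) t := by
  obtain ⟨W, e, hW, se, ⟨w, hw, hwy⟩, he⟩ := hI (t, 0) ht
  have sA : MSm (fun s => aMat (σ s)) t :=
    MSm.aMat (hσ.1.contDiffAt (hΩ.mem_nhds ht)) (hσ.2 t ht).2
  have se' : ∀ w ∈ W, ContDiffAt ℝ ∞ e w := fun w hw => se.contDiffAt (hW.mem_nhds hw)
  let e₁ : Plane → Plane := fun w => (e w).1
  let e₂ : Plane → Plane := fun w => (e w).2
  have s₁ : ∀ w ∈ W, ContDiffAt ℝ ∞ e₁ w := fun w hw => contDiffAt_fst.comp _ (se' w hw)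
  have s₂ : ∀ w ∈ W, ContDiffAt ℝ ∞ e₂ w := fun w hw => contDiffAt_snd.comp _ (se' w hw)
  have hd : ∀ w ∈ W, ∀ u, fderiv ℝ e w u = (fderiv ℝ e₁ w u, fderiv ℝ e₂ w u) := fun w hw u => by
    have f1 : fderiv ℝ e₁ w = _ := (hasFDerivAt_fst.comp w (se' w hw).diff.hasFDerivAt).fderiv
    have f2 : fderiv ℝ e₂ w = _ := (hasFDerivAt_snd.comp w (se' w hw).diff.hasFDerivAt).fderiv
    rw [f1, f2]
    rfl
  -- Along an integral manifold `dz = -Aᵀ dt`.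
  have hrel : ∀ w ∈ W, ∀ u, fderiv ℝ e₂ w u
      = - ((aMat (σ (e₁ w)))ᵀ *ᵥ fderiv ℝ e₁ w u) := fun w hw u => by
    have h1 : fderiv ℝ e w u ∈ orthLeaf (σ (e w).1) := (he w hw).2.2 ▸ ⟨u, rfl⟩
    rw [mem_orthLeaf_iff (hσ.2 _ (he w hw).1).2, hd w hw] at h1
    exact h1
  have ht₁ : e₁ w = t := congrArg Prod.fst hwy
  have c₁ := fun j => contDiffAt_pi.1 (s₁ w hw) j
  have c₂ := contDiffAt_pi.1 (s₂ w hw) k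
  have sA' : ∀ i, ContDiffAt ℝ ∞ (fun s => aMat (σ s) i k) (e₁ w) := fun i => by
    rw [ht₁]
    exact sA i k
  have a₁ : ∀ i, ContDiffAt ℝ ∞ (fun w => aMat (σ (e₁ w)) i k) w := fun i =>
    ContDiffAt.comp w (sA' i) (s₁ w hw)
  have hpd : ∀ a, pd a (fun w => e₂ w k) =ᶠ[𝓝 w] fun w =>
      (-1) * (aMat (σ (e₁ w)) 0 k * pd a (fun w => e₁ w 0) w
        + aMat (σ (e₁ w)) 1 k * pd a (fun w => e₁ w 1) w) := fun a => by
    filter_upwards [hW.mem_nhds hw] with w' hw'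
    have := congrFun (hrel w' hw' (Pi.single a 1)) k
    rw [← pd_apply (s₂ w' hw').diff, ← pd_apply (s₁ w' hw').diff, ← pd_apply (s₁ w' hw').diff]
    simp only [Pi.neg_apply, Matrix.mulVec, dotProduct, Matrix.transpose_apply,
      Fin.sum_univ_two] at this
    rw [neg_one_mul]
    exact this
  have hpd2 : ∀ a b, pd b (pd a (fun w => e₂ w k)) w = (-1) *
      ((pd b (fun w => aMat (σ (e₁ w)) 0 k) w * pd a (fun w => e₁ w 0) w
        + aMat (σ (e₁ w)) 0 k * pd b (pd a (fun w => e₁ w 0)) w)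
      + (pd b (fun w => aMat (σ (e₁ w)) 1 k) w * pd a (fun w => e₁ w 1) w
        + aMat (σ (e₁ w)) 1 k * pd b (pd a (fun w => e₁ w 1)) w)) := fun a b => by
    have m0 := (a₁ 0).mul ((c₁ 0).pd a)
    have m1 := (a₁ 1).mul ((c₁ 1).pd a)
    rw [(pd_congr (hpd a) b).eq_of_nhds, (pd_mul contDiffAt_const (m0.add m1) b).eq_of_nhds,
      (pd_add m0 m1 b).eq_of_nhds, (pd_mul (a₁ 0) ((c₁ 0).pd a) b).eq_of_nhds,
      (pd_mul (a₁ 1) ((c₁ 1).pd a) b).eq_of_nhds]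
    have : pd b (fun _ : Plane => (-1 : ℝ)) w = 0 := by simp [pd]
    rw [this]
    ring
  have hcomp : ∀ b i, pd b (fun w => aMat (σ (e₁ w)) i k) w
      = pd b (fun w => e₁ w 0) w * pd 0 (fun s => aMat (σ s) i k) t
        + pd b (fun w => e₁ w 1) w * pd 1 (fun s => aMat (σ s) i k) t := fun b i => by
    rw [(pd_comp (f := fun s => aMat (σ s) i k) (sA' i) (s₁ w hw) b).eq_of_nhds,
      Fin.sum_univ_two, ht₁, pd_apply (s₁ w hw).diff, pd_apply (s₁ w hw).diff]
    rfl
  -- By `hrel` a direction killed by `de₁` is killed by `de₂` too, so the projection to the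
  -- `t`-plane inherits injectivity from `e`.
  have hdet : (jac e₁ w).det ≠ 0 := by
    intro h0
    obtain ⟨u, hu, hu'⟩ := Matrix.exists_mulVec_eq_zero_iff.2 h0
    rw [jac_mulVec] at hu'
    refine hu ((he w hw).2.1 ?_)
    rw [hd w hw, hrel w hw, hu', Matrix.mulVec_zero, neg_zero, map_zero]
    rfl
  have h1 := hpd2 0 1
  have h2 := hpd2 1 0
  rw [(pd_comm c₂ 1 0).eq_of_nhds, h2, (pd_comm (c₁ 0) 1 0).eq_of_nhds,
    (pd_comm (c₁ 1) 1 0).eq_of_nhds, hcomp, hcomp, hcomp, hcomp] at h1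
  rw [Matrix.det_fin_two] at hdet
  simp only [jac, Matrix.of_apply, pd_apply (s₁ w hw).diff] at hdet
  -- Equality of the mixed second derivatives of `e₂` says that the Jacobian of `e₁` times the
  -- curvature vanishes.
  refine sub_eq_zero.1 ((mul_eq_zero.1 (?_ : _ * _ = (0 : ℝ))).resolve_left hdet)
  linear_combination -h1

/-- If the connection is exact, `Ξ^⊥` is integrable. -/
lemma orthIntegrableOn_of_exact {σ : Plane → Coeff} {Ω : Set Plane} (hΩ : IsOpen Ω)
    (hσ : IsMetricOn σ Ω) {χ : Plane → Plane} (hχ : ContDiffOn ℝ ∞ χ Ω)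
    (h : ∀ t ∈ Ω, aMat (σ t) = (jac χ t)ᵀ) : OrthIntegrableOn σ Ω := by
  intro y hy
  have hd : ∀ w ∈ Ω, HasFDerivAt (fun w => ((w, y.2 + χ y.1 - χ w) : Space))
      ((ContinuousLinearMap.id ℝ Plane).prod (-(fderiv ℝ χ w))) w := fun w hw =>
    (hasFDerivAt_id w).prodMk
      ((hχ.contDiffAt (hΩ.mem_nhds hw)).diff.hasFDerivAt.const_sub _)
  -- The integral manifolds are the graphs `z = const - χ(t)`.
  refine ⟨Ω, fun w => (w, y.2 + χ y.1 - χ w), hΩ, contDiffOn_id.prodMk (contDiffOn_const.sub hχ),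
    ⟨y.1, hy, by simp⟩, fun w hw => ⟨hw, ?_, ?_⟩⟩
  · rw [(hd w hw).fderiv]
    exact fun u v huv => congrArg Prod.fst huv
  · rw [(hd w hw).fderiv]
    ext v
    rw [mem_orthLeaf_iff (hσ.2 w hw).2, h w hw, Matrix.transpose_transpose, jac_mulVec]
    constructor
    · rintro ⟨u, rfl⟩
      rfl
    · intro hv
      exact ⟨v.1, Prod.ext rfl hv.symm⟩

/-- A closed connection is locally exact. -/
lemma exists_potential {A : Plane → M2} {Ω : Set Plane} (hΩ : IsOpen Ω)
    (hA : ∀ i j, ContDiffOn ℝ ∞ (fun s => A s i j) Ω)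
    (hc : ∀ t ∈ Ω, ∀ k, pd 0 (fun s => A s 1 k) t = pd 1 (fun s => A s 0 k) t) {t : Plane}
    (ht : t ∈ Ω) : ∃ χ : Plane → Plane, ContDiffAt ℝ ∞ χ t ∧ ∀ᶠ s in 𝓝 t, (jac χ s)ᵀ = A s := by
  obtain ⟨r, hr, hball⟩ := Metric.isOpen_iff.1 hΩ t ht
  let E : Fin 2 → Fin 2 → Plane →L[ℝ] Plane := fun i k =>
    (ContinuousLinearMap.proj (R := ℝ) (φ := fun _ : Fin 2 => ℝ) i).smulRight (Pi.single k 1)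
  -- The `ℝ²`-valued one-form `Aᵢₖ dtⁱ`, to which the Poincaré lemma on a ball is applied;
  -- closedness is symmetry of its derivative.
  let α : Plane → Plane →L[ℝ] Plane := fun s => ∑ i, ∑ k, A s i k • E i k
  have sα : ContDiffOn ℝ ∞ α (Metric.ball t r) :=
    ContDiffOn.sum fun i _ => ContDiffOn.sum fun k _ =>
      ((hA i k).mono hball).smul contDiffOn_const
  have hsym : ∀ a ∈ Metric.ball t r, ∀ x y, fderiv ℝ α a x y = fderiv ℝ α a y x := by
    intro a ha x y
    have dA : ∀ i k, HasFDerivAt (fun s => A s i k) (fderiv ℝ (fun s => A s i k) a) a := fun i k =>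
      ((hA i k).contDiffAt (hΩ.mem_nhds (hball ha))).diff.hasFDerivAt
    have h1 : HasFDerivAt α (∑ i, ∑ k, (fderiv ℝ (fun s => A s i k) a).smulRight (E i k)) a :=
      HasFDerivAt.fun_sum fun i _ => HasFDerivAt.fun_sum fun k _ => (dA i k).smul_const (E i k)
    rw [h1.fderiv]
    have h2 : ∀ x i k, fderiv ℝ (fun s => A s i k) a x
        = x 0 * pd 0 (fun s => A s i k) a + x 1 * pd 1 (fun s => A s i k) a := fun x i k => by
      rw [fderiv_eq_sum_pd, Fin.sum_univ_two]
      rfl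
    ext k
    have h3 := hc a (hball ha) 0
    have h4 := hc a (hball ha) 1
    fin_cases k <;> simp [E, Fin.sum_univ_two, h2, h3, h4] <;> ring
  obtain ⟨χ, hχ⟩ := (convex_ball t r).exists_forall_hasFDerivAt_of_fderiv_symmetric
    Metric.isOpen_ball (sα.differentiableOn (by simp)) hsym
  have hmem := Metric.isOpen_ball.mem_nhds (Metric.mem_ball_self (x := t) hr)
  refine ⟨χ, ?_, ?_⟩
  · have : ContDiffOn ℝ ∞ χ (Metric.ball t r) := by
      rw [contDiffOn_infty_iff_fderiv_of_isOpen Metric.isOpen_ball]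
      exact ⟨fun a ha => (hχ a ha).differentiableAt.differentiableWithinAt,
        sα.congr fun a ha => (hχ a ha).fderiv⟩
    exact this.contDiffAt hmem
  · filter_upwards [hmem] with s hs
    ext i k
    simp only [jac, pd, (hχ s hs).fderiv, Matrix.transpose_apply, Matrix.of_apply]
    fin_cases i <;> fin_cases k <;> simp [α, E, Fin.sum_univ_two]

/-! ### Non-integrability imposes no condition on jets of finite order. -/

section Intransitive

variable {m : ℕ}

lemma nondeg_of_isMetricOn {σ : Plane → Coeff} {Ω : Set Plane} (h : IsMetricOn σ Ω) {x : Space}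
    (hx : x.1 ∈ Ω) : Nondeg (coef (jet m σ x) 0 0) := by
  rw [coef_jet_zero]
  exact h.2 _ hx

/-- Every jet of a metric is the jet of an orthogonally intransitive one. -/
lemma intransitiveJets_eq : intransitiveJets m = {θ | Nondeg (coef θ 0 0)} := by
  ext θ
  constructor
  · rintro ⟨x, Ω, σ, -, hx, hσ, -, rfl⟩
    exact nondeg_of_isMetricOn hσ hx
  intro hθ
  change Nondeg _ at hθ
  rw [← jet_rep θ, coef_jet_zero] at hθ
  set x : Plane := θ.1.1 with hx
  -- If `θ` were not the jet of an intransitive metric, the curvature of every global smooth metric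
  -- with this jet would vanish near `x`; one of its two components suffices for a contradiction.
  have key : ∀ σ : Plane → Coeff, ContDiff ℝ ∞ σ → Nondeg (σ x) → jet m σ θ.1 = θ →
      θ ∉ intransitiveJets m → ∀ᶠ t in 𝓝 x,
        pd 0 (fun s => aMat (σ s) 1 0) t = pd 1 (fun s => aMat (σ s) 0 0) t := by
    intro σ sσ hn hj hcon
    have hΩ : IsOpen {t | Nondeg (σ t)} := isOpen_nondeg.preimage sσ.continuous
    by_contra hne
    refine hcon ⟨θ.1, {t | Nondeg (σ t)}, σ, hΩ, hn, ⟨sσ.contDiffOn, fun t ht => ht⟩, ?_, hj.symm⟩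
    intro Ω' hsub hΩ' hx' hI
    refine hne ?_
    filter_upwards [hΩ'.mem_nhds hx'] with t ht
    exact closed_of_orthIntegrableOn hΩ' ⟨sσ.contDiffOn, fun t ht => hsub ht⟩ hI ht 0
  by_contra hcon
  -- a second metric with the same jet, whose connection has another curvature
  let g : Plane → ℝ := fun t => monom (m + 1) 0 (t - x) • (1 : ℝ)
  have sg : ContDiff ℝ ∞ g :=
    ((contDiff_monom _ _).comp (contDiff_id.sub contDiff_const)).smul contDiff_const
  have fg : Flat m g x := by
    refine (flat_iff sg.contDiffAt).2 fun p q hpq => ?_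
    rw [pd_iterate_monom, if_neg]
    rintro ⟨⟩
    omega
  let D : Plane → M2 := fun t => Matrix.of ![0, ![g t, 0]]
  have fD : MFlat m D x := fun i j => by
    have hz := Flat.zero (E := ℝ) (m := m) (t := x)
    fin_cases i <;> fin_cases j
    exacts [hz, hz, fg, hz]
  have sD : ∀ t, MSm D t := fun t i j => by
    fin_cases i <;> fin_cases j
    exacts [contDiffAt_const, contDiffAt_const, sg.contDiffAt, contDiffAt_const]
  let τ : Plane → Coeff := fun t => rep θ t + coeffOf 0 (D t * hMat (rep θ t)) 0
  have hb0 : ∀ F : M2, bMat (coeffOf 0 F 0) = 0 := fun F => bMat_coeffOf (by simp)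
  have hh0 : ∀ F : M2, hMat (coeffOf 0 F 0) = 0 := fun F => hMat_coeffOf (by simp)
  have τh : ∀ t, hMat (τ t) = hMat (rep θ t) := fun t => by
    have : hMat (τ t) = hMat (rep θ t) + hMat (coeffOf 0 (D t * hMat (rep θ t)) 0) := rfl
    rw [this, hh0, add_zero]
  have τf : ∀ t, fMat (τ t) = fMat (rep θ t) + D t * hMat (rep θ t) := fun t => rfl
  have sr := fun t => contDiffAt_coeff.1 ((smooth_rep θ).contDiffAt (x := t))
  have sτ : ContDiff ℝ ∞ τ := contDiff_iff_contDiffAt.2 fun t =>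
    (smooth_rep θ).contDiffAt.add (contDiffAt_coeffOf (MSm.const _) ((sD t).mul (sr t).2.2)
      (MSm.const _))
  have fτ : Flat m (fun t => τ t - rep θ t) x := by
    have hz : MFlat m (fun _ => (0 : M2)) x := fun i j => Flat.zero
    refine flat_coeff_iff.2 ⟨?_, ?_, ?_⟩ <;> simp only [τ, add_sub_cancel_left, hb0, hh0]
    exacts [hz, fD.mul_right (sr x).2.2, hz]
  have jτ : jet m τ θ.1 = θ :=
    ((jet_eq_iff sτ.contDiffAt (smooth_rep θ).contDiffAt).2 fτ).trans (jet_rep θ)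
  have nτ : Nondeg (τ x) := by
    rw [sub_eq_zero.1 fτ.eq_zero]
    exact hθ
  have k1 := key _ (smooth_rep θ) hθ (jet_rep θ) hcon
  have k2 := key τ sτ nτ jτ hcon
  have hev : ∀ᶠ t in 𝓝 x, (hMat (rep θ t)).det ≠ 0 :=
    (sr x).2.2.det.continuousAt.eventually_ne hθ.2
  have hA : ∀ᶠ t in 𝓝 x, aMat (τ t) = aMat (rep θ t) + D t := by
    filter_upwards [hev] with t ht
    rw [aMat, τf, τh, Matrix.add_mul,
      Matrix.mul_nonsing_inv_cancel_right _ _ (isUnit_iff_ne_zero.2 ht)]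
    rfl
  have sA : MSm (fun s => aMat (rep θ s)) x := MSm.aMat (smooth_rep θ).contDiffAt hθ.2
  have e1 : pd 0 (fun s => aMat (τ s) 1 0) =ᶠ[𝓝 x]
      fun t => pd 0 (fun s => aMat (rep θ s) 1 0) t + pd 0 g t :=
    (pd_congr (hA.mono fun t ht => by rw [ht]; rfl) 0).trans (pd_add (sA 1 0) sg.contDiffAt 0)
  have e2 : pd 1 (fun s => aMat (τ s) 0 0) =ᶠ[𝓝 x] pd 1 (fun s => aMat (rep θ s) 0 0) :=
    pd_congr (hA.mono fun t ht => by rw [ht]; exact add_zero _) 1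
  have e3 : pd 0 g =ᶠ[𝓝 x] fun _ => 0 := by
    filter_upwards [k1, k2, e1, e2] with t h1 h2 h3 h4
    rw [h3, h4, h1] at h2
    linarith
  -- `m` further derivatives of `∂₀g = 0` contradict `∂₀^(m+1) g = 1` at `x`.
  have e4 := (pd_iter_congr e3 0 m).eq_of_nhds
  rw [pd_iterate_zero, ← Function.iterate_succ_apply] at e4
  have e5 := pd_iterate_monom (m + 1) 0 (m + 1) 0 x (1 : ℝ)
  rw [if_pos rfl] at e5
  exact one_ne_zero (e5.symm.trans e4)

end Intransitive

/-! ### Parametrization of the jets of orthogonally transitive metrics. -/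

/-- The symmetric matrix with the given entries. -/
def symMat (s : Sym2 (Fin 2) → ℝ) : M2 := Matrix.of fun i j => s s(i, j)

/-- The entries of the symmetrization of a matrix. -/
def symPart (B : M2) : Sym2 (Fin 2) → ℝ := (coeffOf B 0 0).1

lemma symMat_transpose (s : Sym2 (Fin 2) → ℝ) : (symMat s)ᵀ = symMat s := by
  ext i j
  simp [symMat, Sym2.eq_swap]

lemma symMat_symPart {B : M2} (hB : Bᵀ = B) : symMat (symPart B) = B := bMat_coeffOf hB

lemma hMat_eq_symMat (c : Coeff) : hMat c = symMat c.2.2 := rfl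

section SymMat

variable {X : Type*} [NormedAddCommGroup X] [NormedSpace ℝ X] {x : X}

lemma MSm.symMat {s : X → Sym2 (Fin 2) → ℝ} (hs : ContDiffAt ℝ ∞ s x) :
    MSm (fun y => symMat (s y)) x := fun i j => contDiffAt_pi.1 hs s(i, j)

lemma contDiffAt_symPart {B : X → M2} (hB : MSm B x) :
    ContDiffAt ℝ ∞ (fun y => symPart (B y)) x :=
  contDiffAt_fst.comp x (contDiffAt_coeffOf hB (MSm.const 0) (MSm.const 0))

end SymMat

lemma Flat.symMat {m : ℕ} {t : Plane} {s : Plane → Sym2 (Fin 2) → ℝ} (hs : Flat m s t) :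
    MFlat m (fun y => symMat (s y)) t := fun i j => hs.apply s(i, j)

lemma flat_of_symMat {m : ℕ} {t : Plane} {s : Plane → Sym2 (Fin 2) → ℝ}
    (hs : MFlat m (fun y => symMat (s y)) t) : Flat m s t := Flat.pi fun a => by
  induction a using Sym2.ind with
  | _ i j => exact hs i j

/-- Parameters for the jets of orthogonally transitive metrics: a point, the jets of the quotient
metric and of the metric of the leaves, and the jet of a potential of the connection. -/
abbrev TransParam (m : ℕ) : Type :=
  Space × (MultiIndex m → Sym2 (Fin 2) → ℝ) × (MultiIndex m → Sym2 (Fin 2) → ℝ) ×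
    (PosIndex m → Plane)

section TransMap

variable {m : ℕ}

def TransParam.quot (p : TransParam m) : Plane → Sym2 (Fin 2) → ℝ := taylor ord p.1.1 p.2.1

def TransParam.leaf (p : TransParam m) : Plane → Sym2 (Fin 2) → ℝ := taylor ord p.1.1 p.2.2.1

def TransParam.pot (p : TransParam m) : Plane → Plane := taylor posOrd p.1.1 p.2.2.2

lemma TransParam.smooth_quot (p : TransParam m) : ContDiff ℝ ∞ p.quot := smooth_taylor _ _ _

lemma TransParam.smooth_leaf (p : TransParam m) : ContDiff ℝ ∞ p.leaf := smooth_taylor _ _ _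

lemma TransParam.smooth_pot (p : TransParam m) : ContDiff ℝ ∞ p.pot := smooth_taylor _ _ _

/-- The potential is needed to order `m + 1`, since the connection is its first derivative, and its
constant term is irrelevant; hence `PosIndex`. -/
def transFamily (q : TransParam m × Plane) : Coeff :=
  ofReduced (symMat (q.1.quot q.2)) (jac q.1.pot q.2)ᵀ (symMat (q.1.leaf q.2))

lemma contDiff_quot : ContDiff ℝ ∞ fun q : TransParam m × Plane => q.1.quot q.2 :=
  contDiff_taylor _ (contDiff_fst.comp (contDiff_fst.comp contDiff_fst)) contDiff_snd
    (contDiff_fst.comp (contDiff_snd.comp contDiff_fst))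

lemma contDiff_leaf : ContDiff ℝ ∞ fun q : TransParam m × Plane => q.1.leaf q.2 :=
  contDiff_taylor _ (contDiff_fst.comp (contDiff_fst.comp contDiff_fst)) contDiff_snd
    (contDiff_fst.comp (contDiff_snd.comp (contDiff_snd.comp contDiff_fst)))

lemma contDiff_pot : ContDiff ℝ ∞ fun q : TransParam m × Plane => q.1.pot q.2 :=
  contDiff_taylor _ (contDiff_fst.comp (contDiff_fst.comp contDiff_fst)) contDiff_snd
    (contDiff_snd.comp (contDiff_snd.comp (contDiff_snd.comp contDiff_fst)))

lemma contDiff_transFamily : ContDiff ℝ ∞ (transFamily (m := m)) := by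
  rw [contDiff_iff_contDiffAt]
  exact fun q => contDiffAt_ofReduced (MSm.symMat contDiff_quot.contDiffAt)
    (MSm.jac_family contDiff_pot q).transpose (MSm.symMat contDiff_leaf.contDiffAt)

/-- The jets of metrics with an exact connection. -/
def transMap : TransParam m → JetSpace m :=
  jetMap m transFamily (ContinuousLinearMap.fst ℝ Space _)

def transDomain (m : ℕ) : Set (TransParam m) :=
  {p | (symMat (p.quot p.1.1)).det ≠ 0 ∧ (symMat (p.leaf p.1.1)).det ≠ 0}

lemma continuous_symMat : Continuous symMat :=
  continuous_matrix fun i j => continuous_apply s(i, j)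

lemma isOpen_transDomain : IsOpen (transDomain m) := by
  have h : Continuous fun p : TransParam m => (p, p.1.1) :=
    continuous_id.prodMk (continuous_fst.comp continuous_fst)
  have h1 := continuous_symMat.comp (contDiff_quot.continuous.comp h)
  have h2 := continuous_symMat.comp (contDiff_leaf.continuous.comp h)
  exact (isOpen_ne.preimage h1.matrix_det).inter (isOpen_ne.preimage h2.matrix_det)

lemma mDeriv_ofReduced {B A H B' A' H' : M2} (hB : Bᵀ = B) (hB' : B'ᵀ = B') (hH : Hᵀ = H)
    (hH' : H'ᵀ = H') :
    MDeriv (fun s => bMat (ofReduced (B + s • B') (A + s • A') (H + s • H')))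
      (B' + ((A' * H + A * H') * Aᵀ + A * H * A'ᵀ)) ∧
    MDeriv (fun s => fMat (ofReduced (B + s • B') (A + s • A') (H + s • H')))
      (A' * H + A * H') ∧
    MDeriv (fun s => hMat (ofReduced (B + s • B') (A + s • A') (H + s • H'))) H' := by
  have e1 : ∀ s : ℝ, (B + s • B')ᵀ = B + s • B' := fun s => by simp [hB, hB']
  have e2 : ∀ s : ℝ, (H + s • H')ᵀ = H + s • H' := fun s => by simp [hH, hH']
  have dB := MDeriv.affine B B'
  have dA := MDeriv.affine A A'
  have dH := MDeriv.affine H H'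
  refine ⟨?_, ?_, ?_⟩
  · simp only [bMat_ofReduced (e1 _) (e2 _)]
    convert dB.add ((dA.mul dH).mul dA.transpose) using 1
    simp only [zero_smul, add_zero]
  · simp only [fMat_ofReduced]
    convert dA.mul dH using 1
    simp only [zero_smul, add_zero]
  · simpa only [hMat_ofReduced (e2 _)] using dH

/-- The linearized system is triangular: `h` gives the leaf variation, then `f` that of the
connection, then `b` that of the quotient metric. -/
lemma transMap_immersion {p : TransParam m} (hp : p ∈ transDomain m) {v : TransParam m}
    (h : fderiv ℝ (transMap (m := m)) p v = 0) : v = 0 := by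
  obtain ⟨hv, hfl⟩ := jetMap_kernel contDiff_transFamily _ h
  replace hv : v.1 = 0 := hv
  set t := p.1.1
  let q' : Plane → Sym2 (Fin 2) → ℝ := taylor ord t v.2.1
  let l' : Plane → Sym2 (Fin 2) → ℝ := taylor ord t v.2.2.1
  let χ' : Plane → Plane := taylor posOrd t v.2.2.2
  have sχ' : ContDiff ℝ ∞ χ' := smooth_taylor _ _ _
  obtain ⟨hb, hf, hh⟩ := flat_coeff_iff.1 hfl
  have e1 : ∀ s : ℝ, (p + s • v).quot = fun t => p.quot t + s • q' t := fun s => by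
    funext u
    simp only [TransParam.quot, Prod.fst_add, Prod.snd_add, Prod.smul_fst, Prod.smul_snd, hv,
      smul_zero, add_zero, taylor_add_smul, q', t]
  have e2 : ∀ s : ℝ, (p + s • v).leaf = fun t => p.leaf t + s • l' t := fun s => by
    funext u
    simp only [TransParam.leaf, Prod.fst_add, Prod.snd_add, Prod.smul_fst, Prod.smul_snd, hv,
      smul_zero, add_zero, taylor_add_smul, l', t]
  have e3 : ∀ s : ℝ, (p + s • v).pot = fun t => p.pot t + s • χ' t := fun s => by
    funext u
    simp only [TransParam.pot, Prod.fst_add, Prod.snd_add, Prod.smul_fst, Prod.smul_snd, hv,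
      smul_zero, add_zero, taylor_add_smul, χ', t]
  have key : ∀ u, let g := fderiv ℝ (transFamily (m := m)) (p, u) (v, 0)
      let B := symMat (p.quot u)
      let H := symMat (p.leaf u)
      let A := (jac p.pot u)ᵀ
      let A' := (jac χ' u)ᵀ
      bMat g = symMat (q' u) + ((A' * H + A * symMat (l' u)) * Aᵀ + A * H * A'ᵀ) ∧
      fMat g = A' * H + A * symMat (l' u) ∧ hMat g = symMat (l' u) := by
    intro u g B H A A'
    have h1 := hasDerivAt_line ((contDiff_transFamily.differentiable (by simp)) (p, u)) (v, 0)
    have h2 : (fun s : ℝ => transFamily ((p, u) + s • (v, 0))) = fun s =>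
        ofReduced (B + s • symMat (q' u)) (A + s • A') (H + s • symMat (l' u)) := by
      funext s
      simp only [transFamily, Prod.fst_add, Prod.snd_add, Prod.smul_fst, Prod.smul_snd, smul_zero,
        add_zero, e1, e2, e3]
      rw [jac_add_smul (p.smooth_pot.differentiable (by simp) u) (sχ'.differentiable (by simp) u),
        Matrix.transpose_add, Matrix.transpose_smul]
      rfl
    rw [h2] at h1
    obtain ⟨db, df, dh⟩ := mDeriv_ofReduced (A := A) (A' := A') (symMat_transpose (p.quot u))
      (symMat_transpose (q' u)) (symMat_transpose (p.leaf u)) (symMat_transpose (l' u))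
    refine ⟨?_, ?_, ?_⟩ <;> ext i j
    exacts [((entry 0 i j).hasFDerivAt.comp_hasDerivAt 0 h1).unique (db i j),
      ((entry 1 i j).hasFDerivAt.comp_hasDerivAt 0 h1).unique (df i j),
      ((entry 2 i j).hasFDerivAt.comp_hasDerivAt 0 h1).unique (dh i j)]
  have sA : MSm (fun s => (jac p.pot s)ᵀ) t := (MSm.jac p.smooth_pot.contDiffAt).transpose
  have sH : MSm (fun s => symMat (p.leaf s)) t := MSm.symMat p.smooth_leaf.contDiffAt
  have r1 : MFlat m (fun s => symMat (l' s)) t :=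
    hh.congr (Eventually.of_forall fun s => (key s).2.2)
  have r2 : MFlat m (fun s => (jac χ' s)ᵀ) t := by
    refine ((hf.sub (MFlat.mul_left sA r1)).mul_right (sH.inv hp.2)).congr ?_
    filter_upwards [sH.det.continuousAt.eventually_ne hp.2] with s hs
    rw [(key s).2.1, add_sub_cancel_right,
      Matrix.mul_nonsing_inv_cancel_right _ _ (isUnit_iff_ne_zero.2 hs)]
  have r3 : MFlat m (fun s => symMat (q' s)) t := by
    refine (hb.sub ((((r2.mul_right sH).add (MFlat.mul_left sA r1)).mul_right
      sA.transpose).add (MFlat.mul_left (sA.mul sH) r2.transpose))).congr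
      (Eventually.of_forall fun s => ?_)
    exact sub_eq_of_eq_add (key s).1
  have r4 : Flat (m + 1) χ' t := ⟨sχ'.contDiffAt, taylor_posOrd_self _ _, fun i =>
    Flat.pi fun j => r2 i j⟩
  exact Prod.ext hv (Prod.ext (taylor_ord_eq_zero (flat_of_symMat r3))
    (Prod.ext (taylor_ord_eq_zero (flat_of_symMat r1)) (taylor_posOrd_eq_zero r4)))

lemma mem_transitiveJets {B H : Plane → M2} {χ : Plane → Plane} (sB : ∀ t, MSm B t)
    (sH : ∀ t, MSm H t) (sχ : ContDiff ℝ ∞ χ) (hB : ∀ t, (B t)ᵀ = B t) (hH : ∀ t, (H t)ᵀ = H t)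
    {x : Space} (dB : (B x.1).det ≠ 0) (dH : (H x.1).det ≠ 0) :
    jet m (fun t => ofReduced (B t) (jac χ t)ᵀ (H t)) x ∈ transitiveJets m := by
  have cB : Continuous B := continuous_matrix fun i j =>
    (contDiff_iff_contDiffAt.2 fun t => sB t i j : ContDiff ℝ ∞ fun t => B t i j).continuous
  have cH : Continuous H := continuous_matrix fun i j =>
    (contDiff_iff_contDiffAt.2 fun t => sH t i j : ContDiff ℝ ∞ fun t => H t i j).continuous
  have hΩ : IsOpen {t | (B t).det ≠ 0 ∧ (H t).det ≠ 0} :=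
    (isOpen_ne.preimage cB.matrix_det).inter (isOpen_ne.preimage cH.matrix_det)
  have hσ : IsMetricOn (fun t => ofReduced (B t) (jac χ t)ᵀ (H t))
      {t | (B t).det ≠ 0 ∧ (H t).det ≠ 0} :=
    ⟨fun t _ => (contDiffAt_ofReduced (sB t) (MSm.jac sχ.contDiffAt).transpose
      (sH t)).contDiffWithinAt, fun t ht => nondeg_ofReduced (hB t) (hH t) ht.1 ht.2⟩
  exact ⟨x, _, _, hΩ, ⟨dB, dH⟩, hσ, orthIntegrableOn_of_exact hΩ hσ sχ.contDiffOn fun t ht =>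
    aMat_ofReduced (hH t) ht.2, rfl⟩

/-- An integrable `Ξ^⊥` gives a local potential. Truncating the reduced data, with the potential in
place of the connection, to Taylor polynomials keeps the `m`-jet and leaves the connection exact,
hence `Ξ^⊥` integrable. -/
lemma transitiveJets_eq : transitiveJets m = transMap '' transDomain m := by
  ext θ
  constructor
  · rintro ⟨x, Ω, σ, hΩ, hx, hσ, hI, rfl⟩
    have sσ : ∀ t ∈ Ω, ContDiffAt ℝ ∞ σ t := fun t ht => hσ.1.contDiffAt (hΩ.mem_nhds ht)
    have hdet : ∀ t ∈ Ω, (hMat (σ t)).det ≠ 0 := fun t ht => (hσ.2 t ht).2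
    obtain ⟨χ, sχ, hχ⟩ := exists_potential hΩ
      (fun i j t ht => (MSm.aMat (sσ t ht) (hdet t ht) i j).contDiffWithinAt)
      (fun t ht k => closed_of_orthIntegrableOn hΩ hσ hI ht k) hx
    have sq : ContDiffAt ℝ ∞ (fun t => symPart (qMat (σ t))) x.1 :=
      contDiffAt_symPart (MSm.qMat (sσ _ hx) (hdet _ hx))
    have sl : ContDiffAt ℝ ∞ (fun t => (σ t).2.2) x.1 :=
      contDiffAt_snd.comp _ (contDiffAt_snd.comp _ (sσ _ hx))
    let p : TransParam m := (x,
      fun I => (pd 0)^[(ord I).1] ((pd 1)^[(ord I).2] (fun t => symPart (qMat (σ t)))) x.1,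
      fun I => (pd 0)^[(ord I).1] ((pd 1)^[(ord I).2] (fun t => (σ t).2.2)) x.1,
      fun I => (pd 0)^[(posOrd I).1] ((pd 1)^[(posOrd I).2] χ) x.1)
    have fq : Flat m (fun s => symPart (qMat (σ s)) - p.quot s) x.1 := flat_sub_taylor sq
    have fl : Flat m (fun s => (σ s).2.2 - p.leaf s) x.1 := flat_sub_taylor sl
    have fχ : Flat (m + 1) (fun s => χ s - (χ x.1 + p.pot s)) x.1 := flat_sub_taylor_pos sχ
    have jχ := flat_jac_sub sχ (contDiff_const.add p.smooth_pot).contDiffAt fχ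
    simp only [jac_const_add] at jχ
    have hq : symMat (p.quot x.1) = qMat (σ x.1) := by
      rw [← sub_eq_zero.1 fq.eq_zero, symMat_symPart (qMat_transpose _)]
    have hl : symMat (p.leaf x.1) = hMat (σ x.1) := by
      rw [← sub_eq_zero.1 fl.eq_zero, hMat_eq_symMat]
    refine ⟨p, ⟨?_, ?_⟩, ?_⟩
    · change (symMat (p.quot x.1)).det ≠ 0
      rw [hq]
      exact ((nondeg_iff _).1 (hσ.2 _ hx)).1
    · change (symMat (p.leaf x.1)).det ≠ 0
      rw [hl]
      exact hdet _ hx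
    · refine ((jet_eq_iff (x := x) (sσ _ hx) ?_).2 ?_).symm
      · exact (contDiff_transFamily.comp (contDiff_const.prodMk contDiff_id)).contDiffAt
      · have h1 : Flat m (fun s => ofReduced (symMat (symPart (qMat (σ s)))) (jac χ s)ᵀ
            (symMat (σ s).2.2) - transFamily (p, s)) x.1 :=
          flat_ofReduced_sub fq.symMat jχ.transpose fl.symMat (MSm.jac sχ).transpose
            (MSm.symMat sl) (MSm.jac p.smooth_pot.contDiffAt).transpose
            (MSm.symMat p.smooth_leaf.contDiffAt)
        refine h1.congr ?_
        filter_upwards [hχ, hΩ.mem_nhds hx] with s h2 h3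
        rw [symMat_symPart (qMat_transpose _), h2, ← hMat_eq_symMat, ofReduced_eq (hdet s h3)]
  · rintro ⟨p, hp, rfl⟩
    exact mem_transitiveJets (fun t => MSm.symMat p.smooth_quot.contDiffAt)
      (fun t => MSm.symMat p.smooth_leaf.contDiffAt) p.smooth_pot
      (fun t => symMat_transpose _) (fun t => symMat_transpose _) hp.1 hp.2

end TransMap

/-! ### Order zero: all orbits are open. -/

section OrderZero

lemma exists_taylor_jac {m : ℕ} (c : Plane) (J : M2) :
    ∃ w : PosIndex m → Plane, jac (taylor posOrd c w) c = J := by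
  -- Only the orders `(1, 0)` and `(0, 1)` matter; the values at higher orders are arbitrary.
  let w : PosIndex m → Plane := fun I j => if (I.1.1 : ℕ) = 1 then J j 0 else J j 1
  refine ⟨w, ?_⟩
  ext j i
  fin_cases i
  · have := pd_iterate_taylor_apply posOrd_injective c w
      ⟨(⟨1, by omega⟩, ⟨0, by omega⟩), by simp, by simp⟩
    exact (congrFun this j).trans (by simp [w])
  · have := pd_iterate_taylor_apply posOrd_injective c w
      ⟨(⟨0, by omega⟩, ⟨1, by omega⟩), by simp, by simp⟩
    exact (congrFun this j).trans (by simp [w])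

/-- The differential of `N ↦ Nᵀ b N` at an invertible matrix is onto the symmetric matrices. -/
lemma exists_congruence_variation {b M S : M2} (hb : b.det ≠ 0) (hbs : bᵀ = b) (hM : M.det ≠ 0)
    (hS : Sᵀ = S) : ∃ N : M2, Nᵀ * b * M + Mᵀ * b * N = S := by
  have hu : IsUnit (Mᵀ * b).det := by
    rw [Matrix.det_mul, Matrix.det_transpose]
    exact isUnit_iff_ne_zero.2 (mul_ne_zero hM hb)
  obtain ⟨N, h1⟩ : ∃ N : M2, Mᵀ * b * N = (1 / 2 : ℝ) • S :=
    ⟨(Mᵀ * b)⁻¹ * ((1 / 2 : ℝ) • S), Matrix.mul_nonsing_inv_cancel_left _ _ hu⟩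
  refine ⟨N, ?_⟩
  have h2 := congrArg Matrix.transpose h1
  rw [Matrix.transpose_mul, Matrix.transpose_mul, Matrix.transpose_transpose, hbs,
    Matrix.transpose_smul, hS, ← Matrix.mul_assoc] at h2
  rw [h1, h2, ← add_smul]
  norm_num

/-- `α'` is chosen to match the leaf block, `J'` to match the variation of the quotient metric, and
`K'` solves the mixed block. The remaining block then follows from `linPull_reduced`. -/
lemma exists_linPull {c : Coeff} (hc : Nondeg c) {J K α : M2} (hJ : J.det ≠ 0) (hα : α.det ≠ 0)
    (g : Coeff) : ∃ J' K' α' : M2, linPullB J K J' K' c 0 = bMat g ∧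
      linPullF J K α J' K' α' c 0 = fMat g ∧ linPullH α α' c 0 = hMat g := by
  obtain ⟨hq, hh⟩ := (nondeg_iff c).1 hc
  have hαu := isUnit_iff_ne_zero.2 hα
  have b0 : bMat 0 = 0 := rfl
  have f0 : fMat 0 = 0 := rfl
  have h0 : hMat 0 = 0 := rfl
  set A : M2 := (Jᵀ * aMat c + Kᵀ) * (α⁻¹)ᵀ with hA
  obtain ⟨α', h1⟩ := exists_congruence_variation hh (hMat_transpose c) hα (hMat_transpose g)
  obtain ⟨J', h2⟩ := exists_congruence_variation (S := bMat g - A * (fMat g)ᵀ - fMat g * Aᵀ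
    + A * hMat g * Aᵀ) hq (qMat_transpose c) hJ (by
      simp only [Matrix.transpose_add, Matrix.transpose_sub, Matrix.transpose_mul,
        Matrix.transpose_transpose, bMat_transpose, hMat_transpose, Matrix.mul_assoc]
      abel)
  let Z : M2 := ((fMat g - (Jᵀ * fMat c + Kᵀ * hMat c) * α') * α⁻¹ - J'ᵀ * fMat c) * (hMat c)⁻¹
  have hZ : Z * hMat c = (fMat g - (Jᵀ * fMat c + Kᵀ * hMat c) * α') * α⁻¹ - J'ᵀ * fMat c :=
    Matrix.nonsing_inv_mul_cancel_right _ _ (isUnit_iff_ne_zero.2 hh)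
  have eH : linPullH α α' c 0 = hMat g := by
    rw [linPullH, h0, ← h1]
    simp
  have eF : linPullF J K α J' Zᵀ α' c 0 = fMat g := by
    rw [linPullF, Matrix.transpose_transpose, hZ, f0, h0, Matrix.mul_zero, Matrix.mul_zero,
      add_zero, add_zero, add_sub_cancel, Matrix.nonsing_inv_mul_cancel_right _ _ hαu,
      sub_add_cancel]
  refine ⟨J', Zᵀ, α', ?_, eF, eH⟩
  have h3 := linPull_reduced (g := 0) (K' := Zᵀ) (J' := J') (α' := α') hh
    (Matrix.mul_nonsing_inv _ hαu) hA
  have hQ : linQ c 0 = 0 := by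
    rw [linQ, b0, f0, h0]
    simp
  rw [eF, eH, hQ, Matrix.mul_zero, Matrix.zero_mul, add_zero, h2] at h3
  simpa using h3

instance : Unique (MultiIndex 0) where
  default := ⟨(0, 0), by simp⟩
  uniq I := ord_injective (by
    have := I.2
    exact Prod.ext (by simp only [ord]; omega) (by simp only [ord]; omega))

lemma orbitMap_zero (θ : JetSpace 0) (p : OrbitParam 0) :
    orbitMap θ p = (p.1, fun _ => orbitFamily θ (p, p.1.1)) :=
  Prod.ext rfl (funext fun I => by
    rw [Unique.eq_default I]
    rfl)

/-- The point varies freely, and with the point fixed `exists_linPull` realizes every variation of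
the coefficients. -/
lemma orbitMap_submersion {θ : JetSpace 0} (hn : Nondeg (coef θ 0 0)) {p : OrbitParam 0}
    (hp : p ∈ orbitDomain 0) : Function.Surjective (fderiv ℝ (orbitMap θ) p) := by
  let δ : OrbitParam 0 →L[ℝ] OrbitParam 0 × Plane := (ContinuousLinearMap.id ℝ _).prod
    ((ContinuousLinearMap.fst ℝ Plane Plane).comp (ContinuousLinearMap.fst ℝ Space _))
  have h1 : HasFDerivAt (fun p : OrbitParam 0 => orbitFamily θ (p, p.1.1))
      ((fderiv ℝ (orbitFamily θ) (p, p.1.1)).comp δ) p :=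
    HasFDerivAt.comp (f := δ) p
      (((contDiff_orbitFamily θ).differentiable (by simp)) (p, p.1.1)).hasFDerivAt δ.hasFDerivAt
  have h2 : HasFDerivAt (orbitMap θ) _ p :=
    (((ContinuousLinearMap.fst ℝ Space _).hasFDerivAt.prodMk
      (hasFDerivAt_pi.2 fun _ : MultiIndex 0 => h1)).congr_of_eventuallyEq
      (Eventually.of_forall (orbitMap_zero θ)))
  rw [h2.fderiv]
  have h0 : θ.1.1 + p.phi p.1.1 = θ.1.1 := by
    simp [OrbitParam.phi, taylor_posOrd_self]
  have hn' : Nondeg (rep θ (θ.1.1 + p.phi p.1.1)) := by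
    rw [h0]
    rwa [← jet_rep θ, coef_jet_zero] at hn
  have key : ∀ g : Coeff, ∃ v : OrbitParam 0, v.1 = 0 ∧
      fderiv ℝ (orbitFamily θ) (p, p.1.1) (v, 0) = g := fun g => by
    obtain ⟨J', K', α', e1, e2, e3⟩ :=
      exists_linPull hn' (K := jac p.psi p.1.1) hp.2 hp.1 g
    obtain ⟨w, hw⟩ := exists_taylor_jac (m := 0) p.1.1 J'
    obtain ⟨w', hw'⟩ := exists_taylor_jac (m := 0) p.1.1 K'
    let v : OrbitParam 0 := (0, fun i j => α' i j, w, w')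
    have hv : v.alpha = α' := rfl
    refine ⟨v, rfl, ?_⟩
    obtain ⟨f1, f2, f3⟩ := fderiv_orbitFamily θ (p := p) (v := v) rfl p.1.1
    have hd : fderiv ℝ (rep θ) (θ.1.1 + p.phi p.1.1) (taylor posOrd p.1.1 w p.1.1) = 0 := by
      rw [taylor_posOrd_self, map_zero]
    simp only [v, hd, hw, hw'] at f1 f2 f3
    exact coeff_ext (f1.trans e1) (f2.trans e2) (f3.trans e3)
  rintro ⟨x, w⟩
  -- The subtracted term is the change of the coefficients caused by moving the point along `x`.
  obtain ⟨v, hv, hg⟩ := key (w default -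
    fderiv ℝ (orbitFamily θ) (p, p.1.1) (((x, 0) : OrbitParam 0), x.1))
  refine ⟨(x, 0) + v, Prod.ext ?_ (funext fun I => ?_)⟩
  · change x + v.1 = x
    rw [hv, add_zero]
  · have h3 : fderiv ℝ (orbitFamily θ) (p, p.1.1) ((x, 0) + v, ((x, 0) + v : OrbitParam 0).1.1)
        = w I := by
      have : ((x, 0) + v, ((x, 0) + v : OrbitParam 0).1.1)
          = (((x, 0) : OrbitParam 0), x.1) + (v, 0) := by
        refine Prod.ext rfl ?_
        change (x + v.1).1 = x.1 + 0
        rw [hv, add_zero, add_zero]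
      rw [this, map_add, hg, Unique.eq_default I]
      abel
    exact h3

lemma isOpen_jetOrbit_zero {θ : JetSpace 0} (hn : Nondeg (coef θ 0 0)) :
    IsOpen (jetOrbit 0 θ) := by
  rw [jetOrbit_eq hn, isOpen_iff_mem_nhds]
  rintro _ ⟨p, hp, rfl⟩
  have h1 : ContDiff ℝ ∞ (orbitMap θ) := contDiff_jetMap (contDiff_orbitFamily θ) _
  have h2 := (h1.contDiffAt (x := p)).hasStrictFDerivAt (by simp)
  have h3 := h2.map_nhds_eq_of_surj (LinearMap.range_eq_top.2 (orbitMap_submersion hn hp))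
  rw [← h3]
  exact image_mem_map (isOpen_orbitDomain.mem_nhds hp)

end OrderZero

/-! ### Invariance of nondegeneracy, regularity and transitivity. -/

section Invariance

variable {m : ℕ}

lemma nondeg_orbitMap {θ : JetSpace m} (hn : Nondeg (coef θ 0 0)) {p : OrbitParam m}
    (hp : p ∈ orbitDomain m) : Nondeg (coef (orbitMap θ p) 0 0) := by
  have h0 : θ.1.1 + p.phi p.1.1 = θ.1.1 := by
    simp [OrbitParam.phi, taylor_posOrd_self]
  change Nondeg (coef (jet m (fun t => orbitFamily θ (p, t)) p.1) 0 0)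
  rw [coef_jet_zero]
  refine nondeg_pull ?_ hp.2 hp.1
  simp only [h0]
  rwa [← jet_rep θ, coef_jet_zero] at hn

lemma exists_eq_smul {h k : M2} (hd : h.det ≠ 0)
    (hk : ∀ a b c d, h a b * k c d = h c d * k a b) : ∃ r : ℝ, k = r • h := by
  obtain ⟨a, b, hab⟩ : ∃ a b, h a b ≠ 0 := by
    by_contra! h0
    exact hd (by simp [Matrix.det_fin_two, h0])
  refine ⟨k a b / h a b, ?_⟩
  ext c d
  rw [Matrix.smul_apply, smul_eq_mul, div_mul_eq_mul_div, eq_div_iff hab]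
  linarith [hk a b c d]

/-- The covector `tr(adj h · k i)` is multiplied by `(det α)²` and transformed by `Jᵀ`, and being a
multiple of `h` is preserved by congruence; both steps are reversible. -/
lemma Regular.congruence {h : M2} {k : Fin 2 → M2} (hr : Regular h k) (hd : h.det ≠ 0)
    {J α : M2} (hJ : J.det ≠ 0) (hα : α.det ≠ 0) :
    Regular (αᵀ * h * α) fun i => αᵀ * (∑ j, J j i • k j) * α := by
  have hJJ : J * J⁻¹ = 1 := Matrix.mul_nonsing_inv _ (isUnit_iff_ne_zero.2 hJ)
  have hJs : ∀ j i, J j 0 * J⁻¹ 0 i + J j 1 * J⁻¹ 1 i = if j = i then 1 else 0 := fun j i => by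
    have := congrFun (congrFun hJJ j) i
    rwa [Matrix.mul_apply, Fin.sum_univ_two, Matrix.one_apply] at this
  obtain ⟨⟨i, hi⟩, hm⟩ := hr
  constructor
  · by_contra! h0
    have h1 : ∀ l, ∑ j, J j l * (h.adjugate * k j).trace = 0 := fun l => by
      have e1 : α.det ^ 2 * ∑ j, J j l * (h.adjugate * k j).trace = 0 := by
        rw [← h0 l, Matrix.adjugate_mul_distrib, Matrix.adjugate_mul_distrib,
          ← Matrix.mul_assoc _ (αᵀ * _) α, Matrix.trace_mul_comm]
        have e2 : αᵀ.adjugate * αᵀ = α.det • (1 : M2) := by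
          rw [Matrix.adjugate_mul, Matrix.det_transpose]
        have e3 : α * (α.adjugate * (h.adjugate * αᵀ.adjugate) * (αᵀ * ∑ j, J j l • k j))
            = (α * α.adjugate) * h.adjugate * (αᵀ.adjugate * αᵀ) * ∑ j, J j l • k j := by
          simp only [Matrix.mul_assoc]
        rw [e3, e2, Matrix.mul_adjugate]
        simp only [Matrix.smul_mul, Matrix.mul_smul, one_mul, mul_one, Matrix.trace_smul,
          smul_eq_mul, Fin.sum_univ_two, Matrix.mul_add, Matrix.trace_add]
        ring
      exact (mul_eq_zero.1 e1).resolve_left (pow_ne_zero _ hα)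
    refine hi ?_
    have h2 := h1 0
    have h3 := h1 1
    simp only [Fin.sum_univ_two] at h2 h3
    have e0 := hJs 0 i
    have e1 := hJs 1 i
    have : (h.adjugate * k i).trace = (if (0 : Fin 2) = i then 1 else 0) * (h.adjugate * k 0).trace
        + (if (1 : Fin 2) = i then 1 else 0) * (h.adjugate * k 1).trace := by
      fin_cases i <;> simp
    rw [this, ← e0, ← e1]
    linear_combination J⁻¹ 0 i * h2 + J⁻¹ 1 i * h3
  · by_contra! h0
    obtain ⟨i, a, b, c, d, hm⟩ := hm
    have hd' : (αᵀ * h * α).det ≠ 0 := by simp [hd, hα]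
    have h1 : ∀ l, ∃ r : ℝ, ∑ j, J j l • k j = r • h := fun l => by
      obtain ⟨r, hr⟩ := exists_eq_smul hd' (h0 l)
      refine ⟨r, ?_⟩
      have hu := isUnit_iff_ne_zero.2 hα
      have hut : IsUnit (αᵀ).det := by rwa [Matrix.det_transpose]
      have h2 : αᵀ * (∑ j, J j l • k j) * α = αᵀ * (r • h) * α := by
        rw [hr, Matrix.mul_smul, Matrix.smul_mul]
      have h3 := congrArg (fun M => αᵀ⁻¹ * (M * α⁻¹)) h2
      simpa only [Matrix.mul_nonsing_inv_cancel_right _ _ hu,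
        Matrix.nonsing_inv_mul_cancel_left _ _ hut] using h3
    choose r hr using h1
    have h2 : k i = (r 0 * J⁻¹ 0 i + r 1 * J⁻¹ 1 i) • h := by
      have h3 := hr 0
      have h4 := hr 1
      simp only [Fin.sum_univ_two] at h3 h4
      have : k i = (if (0 : Fin 2) = i then (1 : ℝ) else 0) • k 0
        + (if (1 : Fin 2) = i then (1 : ℝ) else 0) • k 1 := by
        fin_cases i <;> simp
      rw [this, ← hJs 0 i, ← hJs 1 i]
      ext c d
      have h5 := congrFun (congrFun h3 c) d
      have h6 := congrFun (congrFun h4 c) d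
      simp only [Matrix.add_apply, Matrix.smul_apply, smul_eq_mul] at h5 h6 ⊢
      linear_combination J⁻¹ 0 i * h5 + J⁻¹ 1 i * h6
    refine hm ?_
    rw [h2]
    simp only [Matrix.smul_apply, smul_eq_mul]
    ring

lemma hMat_pd {σ : Plane → Coeff} {t : Plane} (sσ : ContDiffAt ℝ ∞ σ t) (i : Fin 2) :
    hMat (pd i σ t) = mpd i (fun s => hMat (σ s)) t := by
  ext a b
  exact (pd_clm (entry 2 a b) sσ i).eq_of_nhds.symm

/-- Because `α` is constant, the derivatives of `αᵀ (h ∘ φ) α` contain no derivative of `α`, so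
`∂ᵢh` transforms tensorially. -/
lemma regularJet_orbitMap (hm : 1 ≤ m) {θ : JetSpace m} (hn : Nondeg (coef θ 0 0))
    (hr : RegularJet θ) {p : OrbitParam m} (hp : p ∈ orbitDomain m) :
    RegularJet (orbitMap θ p) := by
  have h0 : θ.1.1 + p.phi p.1.1 = θ.1.1 := by
    simp [OrbitParam.phi, taylor_posOrd_self]
  have sp : ContDiffAt ℝ ∞ (fun t => θ.1.1 + p.phi t) p.1.1 :=
    (contDiff_const.add p.smooth_phi).contDiffAt
  have sσ : ContDiffAt ℝ ∞ (fun t => orbitFamily θ (p, t)) p.1.1 :=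
    ((contDiff_orbitFamily θ).comp (contDiff_const.prodMk contDiff_id)).contDiffAt
  have sh : MSm (fun s => hMat (rep θ (θ.1.1 + p.phi s))) p.1.1 :=
    (contDiffAt_coeff.1 ((smooth_rep θ).contDiffAt.comp _ sp)).2.2
  rw [← jet_rep θ, regularJet_jet_iff hm] at hr
  rw [← jet_rep θ, coef_jet_zero] at hn
  change RegularJet (jet m (fun t => orbitFamily θ (p, t)) p.1)
  rw [regularJet_jet_iff hm]
  convert hr.congruence hn.2 hp.2 hp.1 using 1
  · simp only [orbitFamily, hMat_pull, h0]
  · funext i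
    rw [hMat_pd sσ]
    simp only [orbitFamily, hMat_pull]
    rw [mpd_mul i ((MSm.const _).mul sh) (MSm.const _), mpd_mul i (MSm.const _) sh, mpd_const,
      mpd_const, mpd_hMat_comp (smooth_rep θ).contDiffAt sp]
    simp only [jac_const_add, h0, Matrix.zero_mul, Matrix.mul_zero, zero_add, add_zero]

end Invariance

section TransitiveInvariance

variable {m : ℕ}

lemma transFamily_smooth (q : TransParam m) : ContDiff ℝ ∞ fun t => transFamily (q, t) :=
  contDiff_transFamily.comp (contDiff_const.prodMk contDiff_id)

lemma transMap_eq (q : TransParam m) : transMap q = jet m (fun t => transFamily (q, t)) q.1 := rfl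

lemma jac_linear_comp {χ φ ψ : Plane → Plane} (sχ : ContDiff ℝ ∞ χ) (sφ : ContDiff ℝ ∞ φ)
    (sψ : ContDiff ℝ ∞ ψ) (β : M2) (t : Plane) :
    jac (fun s => β *ᵥ (χ (φ s) + ψ s)) t = β * (jac χ (φ t) * jac φ t + jac ψ t) := by
  have d1 := (sχ.differentiable (by simp) (φ t)).hasFDerivAt.comp t
    (sφ.differentiable (by simp) t).hasFDerivAt
  have d2 := (sψ.differentiable (by simp) t).hasFDerivAt
  have d3 : HasFDerivAt (fun s => β *ᵥ (χ (φ s) + ψ s)) _ t :=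
    (LinearMap.toContinuousLinearMap (Matrix.mulVecLin β)).hasFDerivAt.comp t (d1.add d2)
  refine Matrix.ext_of_mulVec_single fun i => ?_
  rw [jac_mulVec, d3.fderiv, ← Matrix.mulVec_mulVec, Matrix.add_mulVec, ← Matrix.mulVec_mulVec,
    jac_mulVec, jac_mulVec, jac_mulVec]
  rfl

/-- The polynomial `rep θ` need not be transitive, so it is replaced by a member of `transFamily`
with the same jet; its pullback again has an exact connection. -/
lemma orbitMap_mem_transitiveJets {θ : JetSpace m} (hθ : θ ∈ transitiveJets m)
    {p : OrbitParam m} (hp : p ∈ orbitDomain m) : orbitMap θ p ∈ transitiveJets m := by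
  rw [transitiveJets_eq] at hθ
  obtain ⟨q, hq, rfl⟩ := hθ
  set θ := transMap q with hθ
  have hx : θ.1 = q.1 := rfl
  let φ : Plane → Plane := fun s => q.1.1 + p.phi s
  have sφ : ContDiff ℝ ∞ φ := contDiff_const.add p.smooth_phi
  have hφ : φ p.1.1 = q.1.1 := by simp [φ, OrbitParam.phi, taylor_posOrd_self]
  have jφ : ∀ s, jac φ s = jac p.phi s := fun s => jac_const_add _ _ s
  have hflat : Flat m (fun s => pull (jac p.phi s) (jac p.psi s) p.alpha (transFamily (q, φ s))
      - orbitFamily θ (p, s)) p.1.1 := by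
    have sJ := MSm.jac p.smooth_phi.contDiffAt (t := p.1.1)
    have sK := MSm.jac p.smooth_psi.contDiffAt (t := p.1.1)
    have hz : ∀ A : Plane → M2, MFlat m (fun s => A s - A s) p.1.1 := fun A i j => by
      simpa using Flat.zero (m := m) (t := p.1.1) (E := ℝ)
    have h1 : Flat m (fun s => transFamily (q, s) - rep θ s) (φ p.1.1) := by
      rw [hφ]
      exact flat_sub_rep (transFamily_smooth q).contDiffAt
    have h2 : Flat m (fun s => transFamily (q, φ s) - rep θ (φ s)) p.1.1 :=
      flat_comp_sub (transFamily_smooth q).contDiffAt h1 sφ.contDiffAt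
        (by simpa using Flat.zero (m := m) (t := p.1.1) (E := Plane))
    exact flat_pull_sub (hz _) (hz _) h2 sJ sK sJ sK
      ((transFamily_smooth q).comp sφ).contDiffAt ((smooth_rep θ).comp sφ).contDiffAt
  have hjet := (jet_eq_iff (m := m) (x := p.1) (contDiffAt_pull
    (MSm.jac p.smooth_phi.contDiffAt) (MSm.jac p.smooth_psi.contDiffAt) (MSm.const _)
    ((transFamily_smooth q).comp sφ).contDiffAt) ((contDiff_orbitFamily θ).comp
    (contDiff_const.prodMk contDiff_id)).contDiffAt).2 hflat
  change jet m (fun s => orbitFamily θ (p, s)) p.1 ∈ transitiveJets m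
  refine Set.mem_of_eq_of_mem hjet.symm ?_
  let B : Plane → M2 := fun s => (jac p.phi s)ᵀ * symMat (q.quot (φ s)) * jac p.phi s
  let H : Plane → M2 := fun s => p.alphaᵀ * symMat (q.leaf (φ s)) * p.alpha
  -- The transformed potential: its Jacobian is the connection found in `pull_ofReduced`.
  let χ : Plane → Plane := fun s => p.alpha⁻¹ *ᵥ (q.pot (φ s) + p.psi s)
  have hred : (fun s => pull (jac p.phi s) (jac p.psi s) p.alpha (transFamily (q, φ s)))
      = fun s => ofReduced (B s) (jac χ s)ᵀ (H s) := by
    funext s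
    rw [transFamily, pull_ofReduced (symMat_transpose _) (symMat_transpose _) hp.1,
      jac_linear_comp q.smooth_pot sφ p.smooth_psi, jφ]
    simp only [Matrix.transpose_mul, Matrix.transpose_add, B, H]
  have hmem : jet m (fun s => ofReduced (B s) (jac χ s)ᵀ (H s)) p.1 ∈ transitiveJets m := by
    refine mem_transitiveJets (fun t => ?_) (fun t => ?_) ?_ (fun t => ?_) (fun t => ?_) ?_ ?_
    · exact ((MSm.jac p.smooth_phi.contDiffAt).transpose.mul
        (MSm.symMat (q.smooth_quot.comp sφ).contDiffAt)).mul (MSm.jac p.smooth_phi.contDiffAt)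
    · exact ((MSm.const _).mul (MSm.symMat (q.smooth_leaf.comp sφ).contDiffAt)).mul (MSm.const _)
    · exact (LinearMap.toContinuousLinearMap (Matrix.mulVecLin p.alpha⁻¹)).contDiff.comp
        ((q.smooth_pot.comp sφ).add p.smooth_psi)
    · simp only [B, Matrix.transpose_mul, Matrix.transpose_transpose, symMat_transpose,
        Matrix.mul_assoc]
    · simp only [H, Matrix.transpose_mul, Matrix.transpose_transpose, symMat_transpose,
        Matrix.mul_assoc]
    · simp only [B, hφ, Matrix.det_mul, Matrix.det_transpose]
      exact mul_ne_zero (mul_ne_zero hp.2 hq.1) hp.2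
    · simp only [H, hφ, Matrix.det_mul, Matrix.det_transpose]
      exact mul_ne_zero (mul_ne_zero hp.1 hq.2) hp.1
  rw [← hred] at hmem
  exact hmem

lemma nondeg_of_mem_transitiveJets {θ : JetSpace m} (h : θ ∈ transitiveJets m) :
    Nondeg (coef θ 0 0) := by
  obtain ⟨x, Ω, σ, -, hx, hσ, -, rfl⟩ := h
  rw [coef_jet_zero]
  exact hσ.2 _ hx

/-- A metric with constant coefficients has a constant connection, which has a linear potential. -/
lemma transitiveJets_zero : transitiveJets 0 = {θ | Nondeg (coef θ 0 0)} := by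
  refine Set.Subset.antisymm (fun θ h => nondeg_of_mem_transitiveJets h) fun θ hn => ?_
  obtain ⟨hq, hh⟩ := (nondeg_iff _).1 hn
  set c := coef θ 0 0
  let χ : Plane → Plane := fun t => (aMat c)ᵀ *ᵥ t
  have hχ : ∀ t, (jac χ t)ᵀ = aMat c := fun t => by
    have d : HasFDerivAt χ _ t :=
      (LinearMap.toContinuousLinearMap (Matrix.mulVecLin (aMat c)ᵀ)).hasFDerivAt
    rw [← Matrix.transpose_transpose (aMat c)]
    congr 1
    refine Matrix.ext_of_mulVec_single fun i => ?_
    rw [jac_mulVec, d.fderiv]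
    rfl
  have h1 := mem_transitiveJets (m := 0) (B := fun _ => qMat c) (H := fun _ => hMat c) (χ := χ)
    (x := θ.1) (fun t => MSm.const _) (fun t => MSm.const _)
    (LinearMap.toContinuousLinearMap (Matrix.mulVecLin (aMat c)ᵀ)).contDiff
    (fun _ => qMat_transpose c) (fun _ => hMat_transpose c) hq hh
  simp only [hχ, ofReduced_eq hh] at h1
  have h2 : jet 0 (fun _ => c) θ.1 = θ := Prod.ext rfl (funext fun I => by
    rw [← coef_ord θ I, ← coef_ord (jet 0 _ _) I, Unique.eq_default I]
    exact coef_jet_zero (m := 0) (fun _ => c) θ.1)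
  rwa [h2] at h1

end TransitiveInvariance

/-! ### Density of the regular jets. -/

section Density

/-- A perturbation of the derivative of the leaf metric makes it regular. -/
lemma exists_regular_direction {h : M2} (hs : hᵀ = h) (hd : h.det ≠ 0) :
    ∃ κ : Sym2 (Fin 2) → ℝ, ∀ k k' : M2, ∀ᶠ s in 𝓝[≠] (0 : ℝ),
      Regular h ![k + s • symMat κ, k'] := by
  have hs' : h 1 0 = h 0 1 := congrFun (congrFun hs 0) 1
  -- `K` must have a trace part and not be a multiple of `h`. A diagonal matrix unit works when the
  -- other diagonal entry of `h` is nonzero; otherwise `h₀₁ ≠ 0`.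
  obtain ⟨K, hK, ⟨a, b, c, d, h1⟩, h2⟩ : ∃ K : M2, Kᵀ = K ∧
      (∃ a b c d, h a b * K c d ≠ h c d * K a b) ∧ (h.adjugate * K).trace ≠ 0 := by
    by_cases h0 : h 0 0 = 0
    · by_cases h1 : h 1 1 = 0
      · have h2 : h 0 1 ≠ 0 := by
          intro h2
          exact hd (by rw [Matrix.det_fin_two, h0, h2]; ring)
        refine ⟨!![1, 1; 1, 0], ?_, ⟨0, 1, 0, 0, ?_⟩, ?_⟩
        · ext i j; fin_cases i <;> fin_cases j <;> rfl
        · simpa [h0] using h2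
        · simp [Matrix.adjugate_fin_two, Matrix.trace_fin_two, h0, h1, hs']
          intro h3
          exact h2 (by linarith)
      · refine ⟨!![1, 0; 0, 0], ?_, ⟨0, 0, 1, 1, ?_⟩, ?_⟩
        · ext i j; fin_cases i <;> fin_cases j <;> rfl
        · simpa [h0] using Ne.symm h1
        · simpa [Matrix.adjugate_fin_two, Matrix.trace_fin_two, Matrix.mul_apply,
            Fin.sum_univ_two] using h1
    · refine ⟨!![0, 0; 0, 1], ?_, ⟨0, 0, 1, 1, ?_⟩, ?_⟩
      · ext i j; fin_cases i <;> fin_cases j <;> rfl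
      · simpa using h0
      · simpa [Matrix.adjugate_fin_two, Matrix.trace_fin_two, Matrix.mul_apply,
          Fin.sum_univ_two] using h0
  refine ⟨symPart K, fun k k' => ?_⟩
  rw [symMat_symPart hK]
  -- The regularity conditions for the perturbed derivative are affine and nonconstant in `s`, so
  -- each fails for at most one `s`.
  have key : ∀ u v : ℝ, v ≠ 0 → ∀ᶠ s in 𝓝[≠] (0 : ℝ), u + s * v ≠ 0 := fun u v hv => by
    have h3 : ∀ᶠ s in 𝓝[≠] (0 : ℝ), s ≠ -u / v := by
      rcases eq_or_ne (-u / v) 0 with h | h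
      · rw [h]
        exact eventually_mem_nhdsWithin
      · exact eventually_nhdsWithin_of_eventually_nhds (eventually_ne_nhds h.symm)
    filter_upwards [h3] with s hs h4
    refine hs ?_
    rw [eq_div_iff hv]
    linarith
  filter_upwards [key (h.adjugate * k).trace _ h2,
    key (h a b * k c d - h c d * k a b) _ (sub_ne_zero.2 h1)] with s h3 h4
  refine ⟨⟨0, ?_⟩, ⟨0, a, b, c, d, ?_⟩⟩
  · simpa [Matrix.mul_add] using h3
  · intro h5
    refine h4 ?_
    simp only [Matrix.cons_val_zero, Matrix.add_apply, Matrix.smul_apply, smul_eq_mul] at h5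
    linear_combination h5

variable {m : ℕ}

/-- The multi-index `(p, q)`. -/
def idx (p q : ℕ) (h : p + q ≤ m) : MultiIndex m := ⟨(⟨p, by omega⟩, ⟨q, by omega⟩), h⟩

lemma coef_idx (θ : JetSpace m) (p q : ℕ) (h : p + q ≤ m) : coef θ p q = θ.2 (idx p q h) :=
  coef_ord θ (idx p q h)

lemma idx_ne {p q p' q' : ℕ} {h : p + q ≤ m} {h' : p' + q' ≤ m} (hne : (p, q) ≠ (p', q')) :
    idx p q h ≠ idx p' q' h' := fun he => hne (congrArg ord he)

lemma isOpen_regularJet : IsOpen {θ : JetSpace m | RegularJet θ} := by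
  have hh : ∀ p q, Continuous fun θ : JetSpace m => hMat (coef θ p q) := fun p q =>
    continuous_matrix fun i j => (entry 2 i j).continuous.comp (continuous_coef p q)
  have hk : ∀ i, Continuous fun θ : JetSpace m =>
      (![hMat (coef θ 1 0), hMat (coef θ 0 1)] : Fin 2 → M2) i := fun i => by
    fin_cases i
    exacts [hh 1 0, hh 0 1]
  simp only [RegularJet, Regular, Set.ofPred_and, Set.ofPred_exists]
  refine IsOpen.inter (isOpen_iUnion fun i => ?_) (isOpen_iUnion fun i => isOpen_iUnion fun a =>
    isOpen_iUnion fun b => isOpen_iUnion fun c => isOpen_iUnion fun d => ?_)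
  · exact isOpen_ne_fun (((hh 0 0).matrix_adjugate.matrix_mul (hk i)).matrix_trace)
      continuous_const
  · exact isOpen_ne_fun (((hh 0 0).matrix_elem a b).mul ((hk i).matrix_elem c d))
      (((hh 0 0).matrix_elem c d).mul ((hk i).matrix_elem a b))

lemma isOpen_nondegJets : IsOpen {θ : JetSpace m | Nondeg (coef θ 0 0)} :=
  isOpen_nondeg.preimage (continuous_coef 0 0)

/-- Only the coordinates of `∂h/∂t¹` are perturbed, so nondegeneracy, a condition of order zero, is
unaffected. -/
lemma closure_regularJet_intransitive (hm : 1 ≤ m) :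
    {θ : JetSpace m | Nondeg (coef θ 0 0)} ⊆
      closure ({θ | Nondeg (coef θ 0 0)} ∩ {θ | RegularJet θ}) := fun θ hn => by
  obtain ⟨κ, hκ⟩ := exists_regular_direction (hMat_transpose (coef θ 0 0)) hn.2
  let v : JetSpace m := (0, Pi.single (idx 1 0 hm) (0, 0, κ))
  have hc : Continuous fun s : ℝ => θ + s • v :=
    continuous_const.add (continuous_id.smul continuous_const)
  have ht : Tendsto (fun s : ℝ => θ + s • v) (𝓝[≠] 0) (𝓝 θ) := by
    have := (hc.tendsto 0).mono_left (nhdsWithin_le_nhds (s := {0}ᶜ))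
    simpa using this
  have e : ∀ (s : ℝ) (p q : ℕ) (h : p + q ≤ m), coef (θ + s • v) p q
      = coef θ p q + s • (Pi.single (M := fun _ : MultiIndex m => Coeff) (idx 1 0 hm)
        (0, 0, κ)) (idx p q h) := fun s p q h => by
    rw [coef_idx _ p q h, coef_idx _ p q h]
    rfl
  refine mem_closure_of_tendsto ht ?_
  filter_upwards [hκ (hMat (coef θ 1 0)) (hMat (coef θ 0 1))] with s hs
  have e0 : coef (θ + s • v) 0 0 = coef θ 0 0 := by
    rw [e s 0 0 (by omega), Pi.single_eq_of_ne (idx_ne (by simp)), smul_zero, add_zero]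
  have e1 : coef (θ + s • v) 0 1 = coef θ 0 1 := by
    rw [e s 0 1 (by omega), Pi.single_eq_of_ne (idx_ne (by simp)), smul_zero, add_zero]
  have e2 : coef (θ + s • v) 1 0 = coef θ 1 0 + s • (0, 0, κ) := by
    rw [e s 1 0 (by omega), Pi.single_eq_same]
  refine ⟨?_, ?_⟩
  · change Nondeg (coef (θ + s • v) 0 0)
    rwa [e0]
  · change Regular _ _
    rw [e0, e1, e2]
    exact hs

lemma regularJet_transMap_iff (hm : 1 ≤ m) (q : TransParam m) : RegularJet (transMap q) ↔
    Regular (symMat (q.2.2.1 (idx 0 0 (by omega))))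
      ![symMat (q.2.2.1 (idx 1 0 hm)), symMat (q.2.2.1 (idx 0 1 (by omega)))] := by
  have hh : ∀ t, hMat (transFamily (q, t)) = symMat (q.leaf t) := fun t =>
    hMat_ofReduced (symMat_transpose _)
  have hk : (fun i => hMat (pd i (fun t => transFamily (q, t)) q.1.1))
      = ![symMat (q.2.2.1 (idx 1 0 hm)), symMat (q.2.2.1 (idx 0 1 (by omega)))] := by
    funext i
    rw [hMat_pd (transFamily_smooth q).contDiffAt]
    simp only [hh]
    have h1 : mpd i (fun t => symMat (q.leaf t)) q.1.1 = symMat (pd i q.leaf q.1.1) := by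
      ext a b
      exact (pd_clm (ContinuousLinearMap.proj (R := ℝ) (φ := fun _ : Sym2 (Fin 2) => ℝ) s(a, b))
        q.smooth_leaf.contDiffAt i).eq_of_nhds
    rw [h1]
    fin_cases i
    · exact congrArg symMat (pd_iterate_taylor_apply ord_injective q.1.1 q.2.2.1 (idx 1 0 hm))
    · exact congrArg symMat (pd_iterate_taylor_apply ord_injective q.1.1 q.2.2.1
        (idx 0 1 (by omega)))
  rw [transMap_eq, regularJet_jet_iff hm, hk, hh]
  have h0 : q.leaf q.1.1 = q.2.2.1 (idx 0 0 (by omega)) :=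
    pd_iterate_taylor_apply ord_injective q.1.1 q.2.2.1 (idx 0 0 (by omega))
  rw [h0]

/-- The perturbation is made in the parameters of `transMap` rather than in the jet, which keeps it
inside `transitiveJets m`. -/
lemma closure_regularJet_transitive (hm : 1 ≤ m) :
    transitiveJets m ⊆ closure (transitiveJets m ∩ {θ | RegularJet θ}) := by
  rw [transitiveJets_eq]
  rintro _ ⟨q, hq, rfl⟩
  have h0 : q.leaf q.1.1 = q.2.2.1 (idx 0 0 (by omega)) :=
    pd_iterate_taylor_apply ord_injective q.1.1 q.2.2.1 (idx 0 0 (by omega))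
  obtain ⟨κ, hκ⟩ := exists_regular_direction (symMat_transpose (q.leaf q.1.1)) hq.2
  let v : TransParam m := (0, 0, Pi.single (idx 1 0 hm) κ, 0)
  have hc : Continuous fun s : ℝ => q + s • v :=
    continuous_const.add (continuous_id.smul continuous_const)
  have ht : Tendsto (fun s : ℝ => q + s • v) (𝓝[≠] 0) (𝓝 q) := by
    have := (hc.tendsto 0).mono_left (nhdsWithin_le_nhds (s := {0}ᶜ))
    simpa using this
  have hT : Continuous (transMap (m := m)) := (contDiff_jetMap contDiff_transFamily _).continuous
  refine mem_closure_of_tendsto ((hT.tendsto q).comp ht) ?_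
  filter_upwards [hκ (symMat (q.2.2.1 (idx 1 0 hm))) (symMat (q.2.2.1 (idx 0 1 (by omega)))),
    ht.eventually (isOpen_transDomain.mem_nhds hq)] with s hs hd
  refine ⟨⟨_, hd, rfl⟩, (regularJet_transMap_iff hm _).2 ?_⟩
  have e : ∀ I, (q + s • v).2.2.1 I = q.2.2.1 I
      + s • (Pi.single (M := fun _ : MultiIndex m => Sym2 (Fin 2) → ℝ) (idx 1 0 hm) κ) I :=
    fun I => rfl
  have e0 : (q + s • v).2.2.1 (idx 0 0 (by omega)) = q.leaf q.1.1 := by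
    rw [e, Pi.single_eq_of_ne (idx_ne (by simp)), smul_zero, h0]
    exact add_zero _
  have e1 : (q + s • v).2.2.1 (idx 0 1 (by omega)) = q.2.2.1 (idx 0 1 (by omega)) := by
    rw [e, Pi.single_eq_of_ne (idx_ne (by simp)), smul_zero]
    exact add_zero _
  rw [e0, e1, e, Pi.single_eq_same]
  exact hs

end Density

/-! ### Dimension counts and the generic orbit dimensions. -/

section Main

variable {m : ℕ}

lemma transitiveJets_nonempty : (transitiveJets m).Nonempty :=
  ⟨_, mem_transitiveJets (B := fun _ => 1) (H := fun _ => 1) (χ := fun _ => 0) (x := 0)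
    (fun _ => MSm.const _) (fun _ => MSm.const _) contDiff_const (fun _ => Matrix.transpose_one)
    (fun _ => Matrix.transpose_one) (by simp) (by simp)⟩

lemma hasDimension_jetOrbit (hm : 1 ≤ m) {θ : JetSpace m} (hn : Nondeg (coef θ 0 0))
    (hr : RegularJet θ) : HasDimension (jetOrbit m θ) (Module.finrank ℝ (OrbitParam m)) := by
  rw [jetOrbit_eq hn]
  exact hasDimension_image rfl isOpen_orbitDomain (contDiff_jetMap (contDiff_orbitFamily θ) _)
    fun p hp v hv => orbitMap_immersion hm hn hr hp hv

lemma generic_intransitive (hm : 1 ≤ m) {N : ℕ} (hN : Module.finrank ℝ (JetSpace m)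
    = Module.finrank ℝ (OrbitParam m) + N) :
    HasGenericOrbitSpaceDim m (intransitiveJets m) N := by
  rw [intransitiveJets_eq]
  refine ⟨transitiveJets_nonempty.mono fun θ => nondeg_of_mem_transitiveJets, _, _,
    {θ | Nondeg (coef θ 0 0)} ∩ {θ | RegularJet θ}, hasDimension_of_isOpen rfl isOpen_nondegJets,
    ⟨_, isOpen_regularJet, rfl⟩, closure_regularJet_intransitive hm, ?_,
    fun θ hθ => hasDimension_jetOrbit hm hθ.1 hθ.2, hN⟩
  rintro θ ⟨hn, hr⟩ θ' h
  obtain ⟨p, hp, rfl⟩ := jetOrbit_subset h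
  exact ⟨nondeg_orbitMap hn hp, regularJet_orbitMap hm hn hr hp⟩

lemma generic_transitive (hm : 1 ≤ m) {N : ℕ} (hN : Module.finrank ℝ (TransParam m)
    = Module.finrank ℝ (OrbitParam m) + N) :
    HasGenericOrbitSpaceDim m (transitiveJets m) N := by
  refine ⟨transitiveJets_nonempty, _, _, transitiveJets m ∩ {θ | RegularJet θ}, ?_,
    ⟨_, isOpen_regularJet, rfl⟩, closure_regularJet_transitive hm, ?_,
    fun θ hθ => hasDimension_jetOrbit hm (nondeg_of_mem_transitiveJets hθ.1) hθ.2, hN⟩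
  · rw [transitiveJets_eq]
    exact hasDimension_image rfl isOpen_transDomain (contDiff_jetMap contDiff_transFamily _)
      fun p hp v hv => transMap_immersion hp hv
  · rintro θ ⟨hθ, hr⟩ θ' h
    obtain ⟨p, hp, rfl⟩ := jetOrbit_subset h
    exact ⟨orbitMap_mem_transitiveJets hθ hp,
      regularJet_orbitMap hm (nondeg_of_mem_transitiveJets hθ) hr hp⟩

/-- Open orbits have the full dimension of the jet space; no regularity is needed, so the invariant
dense set is the whole space. -/
lemma generic_zero : HasGenericOrbitSpaceDim 0 {θ | Nondeg (coef θ 0 0)} 0 := by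
  refine ⟨transitiveJets_nonempty.mono fun θ => nondeg_of_mem_transitiveJets, _, _,
    {θ | Nondeg (coef θ 0 0)}, hasDimension_of_isOpen rfl isOpen_nondegJets,
    ⟨Set.univ, isOpen_univ, (Set.inter_univ _).symm⟩, subset_closure, ?_,
    fun θ hθ => hasDimension_of_isOpen rfl (isOpen_jetOrbit_zero hθ), rfl⟩
  intro θ hn θ' h
  obtain ⟨p, hp, rfl⟩ := jetOrbit_subset h
  exact nondeg_orbitMap hn hp

lemma card_sym2 : Fintype.card (Sym2 (Fin 2)) = 3 := by decide

lemma finrank_jetSpace : Module.finrank ℝ (JetSpace m) = 4 + 10 * Fintype.card (MultiIndex m) := by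
  simp [Module.finrank_prod, Module.finrank_pi_fintype, card_sym2]
  ring

/-- `8` counts the point and `α`; each multi-index contributes two components of `φ` and two of `ψ`.
-/
lemma finrank_orbitParam :
    Module.finrank ℝ (OrbitParam m) = 8 + 4 * Fintype.card (PosIndex m) := by
  simp [Module.finrank_prod, Module.finrank_pi_fintype]
  ring

lemma finrank_transParam : Module.finrank ℝ (TransParam m)
    = 4 + 6 * Fintype.card (MultiIndex m) + 2 * Fintype.card (PosIndex m) := by
  simp [Module.finrank_prod, Module.finrank_pi_fintype, card_sym2]
  ring

lemma card_multiIndex : Fintype.card (MultiIndex 1) = 3 ∧ Fintype.card (MultiIndex 2) = 6 := by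
  decide

lemma card_posIndex : Fintype.card (PosIndex 1) = 5 ∧ Fintype.card (PosIndex 2) = 9 := by
  decide

end Main

end GTwo

end

theorem mainTheorem5 :
    (GTwo.HasGenericOrbitSpaceDim 0 (GTwo.intransitiveJets 0) 0 ∧
      GTwo.HasGenericOrbitSpaceDim 1 (GTwo.intransitiveJets 1) 6 ∧
      GTwo.HasGenericOrbitSpaceDim 2 (GTwo.intransitiveJets 2) 20) ∧
    (GTwo.HasGenericOrbitSpaceDim 0 (GTwo.transitiveJets 0) 0 ∧
      GTwo.HasGenericOrbitSpaceDim 1 (GTwo.transitiveJets 1) 4 ∧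
      GTwo.HasGenericOrbitSpaceDim 2 (GTwo.transitiveJets 2) 14) := by
  obtain ⟨a1, a2⟩ := GTwo.card_multiIndex
  obtain ⟨b1, b2⟩ := GTwo.card_posIndex
  refine ⟨⟨?_, ?_, ?_⟩, ?_, ?_, ?_⟩
  · rw [GTwo.intransitiveJets_eq]
    exact GTwo.generic_zero
  -- Here `34 = 28 + 6`, and for second order `64 = 44 + 20`.
  · exact GTwo.generic_intransitive le_rfl
      (by rw [GTwo.finrank_jetSpace, GTwo.finrank_orbitParam, a1, b1])
  · exact GTwo.generic_intransitive one_le_two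
      (by rw [GTwo.finrank_jetSpace, GTwo.finrank_orbitParam, a2, b2])
  · rw [GTwo.transitiveJets_zero]
    exact GTwo.generic_zero
  -- Here `32 = 28 + 4`, and for second order `58 = 44 + 14`.
  · exact GTwo.generic_transitive le_rfl
      (by rw [GTwo.finrank_transParam, GTwo.finrank_orbitParam, a1, b1])
  · exact GTwo.generic_transitive one_le_two
      (by rw [GTwo.finrank_transParam, GTwo.finrank_orbitParam, a2, b2])
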